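/- Let $\mathsf T$ be a rigidly-compactly generated tensor-triangulated category, i.e. a triangulated category with small coproducts and a closed symmetric monoidal structure $(\otimes,\mathbb 1,\underline{\mathrm{Hom}})$ whose tensor product is exact in both variables, such that the full subcategory $\mathsf T^c$ of compact objects is essentially small and generates $\mathsf T$ (if $\mathrm{Hom}(C,X)=0$ for all $C\in\mathsf T^c$ then $X=0$), and such that the compact objects are exactly the rigid ones (those $X$ for which $\underline{\mathrm{Hom}}(X,\mathbb 1)\otimes Y\to\underline{\mathrm{Hom}}(X,Y)$ is an isomorphism for all $Y$). Let $\mathrm{Mod}\,\mathsf T^c$ be the category of additive functors $(\mathsf T^c)^{op}\to\mathrm{Ab}$, let $y\colon\mathsf T\to\mathrm{Mod}\,\mathsf T^c$, $yX=\mathrm{Hom}_{\mathsf T}(-,X)|_{\mathsf T^c}$, be the restricted Yoneda functor, and let $\mathrm{mod}\,\mathsf T^c$ be the full subcategory of the functors isomorphic to $\mathrm{coker}(y\alpha)$ for a map $\alpha$ of compact objects, with the Day convolution product $\otimes$. The homological spectrum $\mathrm{Spc}^h(\mathsf T^c)$ is the set of maximal proper Serre $\otimes$-ideals $\mathcal B$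 of $\mathrm{mod}\,\mathsf T^c$. For such $\mathcal B$, let $Q\colon\mathrm{Mod}\,\mathsf T^c\to\mathrm{Mod}\,\mathsf T^c/\varinjlim\mathcal B$ be the Gabriel quotient by the class of filtered colimits of objects of $\mathcal B$, let $R$ be its right adjoint, and let $E_{\mathcal B}\in\mathsf T$ be the pure injective object (unique up to isomorphism) with $yE_{\mathcal B}\cong R(E(Qy\mathbb 1))$, where $E(-)$ is the injective hull. The topology of $\mathrm{Spc}^h(\mathsf T^c)$ has as a basis of closed sets the sets $\mathrm{supp}^h(x)=\{\mathcal B:\underline{\mathrm{Hom}}(x,E_{\mathcal B})\neq 0\}$, $x\in\mathsf T^c$. The Balmer spectrum $\mathrm{Spc}(\mathsf T^c)$ is the set of prime thick $\otimes$-ideals $\mathcal P\subsetneq\mathsf T^c$, with basis of closed sets $\{\mathcal P: x\notin\mathcal P\}$, $x\in\mathsf T^c$. Then $\phi(\mathcal B)=y^{-1}(\mathcal B)=\{C\in\mathsf T^c: yC\in\mathcal B\}$ is a well-defined continuous map $\phi\colon\mathrm{Spc}^h(\mathsf T^c)\to\mathrm{Spc}(\mathsf T^c)$, and $\phi$ is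 injective if and only if $\mathrm{Spc}^h(\mathsf T^c)$ is a $T_0$-space. -/

import Mathlib

open CategoryTheory CategoryTheory.Limits CategoryTheory.MonoidalCategory
open CategoryTheory.Pretriangulated Opposite

universe v u

namespace HomSpec

noncomputable section

/-! ### Additive functors form an abelian category -/

section AdditiveFunctors

variable (C : Type*) [Category* C] [Preadditive C] (D : Type*) [Category* D] [Abelian D]

instance : (additiveFunctor C D).IsClosedUnderSubobjects where
  prop_of_mono {F G} i _ hG := by
    have : G.Additive := hG
    refine ⟨fun {X Y f g} => ?_⟩
    rw [← cancel_mono (i.app Y)]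
    simp [Preadditive.add_comp, Preadditive.comp_add]

instance : (additiveFunctor C D).IsClosedUnderQuotients where
  prop_of_epi {F G} p _ hF := by
    have : F.Additive := hF
    refine ⟨fun {X Y f g} => ?_⟩
    rw [← cancel_epi (p.app X)]
    simp only [← NatTrans.naturality, Preadditive.comp_add, Functor.map_add, Preadditive.add_comp]

instance : (additiveFunctor C D).ContainsZero where
  exists_zero := ⟨(HasZeroObject.zero' (C ⥤ D)).1, isZero_zero _,
    ⟨fun {_ Y _ _} => (Functor.isZero_iff _ |>.1 (isZero_zero (C ⥤ D)) Y).eq_of_tgt _ _⟩⟩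

instance : (additiveFunctor C D).IsClosedUnderFiniteProducts where
  isClosedUnderLimitsOfShape J _ := ⟨by
    rintro G ⟨pres⟩
    refine ⟨fun {X Y f g} => ?_⟩
    refine (isLimitOfPreserves ((evaluation C D).obj Y) pres.isLimit).hom_ext fun j => ?_
    have : (pres.diag.obj j).Additive := pres.prop_diag_obj j
    have h : ∀ k : X ⟶ Y, G.map k ≫ (pres.π.app j).app Y =
        (pres.π.app j).app X ≫ (pres.diag.obj j).map k := fun k => (pres.π.app j).naturality k
    have := h (f + g)
    simp [Preadditive.add_comp, h]⟩

instance : Abelian (C ⥤+ D) := inferInstanceAs (Abelian (additiveFunctor C D).FullSubcategory)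

end AdditiveFunctors

/-! ### Rigidly-compactly generated tensor-triangulated categories -/

section Basic

variable (T : Type u) [Category.{v} T] [Preadditive T]

/-- The compact objects: those `X` for which `Hom(X, -)` preserves coproducts. -/
def isCompact : ObjectProperty T := fun X =>
  ∀ J : Type v, PreservesColimitsOfShape (Discrete J) (preadditiveCoyoneda.obj (op X))

/-- The full subcategory `Tᶜ` of compact objects. -/
abbrev Cpt := (isCompact T).FullSubcategory

/-- The category `Mod Tᶜ` of additive functors `(Tᶜ)ᵒᵖ ⥤ Ab`. -/
abbrev Modc := (Cpt T)ᵒᵖ ⥤+ AddCommGrpCat.{v}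

/-- The restricted Yoneda functor `y : T ⥤ Mod Tᶜ`, `X ↦ Hom(-, X)` restricted to `Tᶜ`. -/
def yo : T ⥤ Modc T :=
  ObjectProperty.lift _
    (preadditiveYoneda ⋙ (Functor.whiskeringLeft _ _ _).obj (isCompact T).ι.op)
    (fun X => by
      dsimp
      exact (inferInstance : ((isCompact T).ι.op ⋙ preadditiveYoneda.obj X).Additive))

/-- `mod Tᶜ`: the functors isomorphic to the cokernel of `y α` for some map `α` of compact
objects. -/
def isFP : ObjectProperty (Modc T) := fun F =>
  ∃ (A B : Cpt T) (α : A.obj ⟶ B.obj), Nonempty (cokernel ((yo T).map α) ≅ F)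

end Basic

section Tensor

variable (T : Type u) [Category.{v} T] [MonoidalCategory T] [MonoidalClosed T]

/-- The natural map `[X, 𝟙] ⊗ Y ⟶ [X, Y]`. -/
def rigidityMap (X Y : T) : (ihom X).obj (𝟙_ T) ⊗ Y ⟶ (ihom X).obj Y :=
  MonoidalClosed.curry
    ((α_ X ((ihom X).obj (𝟙_ T)) Y).inv ≫ ((ihom.ev X).app (𝟙_ T) ▷ Y) ≫ (λ_ Y).hom)

lemma rigidityMap_naturality (X : T) {Y Z : T} (f : Y ⟶ Z) :
    _ ◁ f ≫ rigidityMap T X Z = rigidityMap T X Y ≫ (ihom X).map f := by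
  rw [rigidityMap, rigidityMap, ← MonoidalClosed.curry_natural_left,
    ← MonoidalClosed.curry_natural_right]
  congr 1
  simp only [Category.assoc, ← leftUnitor_naturality, whisker_exchange_assoc,
    associator_inv_naturality_right_assoc]
  rfl

/-- The rigid objects: those `X` for which `[X, 𝟙] ⊗ Y ⟶ [X, Y]` is invertible for all `Y`. -/
def isRigid : ObjectProperty T := fun X => ∀ Y, IsIso (rigidityMap T X Y)

end Tensor

variable (T : Type u) [Category.{v} T] [Preadditive T] [HasZeroObject T] [HasShift T ℤ]
  [∀ n : ℤ, (shiftFunctor T n).Additive] [Pretriangulated T] [IsTriangulated T]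
  [MonoidalCategory T] [SymmetricCategory T] [MonoidalClosed T]

/-- A triangulated category with a closed symmetric monoidal structure is a
rigidly-compactly generated tensor-triangulated category if the tensor product is exact in both
variables, `T` has coproducts and is generated by its compact objects, of which there is only a set
up to isomorphism, and the compact objects are exactly the rigid ones. (The internal hom is then
exact in its second variable, as a right adjoint; its exactness in the first variable is often
required as well, and is not needed here.) -/
class IsRigidlyCompactlyGenerated : Prop where
  hasCoproducts : HasCoproducts.{v} T
  exact_tensorLeft (X : T) : ∃ _ : (tensorLeft X).CommShift ℤ, (tensorLeft X).IsTriangulated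
  exact_tensorRight (X : T) : ∃ _ : (tensorRight X).CommShift ℤ, (tensorRight X).IsTriangulated
  essentiallySmall : EssentiallySmall.{v} (Cpt T)
  isZero_of_compact (X : T) : (∀ C : T, isCompact T C → ∀ f : C ⟶ X, f = 0) → IsZero X
  compact_iff_rigid (X : T) : isCompact T X ↔ isRigid T X

variable [IsRigidlyCompactlyGenerated T]

instance : (isCompact T).IsMonoidal where
  prop_unit := by
    rw [IsRigidlyCompactlyGenerated.compact_iff_rigid]
    intro Y
    have h1 : (tensorLeft (𝟙_ T)).IsEquivalence :=
      Functor.isEquivalence_of_iso (leftUnitorNatIso T).symm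
    have h2 : (ihom (𝟙_ T)).IsEquivalence :=
      (ihom.adjunction (𝟙_ T)).isEquivalence_right_of_isEquivalence_left
    have h3 : IsIso ((ihom.ev (𝟙_ T)).app (𝟙_ T)) :=
      inferInstanceAs (IsIso ((ihom.adjunction (𝟙_ T)).counit.app (𝟙_ T)))
    have h4 : IsIso ((ihom.coev (𝟙_ T)).app ((ihom (𝟙_ T)).obj (𝟙_ T) ⊗ Y)) :=
      inferInstanceAs (IsIso ((ihom.adjunction (𝟙_ T)).unit.app _))
    rw [rigidityMap, MonoidalClosed.curry_eq]
    infer_instance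
  prop_tensor X Y hX hY J := by
    have hX' := (IsRigidlyCompactlyGenerated.compact_iff_rigid X).1 hX
    obtain ⟨_, _⟩ := IsRigidlyCompactlyGenerated.exact_tensorLeft X
    have hadd : (tensorLeft X).Additive := inferInstance
    let e : tensorLeft ((ihom X).obj (𝟙_ T)) ≅ ihom X :=
      NatIso.ofComponents (fun Z => @asIso _ _ _ _ (rigidityMap T X Z) (hX' Z))
        (fun f => rigidityMap_naturality T X f)
    have : PreservesColimitsOfShape (Discrete J) (ihom X) := preservesColimitsOfShape_of_natIso e
    have := hY J
    let e' : ihom X ⋙ preadditiveCoyoneda.obj (op Y) ≅ preadditiveCoyoneda.obj (op (X ⊗ Y)) :=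
      NatIso.ofComponents
        (fun Z => ((ihom.adjunction X).homAddEquiv Y Z).symm.toAddCommGrpIso)
        (fun {Z W} f => by
          ext g
          exact MonoidalClosed.uncurry_natural_right g f)
    exact preservesColimitsOfShape_of_natIso e'

variable {T}

/-- A bilinear pairing `F × G → H`: a family of biadditive maps `F(a) × G(b) → H(a ⊗ b)` natural
in the compact objects `a` and `b`. -/
structure Pairing (F G H : Modc T) where
  map (a b : Cpt T) : F.obj.obj (op a) →+ G.obj.obj (op b) →+ H.obj.obj (op (a ⊗ b))
  naturality {a a' b b' : Cpt T} (f : a ⟶ a') (g : b ⟶ b')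
      (x : F.obj.obj (op a')) (y : G.obj.obj (op b')) :
    map a b (F.obj.map f.op x) (G.obj.map g.op y) = H.obj.map (f ⊗ₘ g).op (map a' b' x y)

/-- `H` is a Day convolution product `F ⊗ G` in `Mod Tᶜ`: it carries a universal bilinear
pairing. -/
def IsDayTensor (F G H : Modc T) : Prop :=
  ∃ β : Pairing F G H, ∀ (K : Modc T) (γ : Pairing F G K),
    ∃! φ : H ⟶ K, ∀ (a b : Cpt T) (x : F.obj.obj (op a)) (y : G.obj.obj (op b)),
      φ.hom.app (op (a ⊗ b)) (β.map a b x y) = γ.map a b x y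

/-- A Serre `⊗`-ideal of `mod Tᶜ`. -/
structure IsSerreTensorIdeal (S : ObjectProperty (Modc T)) : Prop where
  le_isFP : S ≤ isFP T
  containsZero : S.ContainsZero
  serre (E : ShortComplex (Modc T)) (hE : E.ShortExact)
    (h₁ : isFP T E.X₁) (h₂ : isFP T E.X₂) (h₃ : isFP T E.X₃) : S E.X₂ ↔ S E.X₁ ∧ S E.X₃
  tensor (F G H : Modc T) (hF : isFP T F) (hG : S G) (hH : IsDayTensor F G H) : S H

variable (T) in
/-- The homological primes: maximal proper Serre `⊗`-ideals of `mod Tᶜ`. These are the points of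
the homological spectrum. -/
@[ext]
structure HomologicalSpectrum where
  carrier : ObjectProperty (Modc T)
  isIdeal : IsSerreTensorIdeal carrier
  proper : carrier ≠ isFP T
  maximal (S : ObjectProperty (Modc T)) (hS : IsSerreTensorIdeal S) (hS' : S ≠ isFP T)
    (h : carrier ≤ S) : S = carrier

/-- The morphisms of `Mod Tᶜ` whose kernel and cokernel are filtered colimits of objects of `S`. -/
def isoMod (S : ObjectProperty (Modc T)) : MorphismProperty (Modc T) := fun _ _ f =>
  ObjectProperty.ind.{v} S (kernel f) ∧ ObjectProperty.ind.{v} S (cokernel f)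

/-- The Gabriel quotient of `Mod Tᶜ` by the filtered colimits of objects of `S`; for a homological
prime, this is its homological residue field. -/
abbrev GabrielQuotient (S : ObjectProperty (Modc T)) := (isoMod S).Localization

/-- `i : X ⟶ J` is an injective hull: an essential monomorphism to an injective object. -/
structure IsInjectiveHull {C : Type*} [Category* C] {X J : C} (i : X ⟶ J) : Prop where
  mono : Mono i
  injective : Injective J
  essential {Z : C} (g : J ⟶ Z) : Mono (i ≫ g) → Mono g

/-- `E` is the pure injective object `E_S` attached to `S`: `y E` is isomorphic to the image under
the right adjoint `R` of the quotient functor `Q` of an injective hull of `Q (y 𝟙)`. -/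
def IsResidueObject (S : ObjectProperty (Modc T)) (E : T) : Prop :=
  Injective ((yo T).obj E) ∧
  ∃ (R : GabrielQuotient S ⥤ Modc T) (_ : (isoMod S).Q ⊣ R)
    (J : GabrielQuotient S) (i : (isoMod S).Q.obj ((yo T).obj (𝟙_ T)) ⟶ J),
    IsInjectiveHull i ∧ Nonempty ((yo T).obj E ≅ R.obj J)

/-- The homological support of `x`: the homological primes `B` with `[x, E_B] ≠ 0`. -/
def homologicalSupport (x : T) : Set (HomologicalSpectrum T) :=
  {B | ∃ E : T, IsResidueObject B.carrier E ∧ ¬ IsZero ((ihom x).obj E)}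

/-- The topology whose closed sets are generated by the supports of compact objects. -/
instance : TopologicalSpace (HomologicalSpectrum T) :=
  TopologicalSpace.generateFrom {U | ∃ x : Cpt T, U = (homologicalSupport x.obj)ᶜ}

variable (T) in
/-- The points of the Balmer spectrum of `Tᶜ`: the prime thick `⊗`-ideals of `Tᶜ`. -/
@[ext]
structure BalmerSpectrum where
  carrier : ObjectProperty T
  le_isCompact : carrier ≤ isCompact T
  triangulated : carrier.IsTriangulated
  thick : carrier.IsStableUnderRetracts
  tensor (a b : T) (ha : isCompact T a) (hb : carrier b) : carrier (a ⊗ b)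
  proper : carrier ≠ isCompact T
  prime (a b : T) (ha : isCompact T a) (hb : isCompact T b) (h : carrier (a ⊗ b)) :
    carrier a ∨ carrier b

/-- The support of `x` in the Balmer spectrum: the primes not containing `x`. -/
def balmerSupport (x : T) : Set (BalmerSpectrum T) := {P | ¬ P.carrier x}

/-- The topology whose closed sets are generated by the supports of compact objects. -/
instance : TopologicalSpace (BalmerSpectrum T) :=
  TopologicalSpace.generateFrom {U | ∃ x : Cpt T, U = (balmerSupport x.obj)ᶜ}

/-- `φ` is the comparison map `B ↦ y⁻¹(B) = {C ∈ Tᶜ | y C ∈ B}`. -/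
def IsComparisonMap (φ : HomologicalSpectrum T → BalmerSpectrum T) : Prop :=
  ∀ (B : HomologicalSpectrum T) (C : T),
    (φ B).carrier C ↔ isCompact T C ∧ B.carrier ((yo T).obj C)

end

end HomSpec

/-! The topology of the homological spectrum is pulled back from the Balmer spectrum along `φ`: the
support of `x` upstairs is the preimage of the support of `x` downstairs as soon as `[x, E_B] ≠ 0`
is equivalent to `y x ∉ B` (`mem_homologicalSupport_iff`). So `φ` is inducing, and two homological
primes are inseparable exactly when their images are. The Balmer spectrum is `T₀`, because the
supports of compact objects separate primes. Hence inseparable homological primes are those with the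
same image under `φ`, and `T₀` upstairs means that `φ` is injective.

The equivalence comes from describing `B` through an injective object. For an injective `I` in `Mod
Tᶜ`, the finitely presented functors without nonzero maps to any twist `I(c ⊗ -)` form a Serre
tensor ideal (`isSerreTensorIdeal_annIdeal`). If `I` is nonzero this ideal is proper, and if `I` is
torsion-free for `B` it contains `B`; by maximality it then equals `B`
(`HomologicalSpectrum.carrier_eq_annIdeal`). With `I = y E`, this says that `y x ∈ B` if and only if
every map `c ⊗ x ⟶ E` with `c` compact vanishes, that is, `[x, E] = 0` by compact generation. The
same test shows that `y⁻¹(B)` is a prime thick tensor ideal.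

Two constructions supply `E`. The Gabriel quotient is realised on local objects, which gives the
right adjoint and a torsion-free injective `I` corresponding to the hull of `Q (y 𝟙)`
(`exists_injectiveHull_localization`); and every injective presheaf is `y E` for some `E`, by
Brown's telescope construction (`exists_yo_iso_of_injective`). Tensor ideals become tractable by
rigidity: the Day product of `F` with `y d` is the twist of `F` by the dual of `d`
(`isUniversal_twPairing`). -/

set_option linter.unusedSectionVars false

namespace HomSpec

noncomputable section

/-! ### Sections, Yoneda and exactness for additive presheaves -/

section AdditivePresheaves

variable {C : Type u} [Category.{v} C] [Preadditive C]

/-- The category of additive functors `Cᵒᵖ ⥤ Ab`. -/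
abbrev AddPsh (C : Type u) [Category.{v} C] [Preadditive C] := Cᵒᵖ ⥤+ AddCommGrpCat.{v}

namespace AddPsh

/-- The sections of an additive presheaf over an object. -/
abbrev sec (F : AddPsh C) (c : C) : Type v := F.obj.obj (op c)

/-- Restriction of sections. -/
def res (F : AddPsh C) {c d : C} (f : c ⟶ d) : F.sec d →+ F.sec c := (F.obj.map f.op).hom

/-- The map on sections induced by a morphism. -/
def ap {F G : AddPsh C} (φ : F ⟶ G) (c : C) : F.sec c →+ G.sec c := (φ.hom.app (op c)).hom

section
variable (F : AddPsh C) {c d e : C}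

@[simp] lemma res_id (x : F.sec c) : F.res (𝟙 c) x = x := by
  simp [res]

lemma res_comp (f : c ⟶ d) (g : d ⟶ e) (x : F.sec e) : F.res (f ≫ g) x = F.res f (F.res g x) := by
  simp [res]

lemma res_add (f g : c ⟶ d) (x : F.sec d) : F.res (f + g) x = F.res f x + F.res g x := by
  have : F.obj.map (f + g).op = F.obj.map f.op + F.obj.map g.op := by
    rw [op_add, Functor.map_add]
  exact congr_arg (fun φ => φ.hom x) this

/-- Restriction of a section is additive in the morphism. -/
def resHom (c : C) (x : F.sec d) : (c ⟶ d) →+ F.sec c :=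
  AddMonoidHom.mk' (fun f => F.res f x) fun f g => F.res_add f g x

@[simp] lemma resHom_apply (x : F.sec d) (f : c ⟶ d) : F.resHom c x f = F.res f x := rfl

@[simp] lemma res_zero (x : F.sec d) : F.res (0 : c ⟶ d) x = 0 := (F.resHom c x).map_zero
end

section
variable {F G H : AddPsh C} {c d : C}

@[simp] lemma ap_id (x : F.sec c) : ap (𝟙 F) c x = x := rfl
@[simp] lemma ap_comp (φ : F ⟶ G) (ψ : G ⟶ H) (x : F.sec c) :
    ap (φ ≫ ψ) c x = ap ψ c (ap φ c x) := rfl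
@[simp] lemma ap_zero (x : F.sec c) : ap (0 : F ⟶ G) c x = 0 := rfl
@[simp] lemma ap_add (φ ψ : F ⟶ G) (x : F.sec c) : ap (φ + ψ) c x = ap φ c x + ap ψ c x := rfl

lemma ap_res (φ : F ⟶ G) (f : c ⟶ d) (x : F.sec d) : ap φ c (F.res f x) = G.res f (ap φ d x) :=
  NatTrans.naturality_apply φ.hom f.op x

lemma ext {φ ψ : F ⟶ G} (h : ∀ c x, ap φ c x = ap ψ c x) : φ = ψ := by
  apply ObjectProperty.hom_ext
  ext ⟨c⟩ x
  exact h c x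

/-- A morphism of additive presheaves from its maps on sections. -/
def mkHom (φ : ∀ c, F.sec c →+ G.sec c)
    (h : ∀ {c d : C} (f : c ⟶ d) (x : F.sec d), φ c (F.res f x) = G.res f (φ d x)) : F ⟶ G :=
  ⟨{ app := fun c => AddCommGrpCat.ofHom (φ c.unop)
     naturality := fun c d f => by
      ext x
      exact h f.unop x }⟩

/-- An additive presheaf from its groups of sections and restriction maps. -/
def mk' (S : C → Type v) [∀ c, AddCommGroup (S c)] (r : ∀ {c d : C}, (c ⟶ d) → (S d →+ S c))
    (hid : ∀ c x, r (𝟙 c) x = x)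
    (hcomp : ∀ {c d e : C} (f : c ⟶ d) (g : d ⟶ e) (x : S e), r (f ≫ g) x = r f (r g x))
    (hadd : ∀ {c d : C} (f g : c ⟶ d) (x : S d), r (f + g) x = r f x + r g x) : AddPsh C :=
  ⟨{ obj := fun c => AddCommGrpCat.of (S c.unop)
     map := fun f => AddCommGrpCat.ofHom (r f.unop)
     map_id := fun c => by ext x; exact hid _ x
     map_comp := fun f g => by ext x; exact hcomp _ _ x }, ⟨fun {_ _ f g} => by
      ext x; exact hadd f.unop g.unop x⟩⟩

lemma isIso_of_bijective (φ : F ⟶ G) (h : ∀ c, Function.Bijective (ap φ c)) : IsIso φ := by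
  let e (c : C) : F.sec c ≃+ G.sec c := AddEquiv.ofBijective (ap φ c) (h c)
  have he (c : C) (x : G.sec c) : ap φ c ((e c).symm x) = x := (e c).apply_symm_apply x
  refine ⟨mkHom (fun c => (e c).symm.toAddMonoidHom) ?_, ?_, ?_⟩
  · intro c d f x
    apply (h c).1
    rw [ap_res]
    exact (he c _).trans (congr_arg (G.res f) (he d x).symm)
  · exact ext fun c x => (e c).symm_apply_apply x
  · exact ext fun c x => he c x

lemma mono_of_injective (φ : F ⟶ G) (h : ∀ c, Function.Injective (ap φ c)) : Mono φ :=
  ⟨fun a b hab => ext fun c x => h c (by rw [← ap_comp, hab, ap_comp])⟩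

lemma epi_of_surjective (φ : F ⟶ G) (h : ∀ c, Function.Surjective (ap φ c)) : Epi φ :=
  ⟨fun a b hab => ext fun c x => by
    obtain ⟨y, rfl⟩ := h c x
    rw [← ap_comp, hab, ap_comp]⟩

end

/-- The additive presheaf represented by an object. -/
def rep (c : C) : AddPsh C :=
  ⟨preadditiveYoneda.obj c, (inferInstance : (preadditiveYoneda.obj c).Additive)⟩

/-- A morphism as a section of a representable presheaf. -/
def repSec {c d : C} (f : d ⟶ c) : (rep c).sec d := f

lemma res_repSec {c d e : C} (f : d ⟶ c) (g : e ⟶ d) : (rep c).res g (repSec f) = repSec (g ≫ f) :=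
  rfl

/-- The Yoneda map of a section. -/
def ofSec {F : AddPsh C} {c : C} (x : F.sec c) : rep c ⟶ F :=
  mkHom (F := rep c) (fun d => F.resHom d x) (fun {_ _} f g => F.res_comp f g x)

@[simp] lemma ap_ofSec {F : AddPsh C} {c d : C} (x : F.sec c) (f : d ⟶ c) :
    ap (ofSec x) d (repSec f) = F.res f x := rfl

lemma rep_ext {F : AddPsh C} {c : C} {φ ψ : rep c ⟶ F}
    (h : ap φ c (repSec (𝟙 c)) = ap ψ c (repSec (𝟙 c))) : φ = ψ := by
  refine ext fun d (f : d ⟶ c) => ?_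
  have := res_repSec (𝟙 c) f
  rw [Category.comp_id] at this
  change ap φ d (repSec f) = ap ψ d (repSec f)
  rw [← this, ap_res, ap_res, h]

lemma ofSec_comp {F G : AddPsh C} {c : C} (x : F.sec c) (φ : F ⟶ G) :
    ofSec x ≫ φ = ofSec (ap φ c x) :=
  rep_ext (by simp)

lemma ofSec_injective {F : AddPsh C} {c : C} {x y : F.sec c} (h : ofSec x = ofSec y) : x = y := by
  have := congr_arg (fun φ => ap φ c (repSec (𝟙 c))) h
  simpa using this

/-- By Yoneda a section is a map out of a representable, and a monomorphism cancels such maps. -/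
lemma injective_of_mono {F G : AddPsh C} (φ : F ⟶ G) [Mono φ] (c : C) :
    Function.Injective (ap φ c) := fun x y h => by
  apply ofSec_injective
  rw [← cancel_mono φ, ofSec_comp, ofSec_comp, h]

/-- An additive subpresheaf. -/
@[ext]
structure Sub (F : AddPsh C) where
  carrier (c : C) : AddSubgroup (F.sec c)
  res_mem {c d : C} (f : c ⟶ d) {x : F.sec d} : x ∈ carrier d → F.res f x ∈ carrier c

namespace Sub
variable {F G : AddPsh C}

instance : PartialOrder (Sub F) where
  le N M := ∀ c, N.carrier c ≤ M.carrier c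
  le_refl _ _ := le_rfl
  le_trans _ _ _ h h' c := (h c).trans (h' c)
  le_antisymm _ _ h h' := Sub.ext (funext fun c => le_antisymm (h c) (h' c))

/-- The presheaf underlying a subpresheaf. -/
def obj (N : Sub F) : AddPsh C :=
  mk' (fun c => N.carrier c)
    (fun {_ d} f => ((F.res f).comp (N.carrier d).subtype).codRestrict _
      fun x => N.res_mem f x.2)
    (fun _ x => Subtype.ext (F.res_id x.1)) (fun f g x => Subtype.ext (F.res_comp f g x.1))
    (fun f g x => Subtype.ext (F.res_add f g x.1))

/-- The inclusion of a subpresheaf. -/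
def ι (N : Sub F) : N.obj ⟶ F := mkHom (F := N.obj) (fun c => (N.carrier c).subtype) fun _ _ => rfl

/-- The quotient by a subpresheaf. -/
def quot (N : Sub F) : AddPsh C :=
  mk' (fun c => F.sec c ⧸ N.carrier c)
    (fun {c d} f => QuotientAddGroup.map _ _ (F.res f) fun _ hx => N.res_mem f hx)
    (fun c x => by
      obtain ⟨x, rfl⟩ := QuotientAddGroup.mk'_surjective _ x
      exact congr_arg (QuotientAddGroup.mk' _) (F.res_id x))
    (fun f g x => by
      obtain ⟨x, rfl⟩ := QuotientAddGroup.mk'_surjective _ x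
      exact congr_arg (QuotientAddGroup.mk' _) (F.res_comp f g x))
    (fun f g x => by
      obtain ⟨x, rfl⟩ := QuotientAddGroup.mk'_surjective _ x
      exact congr_arg (QuotientAddGroup.mk' _) (F.res_add f g x))

/-- The projection to the quotient by a subpresheaf. -/
def π (N : Sub F) : F ⟶ N.quot :=
  mkHom (G := N.quot) (fun c => QuotientAddGroup.mk' (N.carrier c)) fun _ _ => rfl

lemma ι_mem (N : Sub F) (c : C) (x : N.obj.sec c) : ap N.ι c x ∈ N.carrier c :=
  (show N.carrier c from x).2

lemma ι_injective (N : Sub F) (c : C) : Function.Injective (ap N.ι c) :=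
  Subtype.val_injective

lemma exists_ι (N : Sub F) {c : C} {x : F.sec c} (h : x ∈ N.carrier c) :
    ∃ y, ap N.ι c y = x := ⟨(⟨x, h⟩ : N.carrier c), rfl⟩

lemma π_surjective (N : Sub F) (c : C) : Function.Surjective (ap N.π c) :=
  QuotientAddGroup.mk'_surjective _

lemma π_eq_zero_iff (N : Sub F) {c : C} (x : F.sec c) : ap N.π c x = 0 ↔ x ∈ N.carrier c :=
  QuotientAddGroup.eq_zero_iff x

instance (N : Sub F) : Mono N.ι := mono_of_injective _ N.ι_injective
instance (N : Sub F) : Epi N.π := epi_of_surjective _ N.π_surjective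

@[simp]
lemma ι_π (N : Sub F) : N.ι ≫ N.π = 0 :=
  ext fun c x => by
    rw [ap_comp, ap_zero, π_eq_zero_iff]
    exact N.ι_mem c x

/-- The image of a morphism. -/
def range (φ : F ⟶ G) : Sub G where
  carrier c := (ap φ c).range
  res_mem f := by
    rintro _ ⟨x, rfl⟩
    exact ⟨F.res f x, ap_res φ f x⟩

lemma mem_range {φ : F ⟶ G} {c : C} {y : G.sec c} :
    y ∈ (range φ).carrier c ↔ ∃ x, ap φ c x = y := Iff.rfl

/-- The kernel of a morphism. -/
def ker (φ : F ⟶ G) : Sub F where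
  carrier c := (ap φ c).ker
  res_mem f x hx := by
    rw [AddMonoidHom.mem_ker] at hx ⊢
    rw [ap_res, hx, map_zero]

lemma mem_ker {φ : F ⟶ G} {c : C} {x : F.sec c} :
    x ∈ (ker φ).carrier c ↔ ap φ c x = 0 := Iff.rfl

/-- A morphism with image in a subpresheaf factors through it. -/
def lift (N : Sub F) (φ : G ⟶ F) (h : ∀ c x, ap φ c x ∈ N.carrier c) : G ⟶ N.obj :=
  mkHom (G := N.obj) (fun c => (ap φ c).codRestrict _ (h c))
    fun f x => Subtype.ext (ap_res φ f x)

@[simp]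
lemma lift_ι (N : Sub F) (φ : G ⟶ F) (h : ∀ c x, ap φ c x ∈ N.carrier c) :
    N.lift φ h ≫ N.ι = φ := rfl

/-- A morphism vanishing on a subpresheaf factors through the quotient. -/
def desc (N : Sub F) (φ : F ⟶ G) (h : ∀ c, ∀ x ∈ N.carrier c, ap φ c x = 0) : N.quot ⟶ G :=
  mkHom (F := N.quot) (fun c => QuotientAddGroup.lift _ (ap φ c) (h c))
    fun f x => by
      obtain ⟨x, rfl⟩ := N.π_surjective _ x
      exact ap_res φ f x

@[simp]
lemma π_desc (N : Sub F) (φ : F ⟶ G) (h : ∀ c, ∀ x ∈ N.carrier c, ap φ c x = 0) :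
    N.π ≫ N.desc φ h = φ := rfl

@[simp] lemma desc_π (N : Sub F) (φ : F ⟶ G) (h : ∀ c, ∀ x ∈ N.carrier c, ap φ c x = 0)
    (c : C) (x : F.sec c) : ap (N.desc φ h) c (ap N.π c x) = ap φ c x := rfl

end Sub

section
variable {F G H : AddPsh C}

/-- The projection to the quotient by the image is zero after an epimorphism, hence zero, so the
image is everything. -/
lemma surjective_of_epi (φ : F ⟶ G) [Epi φ] (c : C) : Function.Surjective (ap φ c) := fun y => by
  have h : (Sub.range φ).π = 0 := by
    rw [← cancel_epi φ, comp_zero]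
    refine ext fun c x => ?_
    rw [ap_comp, ap_zero, Sub.π_eq_zero_iff]
    exact ⟨x, rfl⟩
  have h' : ap (Sub.range φ).π c y = 0 := by rw [h, ap_zero]
  exact ((Sub.range φ).π_eq_zero_iff y).1 h'

instance (c : C) : Projective (rep c) where
  factors {E X} f e _ := by
    obtain ⟨x, hx⟩ := surjective_of_epi e c (ap f c (repSec (𝟙 c)))
    exact ⟨ofSec x, rep_ext (by simp [hx])⟩

lemma exact_of_sec (S : ShortComplex (AddPsh C))
    (h : ∀ c x, ap S.g c x = 0 → ∃ y, ap S.f c y = x) : S.Exact := by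
  rw [S.exact_iff_epi_kernel_lift]
  refine epi_of_surjective _ fun c x => ?_
  obtain ⟨y, hy⟩ := h c (ap (kernel.ι S.g) c x) (by
    rw [← ap_comp, kernel.condition, ap_zero])
  refine ⟨y, injective_of_mono (kernel.ι S.g) c ?_⟩
  rw [← ap_comp, kernel.lift_ι, hy]

lemma sec_of_exact {S : ShortComplex (AddPsh C)} (hS : S.Exact) {c : C} (x : S.X₂.sec c)
    (hx : ap S.g c x = 0) : ∃ y, ap S.f c y = x := by
  have h0 : ofSec x ≫ S.g = 0 := by
    rw [ofSec_comp, hx]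
    exact rep_ext (by simp)
  refine ⟨ap (hS.liftFromProjective (ofSec x) h0) c (repSec (𝟙 c)), ?_⟩
  rw [← ap_comp, hS.liftFromProjective_comp, ap_ofSec, res_id]

end
end AddPsh
end AdditivePresheaves

/-! ### Coinduced presheaves and injective hulls -/

namespace AddPsh
variable {C : Type u} [Category.{v} C] [Preadditive C]

section EnoughInjectives
variable [EssentiallySmall.{v} C]

/-- The object of `C` attached to an index in a small model. -/
abbrev smallObj (s : SmallModel.{v} C) : C := (equivSmallModel.{v} C).inverse.obj s

/-- The product, over a small model of `C`, of the presheaves coinduced from abelian groups. -/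
def coind (A : SmallModel.{v} C → AddCommGrpCat.{v}) : AddPsh C :=
  mk' (fun c => ∀ s, (smallObj s ⟶ c) →+ A s)
    (fun {c d} f => AddMonoidHom.mk' (fun h s => (h s).comp (Preadditive.rightComp _ f))
      fun _ _ => rfl)
    (fun c h => by
      funext s
      ext g
      exact congr_arg (h s) (Category.comp_id g))
    (fun f g h => by
      funext s
      ext k
      exact congr_arg (h s) (Category.assoc k f g).symm)
    (fun f g h => by
      funext s
      ext k
      exact (congr_arg (h s) (Preadditive.comp_add _ _ _ k f g)).trans ((h s).map_add _ _))

/-- A morphism to a coinduced presheaf. -/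
def toCoind {F : AddPsh C} {A : SmallModel.{v} C → AddCommGrpCat.{v}}
    (ψ : ∀ s, F.sec (smallObj s) →+ A s) : F ⟶ coind A :=
  mkHom (G := coind A)
    (fun c => AddMonoidHom.mk' (fun x s => (ψ s).comp (F.resHom _ x)) fun x y => by
      funext s
      ext f
      exact (congr_arg (ψ s) ((F.res f).map_add x y)).trans ((ψ s).map_add _ _))
    (fun {c d} f x => by
      funext s
      ext g
      exact congr_arg (ψ s) (F.res_comp g f x).symm)

lemma toCoind_apply {F : AddPsh C} {A : SmallModel.{v} C → AddCommGrpCat.{v}}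
    (ψ : ∀ s, F.sec (smallObj s) →+ A s) {c : C} (x : F.sec c) (s) (f : smallObj s ⟶ c) :
    (show ∀ s, (smallObj s ⟶ c) →+ A s from ap (toCoind ψ) c x) s f = ψ s (F.res f x) := rfl

/-- A map `F ⟶ coind A` amounts to a family of homomorphisms `F(s) → A s`, obtained by evaluating at
identities. Each of them extends along a monomorphism, since `A s` is injective. -/
lemma injective_coind (A : SmallModel.{v} C → AddCommGrpCat.{v}) [∀ s, Injective (A s)] :
    Injective (coind A) where
  factors {X Y} φ m _ := by
    let α (s) : X.sec (smallObj s) →+ A s := AddMonoidHom.mk'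
      (fun x => (show ∀ t, (smallObj t ⟶ smallObj s) →+ A t from ap φ _ x) s (𝟙 _))
      (fun x y => by
        change (show ∀ t, (smallObj t ⟶ smallObj s) →+ A t from ap φ _ (x + y)) s (𝟙 _) = _
        rw [map_add]
        rfl)
    have hm (s) : Mono (AddCommGrpCat.ofHom (ap m (smallObj s))) :=
      (AddCommGrpCat.mono_iff_injective _).2 (injective_of_mono m _)
    let ψ (s) : Y.sec (smallObj s) →+ A s :=
      (Injective.factorThru (AddCommGrpCat.ofHom (α s))
        (AddCommGrpCat.ofHom (ap m (smallObj s)))).hom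
    have hψ (s) (x : X.sec (smallObj s)) : ψ s (ap m _ x) = α s x := by
      have := Injective.comp_factorThru (AddCommGrpCat.ofHom (α s))
        (AddCommGrpCat.ofHom (ap m (smallObj s)))
      exact congr_arg (fun f => f.hom x) this
    refine ⟨toCoind ψ, ext fun c x => ?_⟩
    funext s
    ext f
    have h1 : α s (X.res f x) = (show ∀ t, (smallObj t ⟶ smallObj s) →+ A t from
        (coind A).res f (ap φ c x)) s (𝟙 _) := by
      rw [← ap_res]
      rfl
    exact ((toCoind_apply ψ (ap m c x) s f).trans (congr_arg (ψ s) (ap_res m f x).symm)).trans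
      ((hψ s _).trans (h1.trans (congr_arg
        ((show ∀ t, (smallObj t ⟶ c) →+ A t from ap φ c x) s) (Category.id_comp f))))

instance : EnoughInjectives (AddPsh C) where
  presentation F := by
    let A (s : SmallModel.{v} C) : AddCommGrpCat.{v} :=
      Injective.under (AddCommGrpCat.of (F.sec (smallObj s)))
    let ψ (s) : F.sec (smallObj s) →+ A s :=
      (Injective.ι (AddCommGrpCat.of (F.sec (smallObj s)))).hom
    have hψ (s) : Function.Injective (ψ s) :=
      (AddCommGrpCat.mono_iff_injective _).1
        (inferInstanceAs (Mono (Injective.ι (AddCommGrpCat.of (F.sec (smallObj s))))))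
    refine ⟨⟨coind A, injective_coind A, toCoind ψ, mono_of_injective _ fun c => ?_⟩⟩
    rw [injective_iff_map_eq_zero]
    intro x hx
    -- The product is indexed by the small model only; restriction along this isomorphism moves `x`
    -- to an object of it.
    let e := (equivSmallModel.{v} C).unitIso.app c
    have h1 : ψ _ (F.res e.inv x) = 0 := by
      rw [← toCoind_apply ψ x _ e.inv, hx]
      rfl
    have h2 : F.res e.inv x = 0 := hψ _ (h1.trans (map_zero _).symm)
    have h3 : F.res (e.hom ≫ e.inv) x = x :=
      (congr_arg (F.resHom c x) e.hom_inv_id).trans (F.res_id x)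
    rw [← h3, res_comp, h2, map_zero]

end EnoughInjectives

namespace Sub
variable {F : AddPsh C}

/-- The union of a nonempty chain of subpresheaves. -/
def chainUnion (S : Set (Sub F)) (hS : IsChain (· ≤ ·) S) (hne : S.Nonempty) : Sub F where
  carrier c :=
    { carrier := {x | ∃ N ∈ S, x ∈ N.carrier c}
      zero_mem' := hne.imp fun N hN => ⟨hN, zero_mem _⟩
      add_mem' := by
        rintro x y ⟨N, hN, hx⟩ ⟨M, hM, hy⟩
        rcases hS.total hN hM with h | h
        · exact ⟨M, hM, add_mem (h c hx) hy⟩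
        · exact ⟨N, hN, add_mem hx (h c hy)⟩
      neg_mem' := by
        rintro x ⟨N, hN, hx⟩
        exact ⟨N, hN, neg_mem hx⟩ }
  res_mem f := by
    rintro x ⟨N, hN, hx⟩
    exact ⟨N, hN, N.res_mem f hx⟩

lemma le_chainUnion {S : Set (Sub F)} (hS : IsChain (· ≤ ·) S) (hne : S.Nonempty) {N : Sub F}
    (hN : N ∈ S) : N ≤ chainUnion S hS hne := fun _ _ hx => ⟨N, hN, hx⟩

instance : Bot (Sub F) := ⟨⟨fun _ => ⊥, fun f x hx => by
  rw [AddSubgroup.mem_bot] at hx ⊢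
  rw [hx, map_zero]⟩⟩

lemma mem_bot {c : C} {x : F.sec c} : x ∈ (⊥ : Sub F).carrier c ↔ x = 0 := AddSubgroup.mem_bot

/-- The subpresheaf generated by a subpresheaf and a section. -/
def adjoin (N : Sub F) {c : C} (x : F.sec c) : Sub F where
  carrier d := N.carrier d ⊔ (F.resHom d x).range
  res_mem {d e} f y hy := by
    obtain ⟨n, hn, _, ⟨g, rfl⟩, rfl⟩ := AddSubgroup.mem_sup.1 hy
    rw [map_add]
    refine add_mem (AddSubgroup.mem_sup_left (N.res_mem f hn)) (AddSubgroup.mem_sup_right ?_)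
    exact ⟨f ≫ g, F.res_comp f g x⟩

lemma mem_adjoin {N : Sub F} {c d : C} {x : F.sec c} {y : F.sec d} :
    y ∈ (N.adjoin x).carrier d ↔ ∃ n ∈ N.carrier d, ∃ f : d ⟶ c, n + F.res f x = y := by
  refine AddSubgroup.mem_sup.trans ⟨?_, ?_⟩
  · rintro ⟨n, hn, _, ⟨g, rfl⟩, rfl⟩
    exact ⟨n, hn, g, rfl⟩
  · rintro ⟨n, hn, g, rfl⟩
    exact ⟨n, hn, _, ⟨g, rfl⟩, rfl⟩

/-- Every nonzero section of `M` has a nonzero restriction in `N`. -/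
def IsEssential (N M : Sub F) : Prop :=
  ∀ c, ∀ x ∈ M.carrier c, x ≠ 0 → ∃ (d : C) (f : d ⟶ c), F.res f x ≠ 0 ∧ F.res f x ∈ N.carrier d

lemma exists_maximal_essential (N : Sub F) :
    ∃ M, N ≤ M ∧ Maximal (fun M => IsEssential N M) M := by
  refine zorn_le_nonempty₀ {M | IsEssential N M} (fun S hS hc M hM => ?_) N
    (fun c x hx h => ⟨c, 𝟙 c, by simpa using ⟨h, hx⟩⟩)
  refine ⟨chainUnion S hc ⟨M, hM⟩, ?_, fun z hz => le_chainUnion hc _ hz⟩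
  rintro c x ⟨M', hM', hx⟩ h
  exact hS hM' c x hx h

lemma exists_maximal_disjoint (M : Sub F) :
    ∃ K : Sub F, Maximal (fun K : Sub F =>
      ∀ c, ∀ x ∈ K.carrier c, x ∈ M.carrier c → x = 0) K := by
  obtain ⟨K, _, h⟩ := zorn_le_nonempty₀
    {K : Sub F | ∀ c, ∀ x ∈ K.carrier c, x ∈ M.carrier c → x = 0}
    (fun S hS hc K hK => ⟨chainUnion S hc ⟨K, hK⟩, by
      rintro c x ⟨K', hK', hx⟩ h
      exact hS hK' c x hx h, fun z hz => le_chainUnion hc _ hz⟩) ⊥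
    (fun c x hx _ => mem_bot.1 hx)
  exact ⟨K, h⟩

end Sub

open HomSpec.AddPsh.Sub in
-- The Eckmann–Schopf argument: in an injective `I` containing `F`, take a maximal essential
-- extension `M` of `F` and a maximal `K` meeting `M` trivially. Then `M` turns out to be a retract
-- of `I`, so it is injective.
theorem exists_injectiveHull [EssentiallySmall.{v} C] (F : AddPsh C) :
    ∃ (J : AddPsh C) (i : F ⟶ J), IsInjectiveHull i := by
  let I := Injective.under F
  let j : F ⟶ I := Injective.ι F
  have hj := injective_of_mono j
  obtain ⟨M, hNM, hM⟩ := exists_maximal_essential (range j)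
  obtain ⟨K, hK⟩ := exists_maximal_disjoint M
  have hp (c) (m : M.obj.sec c) (h : ap K.π c (ap M.ι c m) = 0) : ap M.ι c m = 0 :=
    hK.prop c _ ((K.π_eq_zero_iff _).1 h) (M.ι_mem c m)
  have : Mono (M.ι ≫ K.π) := mono_of_injective _ fun c => by
    rw [injective_iff_map_eq_zero]
    intro m hm
    exact M.ι_injective c ((hp c m hm).trans (map_zero _).symm)
  -- Maximality of `K`: enlarging it by a section outside it must meet `M`, so `M` is essential in
  -- `I / K`.
  have hess (c) (y : K.quot.sec c) (hy : y ≠ 0) : ∃ (d : C) (f : d ⟶ c) (m : M.obj.sec d),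
      ap M.ι d m ≠ 0 ∧ K.quot.res f y = ap K.π d (ap M.ι d m) := by
    obtain ⟨x, rfl⟩ := K.π_surjective c y
    have hx : x ∉ K.carrier c := fun h => hy ((K.π_eq_zero_iff x).2 h)
    have hKx : K ≤ K.adjoin x := fun d k hk => mem_adjoin.2 ⟨k, hk, 0, by simp⟩
    have hx' : x ∈ (K.adjoin x).carrier c := mem_adjoin.2 ⟨0, zero_mem _, 𝟙 c, by simp⟩
    have hn : ¬ ∀ d, ∀ z ∈ (K.adjoin x).carrier d, z ∈ M.carrier d → z = 0 := fun h =>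
      hx (hK.le_of_ge h hKx c hx')
    push Not at hn
    obtain ⟨d, z, hz, hzM, hz0⟩ := hn
    obtain ⟨k, hk, f, rfl⟩ := mem_adjoin.1 hz
    refine ⟨d, f, ⟨_, hzM⟩, hz0, ?_⟩
    rw [← ap_res]
    change _ = ap K.π d (k + _)
    rw [map_add, (K.π_eq_zero_iff k).2 hk, zero_add]
  obtain ⟨g, hg⟩ : ∃ g : K.quot ⟶ I, (M.ι ≫ K.π) ≫ g = M.ι :=
    ⟨Injective.factorThru M.ι (M.ι ≫ K.π), Injective.comp_factorThru _ _⟩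
  have hg' (c) (m : M.obj.sec c) : ap g c (ap K.π c (ap M.ι c m)) = ap M.ι c m := by
    rw [← ap_comp, ← ap_comp, ← Category.assoc, hg]
  have hle : M ≤ range g := fun c m hm => ⟨ap K.π c m, hg' c ⟨m, hm⟩⟩
  -- The image of `g` contains `M` and is still essential over `F`, so it equals `M` by maximality.
  -- Therefore `K.π ≫ g` retracts `I` onto `M`.
  have hge : range g ≤ M := hM.le_of_ge (by
    rintro c _ ⟨y, rfl⟩ h
    obtain ⟨d, f, m, hm, hy⟩ := hess c y (by rintro rfl; exact h (map_zero _))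
    have hr : I.res f (ap g c y) = ap M.ι d m := by rw [← ap_res, hy, hg']
    obtain ⟨e, k, h1, h2⟩ := hM.prop d _ (M.ι_mem d m) hm
    exact ⟨e, k ≫ f, by rw [res_comp, hr]; exact h1, by rw [res_comp, hr]; exact h2⟩) hle
  let r : I ⟶ M.obj := M.lift (K.π ≫ g) fun c x => hge c ⟨_, rfl⟩
  have hr : M.ι ≫ r = 𝟙 _ := by
    rw [← cancel_mono M.ι, Category.assoc, lift_ι, Category.id_comp, ← Category.assoc, hg]
  refine ⟨M.obj, M.lift j fun c x => hNM c ⟨x, rfl⟩, ?_, ?_, ?_⟩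
  · have : Mono (M.lift j (fun c x => hNM c ⟨x, rfl⟩) ≫ M.ι) := by rw [lift_ι]; infer_instance
    exact mono_of_mono _ M.ι
  · exact Retract.injective ⟨M.ι, r, hr⟩
  · intro Z k hk
    refine mono_of_injective _ fun c => ?_
    rw [injective_iff_map_eq_zero]
    intro x hx
    by_contra h
    obtain ⟨d, f, h1, s, hs⟩ := hM.prop c _ (M.ι_mem c x)
      (fun h' => h (M.ι_injective c (h'.trans (map_zero _).symm)))
    have hs' : ap (M.lift j fun c x => hNM c ⟨x, rfl⟩) d s = M.obj.res f x :=
      M.ι_injective d (hs.trans (ap_res M.ι f x).symm)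
    have h0 : s = 0 := injective_of_mono _ d (a₁ := s) (a₂ := 0) (by
      rw [ap_comp, hs', ap_res, hx, map_zero, map_zero] : ap (_ ≫ k) d s = ap (_ ≫ k) d 0)
    rw [h0, map_zero] at hs
    exact h1 hs.symm

end AddPsh

/-! ### Finitely presented presheaves and coherence -/

namespace AddPsh
variable {C : Type u} [Category.{v} C] [Preadditive C]

/-- The section `x` generates the presheaf `F`. -/
def Generates {F : AddPsh C} {B : C} (x : F.sec B) : Prop :=
  ∀ (c : C) (s : F.sec c), ∃ f : c ⟶ B, F.res f x = s

/-- `A ⟶ B` presents the presheaf `F` through its section `x` over `B`. -/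
structure IsPres {F : AddPsh C} {A B : C} (x : F.sec B) (α : A ⟶ B) : Prop where
  gen : Generates x
  rel {c : C} (f : c ⟶ B) : F.res f x = 0 ↔ ∃ g, g ≫ α = f

/-- The finitely generated presheaves. -/
def IsFinGen (F : AddPsh C) : Prop := ∃ (B : C) (x : F.sec B), Generates x

/-- The finitely presented presheaves. -/
def IsFinPres (F : AddPsh C) : Prop :=
  ∃ (A B : C) (α : A ⟶ B) (x : F.sec B), IsPres x α

variable (C) in
/-- Existence of weak kernels, in terms of elements. -/
def WeakKernels : Prop := ∀ {X Y : C} (f : X ⟶ Y), ∃ (K : C) (k : K ⟶ X),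
  ∀ (c : C) (g : c ⟶ X), g ≫ f = 0 ↔ ∃ h, h ≫ k = g

section
variable {F G H : AddPsh C}

lemma IsPres.map_iso {A B : C} {x : F.sec B} {α : A ⟶ B} (h : IsPres x α) (e : F ≅ G) :
    IsPres (ap e.hom B x) α where
  gen c s := by
    obtain ⟨f, hf⟩ := h.gen c (ap e.inv c s)
    exact ⟨f, by rw [← ap_res, hf, ← ap_comp, e.inv_hom_id, ap_id]⟩
  rel f := by
    rw [← ap_res, ← h.rel]
    exact map_eq_zero_iff _ (injective_of_mono e.hom _)

lemma IsFinPres.of_iso (h : IsFinPres F) (e : F ≅ G) : IsFinPres G := by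
  obtain ⟨A, B, α, x, h⟩ := h
  exact ⟨A, B, α, _, h.map_iso e⟩

lemma IsFinPres.isFinGen (h : IsFinPres F) : IsFinGen F := by
  obtain ⟨A, B, α, x, h⟩ := h
  exact ⟨B, x, h.gen⟩

lemma Generates.epi {B : C} {x : F.sec B} (h : Generates x) : Epi (ofSec x) :=
  epi_of_surjective _ fun c s => by
    obtain ⟨f, hf⟩ := h c s
    exact ⟨repSec f, hf⟩

lemma Generates.hom_ext {B : C} {x : F.sec B} (h : Generates x) {φ ψ : F ⟶ G}
    (h' : ap φ B x = ap ψ B x) : φ = ψ := by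
  have := h.epi
  rw [← cancel_epi (ofSec x), ofSec_comp, ofSec_comp, h']

/-- Morphisms out of a presented presheaf. -/
lemma IsPres.exists_hom {A B : C} {x : F.sec B} {α : A ⟶ B} (h : IsPres x α) (y : G.sec B)
    (hy : G.res α y = 0) : ∃ φ : F ⟶ G, ap φ B x = y := by
  choose f hf using h.gen
  have hwd {c : C} (g g' : c ⟶ B) (hg : F.res g x = F.res g' x) : G.res g y = G.res g' y := by
    have h1 : F.res (g - g') x = 0 := by
      rw [← resHom_apply, map_sub, resHom_apply, resHom_apply, hg, sub_self]
    obtain ⟨k, hk⟩ := (h.rel _).1 h1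
    have h2 : G.res (g - g') y = 0 := by rw [← hk, res_comp, hy, map_zero]
    rw [← resHom_apply, map_sub] at h2
    exact sub_eq_zero.1 h2
  refine ⟨mkHom (fun c => AddMonoidHom.mk' (fun s => G.res (f c s) y) fun s t => ?_) ?_, ?_⟩
  · rw [← res_add]
    exact hwd _ _ (by rw [res_add, hf, hf, hf])
  · intro c d g s
    change G.res _ y = G.res g (G.res _ y)
    rw [← res_comp]
    exact hwd _ _ (by rw [res_comp, hf, hf])
  · change G.res _ y = y
    conv_rhs => rw [← G.res_id y]
    exact hwd _ _ (by rw [hf, res_id])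

lemma isFinPres_rep [HasZeroObject C] (B : C) : IsFinPres (rep B) := by
  refine ⟨HasZeroObject.zero' C |>.1, B, 0, repSec (𝟙 B), fun c s => ⟨s, ?_⟩, fun {c} f => ?_⟩
  · exact Category.comp_id s
  · have : (rep B).res f (repSec (𝟙 B)) = repSec f := Category.comp_id f
    rw [this]
    refine ⟨fun h => ⟨0, ?_⟩, fun ⟨g, hg⟩ => ?_⟩
    · rw [comp_zero]; exact h.symm
    · rw [comp_zero] at hg; exact hg.symm

lemma isPres_cokernel {A B : C} (φ : rep A ⟶ rep B) :
    IsPres (ap (cokernel.π φ) B (repSec (𝟙 B))) (show A ⟶ B from ap φ A (repSec (𝟙 A))) := by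
  let α : A ⟶ B := ap φ A (repSec (𝟙 A))
  have hφ {c : C} (g : c ⟶ A) : ap φ c (repSec g) = repSec (g ≫ α) := by
    have : repSec g = (rep A).res g (repSec (𝟙 A)) := (Category.comp_id g).symm
    rw [this, ap_res]
    rfl
  have hid {c : C} (f : c ⟶ B) : (rep B).res f (repSec (𝟙 B)) = repSec f := Category.comp_id f
  refine ⟨fun c s => ?_, fun {c} f => ?_⟩
  · obtain ⟨f, rfl⟩ := surjective_of_epi (cokernel.π φ) c s
    exact ⟨f, (ap_res (cokernel.π φ) (d := B) f _).symm.trans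
      (congr_arg (ap (cokernel.π φ) c) (hid f))⟩
  · rw [← ap_res, hid]
    constructor
    · intro h
      have hex : (ShortComplex.mk φ (cokernel.π φ) (cokernel.condition φ)).Exact :=
        ShortComplex.exact_cokernel φ
      obtain ⟨g, hg⟩ := sec_of_exact hex _ h
      exact ⟨g, (hφ g).symm.trans hg⟩
    · rintro ⟨g, rfl⟩
      rw [← hφ, ← ap_comp, cokernel.condition, ap_zero]

lemma IsPres.nonempty_iso {A B : C} {x : F.sec B} {y : G.sec B} {α : A ⟶ B} (h : IsPres x α)
    (h' : IsPres y α) : Nonempty (F ≅ G) := by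
  obtain ⟨φ, hφ⟩ := h.exists_hom y ((h'.rel α).2 ⟨𝟙 A, Category.id_comp α⟩)
  obtain ⟨ψ, hψ⟩ := h'.exists_hom x ((h.rel α).2 ⟨𝟙 A, Category.id_comp α⟩)
  exact ⟨⟨φ, ψ, h.gen.hom_ext (by simp [hφ, hψ]), h'.gen.hom_ext (by simp [hφ, hψ])⟩⟩

lemma IsPres.transport {A B A' B' : C} {x : F.sec B} {α : A ⟶ B} (h : IsPres x α)
    (e : A' ≅ A) (e' : B' ≅ B) : IsPres (F.res e'.hom x) (e.hom ≫ α ≫ e'.inv) where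
  gen c s := by
    obtain ⟨f, rfl⟩ := h.gen c s
    exact ⟨f ≫ e'.inv, by rw [← res_comp, Category.assoc, e'.inv_hom_id, Category.comp_id]⟩
  rel f := by
    rw [← res_comp, h.rel]
    constructor
    · rintro ⟨g, hg⟩
      exact ⟨g ≫ e.inv, by
        rw [Category.assoc, e.inv_hom_id_assoc, ← Category.assoc, hg, Category.assoc, e'.hom_inv_id,
          Category.comp_id]⟩
    · rintro ⟨g, rfl⟩
      exact ⟨g ≫ e.hom, by simp⟩

/-- A subpresheaf generated by one section. -/
def Sub.span {B : C} (x : F.sec B) : Sub F := Sub.range (ofSec x)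

lemma Sub.mem_span {B c : C} {x : F.sec B} {y : F.sec c} :
    y ∈ (Sub.span x).carrier c ↔ ∃ f : c ⟶ B, F.res f x = y := Iff.rfl

lemma Sub.self_mem_span {B : C} (x : F.sec B) : x ∈ (Sub.span x).carrier B :=
  Sub.mem_span.2 ⟨𝟙 B, F.res_id x⟩

lemma isFinGen_span {B : C} (x : F.sec B) : IsFinGen (Sub.span x).obj := by
  refine ⟨B, ⟨x, Sub.self_mem_span x⟩, fun c s => ?_⟩
  obtain ⟨f, hf⟩ := Sub.mem_span.1 ((Sub.span x).ι_mem c s)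
  exact ⟨f, Subtype.ext hf⟩

lemma isFinGen_of_epi (φ : F ⟶ G) [Epi φ] (h : IsFinGen F) : IsFinGen G := by
  obtain ⟨B, x, hx⟩ := h
  refine ⟨B, ap φ B x, fun c s => ?_⟩
  obtain ⟨t, rfl⟩ := surjective_of_epi φ c s
  obtain ⟨f, rfl⟩ := hx c t
  exact ⟨f, (ap_res φ f x).symm⟩

variable [HasBinaryBiproducts C]

lemma biprod_desc_eq_zero_iff {A B D c : C} (f : A ⟶ D) (g : B ⟶ D) (h : c ⟶ A ⊞ B) :
    h ≫ biprod.desc f (-g) = 0 ↔ (h ≫ biprod.fst) ≫ f = (h ≫ biprod.snd) ≫ g := by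
  rw [biprod.desc_eq, Preadditive.comp_add, Preadditive.comp_neg, Preadditive.comp_neg,
    ← sub_eq_add_neg, sub_eq_zero, Category.assoc, Category.assoc]

/-- Weak pullbacks from weak kernels and biproducts. -/
lemma WeakKernels.exists_weakPullback (hC : WeakKernels C) {A B D : C} (f : A ⟶ D) (g : B ⟶ D) :
    ∃ (K : C) (k : K ⟶ A), ∀ (c : C) (a : c ⟶ A),
      (∃ b : c ⟶ B, b ≫ g = a ≫ f) ↔ ∃ h, h ≫ k = a := by
  obtain ⟨K, k, hk⟩ := hC (biprod.desc f (-g))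
  refine ⟨K, k ≫ biprod.fst, fun c a => ⟨?_, ?_⟩⟩
  · rintro ⟨b, hb⟩
    obtain ⟨h, hh⟩ := (hk c (biprod.lift a b)).1 (by rw [biprod_desc_eq_zero_iff]; simp [hb])
    exact ⟨h, by rw [← Category.assoc, hh, biprod.lift_fst]⟩
  · rintro ⟨h, rfl⟩
    have := (biprod_desc_eq_zero_iff f g (h ≫ k)).1 ((hk c _).2 ⟨h, rfl⟩)
    exact ⟨_, by rw [← this]; simp⟩

/-- The relations on a generator of `G` are those on its image in `F`; they are generated by a weak
pullback of the presenting map `α`. -/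
lemma IsFinPres.of_mono (hC : WeakKernels C) (φ : G ⟶ F) [Mono φ] (hG : IsFinGen G)
    (hF : IsFinPres F) : IsFinPres G := by
  obtain ⟨B', y, hy⟩ := hG
  obtain ⟨A, B, α, x, hx⟩ := hF
  obtain ⟨f, hf⟩ := hx.gen B' (ap φ B' y)
  obtain ⟨K, k, hk⟩ := hC.exists_weakPullback f α
  refine ⟨K, B', k, y, hy, fun {c} g => ?_⟩
  rw [← hk, ← hx.rel, ← map_eq_zero_iff (ap φ c) (injective_of_mono φ c), ap_res, ← hf, res_comp]

lemma isFinGen_ker (hC : WeakKernels C) (φ : F ⟶ G) (hF : IsFinGen F) (hG : IsFinPres G) :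
    IsFinGen (Sub.ker φ).obj := by
  obtain ⟨B, x, hx⟩ := hF
  obtain ⟨A, B', α, y, hy⟩ := hG
  obtain ⟨h, hh⟩ := hy.gen B (ap φ B x)
  obtain ⟨K, k, hk⟩ := hC.exists_weakPullback h α
  have key (c : C) (f : c ⟶ B) : ap φ c (F.res f x) = 0 ↔ ∃ l, l ≫ k = f := by
    rw [← hk, ← hy.rel, ap_res, ← hh, res_comp]
  refine ⟨K, ⟨F.res k x, Sub.mem_ker.2 ((key K k).2 ⟨𝟙 K, Category.id_comp k⟩)⟩, fun c s => ?_⟩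
  obtain ⟨f, hf⟩ := hx c (ap (Sub.ker φ).ι c s)
  obtain ⟨l, rfl⟩ := (key c f).1 (by rw [hf]; exact (Sub.ker φ).ι_mem c s)
  exact ⟨l, Subtype.ext ((F.res_comp l k x).symm.trans hf)⟩

lemma IsFinPres.ker (hC : WeakKernels C) (φ : F ⟶ G) (hF : IsFinPres F) (hG : IsFinPres G) :
    IsFinPres (Sub.ker φ).obj :=
  .of_mono hC (Sub.ker φ).ι (isFinGen_ker hC φ hF.isFinGen hG) hF

omit [HasBinaryBiproducts C] in
lemma isFinGen_range (φ : F ⟶ G) (hF : IsFinGen F) : IsFinGen (Sub.range φ).obj := by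
  have : Epi ((Sub.range φ).lift φ fun c x => ⟨x, rfl⟩) := epi_of_surjective _ fun c s => by
    obtain ⟨x, hx⟩ := (Sub.range φ).ι_mem c s
    exact ⟨x, Subtype.ext hx⟩
  exact isFinGen_of_epi ((Sub.range φ).lift φ fun c x => ⟨x, rfl⟩) hF

/-- A generator of `N` over `B'` becomes one more relation, whence the source `A ⊞ B'`. -/
lemma IsFinPres.quot (hF : IsFinPres F) (N : Sub F) (hN : IsFinGen N.obj) :
    IsFinPres N.quot := by
  obtain ⟨A, B, α, x, hx⟩ := hF
  obtain ⟨B', n, hn⟩ := hN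
  obtain ⟨f, hf⟩ := hx.gen B' (ap N.ι B' n)
  refine ⟨A ⊞ B', B, biprod.desc α f, ap N.π B x, fun c s => ?_, fun {c} g => ?_⟩
  · obtain ⟨t, rfl⟩ := N.π_surjective c s
    obtain ⟨g, rfl⟩ := hx.gen c t
    exact ⟨g, (ap_res N.π g x).symm⟩
  · rw [← ap_res, N.π_eq_zero_iff]
    constructor
    · intro h
      obtain ⟨b, hb⟩ := hn c ⟨_, h⟩
      have hb' : F.res b (ap N.ι B' n) = F.res g x := (ap_res N.ι b n).symm.trans
        (congr_arg (ap N.ι c) hb)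
      have h0 : F.res (g - b ≫ f) x = 0 := by
        rw [← resHom_apply, map_sub, resHom_apply, resHom_apply, res_comp, hf, hb', sub_self]
      obtain ⟨a, ha⟩ := (hx.rel _).1 h0
      exact ⟨biprod.lift a b, by rw [biprod.lift_desc, ha, sub_add_cancel]⟩
    · rintro ⟨k, rfl⟩
      rw [biprod.desc_eq, Preadditive.comp_add, res_add]
      have h1 : F.res (k ≫ biprod.fst ≫ α) x = 0 :=
        (hx.rel _).2 ⟨k ≫ biprod.fst, Category.assoc _ _ _⟩
      have h2 : F.res (k ≫ biprod.snd ≫ f) x = ap N.ι c (N.obj.res (k ≫ biprod.snd) n) := by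
        rw [← Category.assoc, res_comp, hf, ap_res]
      rw [h1, h2, zero_add]
      exact N.ι_mem _ _

omit [HasBinaryBiproducts C] in
lemma biprod_sec_ext {c : C} {x y : (F ⊞ G).sec c}
    (h1 : ap (biprod.fst : F ⊞ G ⟶ F) c x = ap (biprod.fst : F ⊞ G ⟶ F) c y)
    (h2 : ap (biprod.snd : F ⊞ G ⟶ G) c x = ap (biprod.snd : F ⊞ G ⟶ G) c y) : x = y := by
  have key (z : (F ⊞ G).sec c) : z = ap (biprod.inl : F ⟶ F ⊞ G) c (ap biprod.fst c z) +
      ap (biprod.inr : G ⟶ F ⊞ G) c (ap biprod.snd c z) := by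
    rw [← ap_comp, ← ap_comp, ← ap_add, biprod.total, ap_id]
  rw [key x, key y, h1, h2]

omit [HasBinaryBiproducts C] in
lemma exists_biprod_sec {c : C} (x : F.sec c) (y : G.sec c) : ∃ z : (F ⊞ G).sec c,
    ap (biprod.fst : F ⊞ G ⟶ F) c z = x ∧ ap (biprod.snd : F ⊞ G ⟶ G) c z = y := by
  refine ⟨ap (biprod.inl : F ⟶ F ⊞ G) c x + ap (biprod.inr : G ⟶ F ⊞ G) c y, ?_, ?_⟩ <;>
  · rw [map_add, ← ap_comp, ← ap_comp]
    simp

lemma IsFinPres.biprod (hF : IsFinPres F) (hG : IsFinPres G) : IsFinPres (F ⊞ G) := by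
  obtain ⟨A, B, α, x, hx⟩ := hF
  obtain ⟨A', B', α', y, hy⟩ := hG
  obtain ⟨z, hz, hz'⟩ := exists_biprod_sec (F.res (biprod.fst : B ⊞ B' ⟶ B) x)
    (G.res (biprod.snd : B ⊞ B' ⟶ B') y)
  refine ⟨A ⊞ A', B ⊞ B', biprod.map α α', z, fun c s => ?_, fun {c} g => ?_⟩
  · obtain ⟨f, hf⟩ := hx.gen c (ap biprod.fst c s)
    obtain ⟨f', hf'⟩ := hy.gen c (ap biprod.snd c s)
    refine ⟨biprod.lift f f', biprod_sec_ext ?_ ?_⟩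
    · rw [ap_res, hz, ← res_comp, biprod.lift_fst, hf]
    · rw [ap_res, hz', ← res_comp, biprod.lift_snd, hf']
  · have h0 : (F ⊞ G).res g z = 0 ↔
        F.res (g ≫ biprod.fst) x = 0 ∧ G.res (g ≫ biprod.snd) y = 0 := by
      rw [res_comp, res_comp, ← hz, ← hz', ← ap_res, ← ap_res]
      exact ⟨fun h => by rw [h]; simp,
        fun h => biprod_sec_ext (h.1.trans (map_zero _).symm) (h.2.trans (map_zero _).symm)⟩
    rw [h0, hx.rel, hy.rel]
    constructor
    · rintro ⟨⟨a, ha⟩, ⟨a', ha'⟩⟩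
      exact ⟨biprod.lift a a', by ext <;> simp [ha, ha']⟩
    · rintro ⟨k, rfl⟩
      exact ⟨⟨k ≫ biprod.fst, by simp⟩, ⟨k ≫ biprod.snd, by simp⟩⟩

omit [HasBinaryBiproducts C] in
lemma isFinPres_of_isZero [HasZeroObject C] (hF : IsZero F) : IsFinPres F := by
  have hz (c : C) (s : F.sec c) : s = 0 := by
    have := congr_arg (fun φ => ap φ c s) ((IsZero.iff_id_eq_zero F).1 hF)
    simpa using this
  let Z := (HasZeroObject.zero' C).1
  have hZ : IsZero Z := isZero_zero C
  exact ⟨Z, Z, 0, 0, fun c s => ⟨0, by rw [hz c s, map_zero]⟩,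
    fun f => ⟨fun _ => ⟨f, by rw [comp_zero]; exact hZ.eq_of_tgt _ _⟩, fun _ => map_zero _⟩⟩

end
end AddPsh

/-! ### Serre classes, torsion and filtered colimits -/

namespace AddPsh
variable {C : Type u} [Category.{v} C] [Preadditive C]

section Small
variable [EssentiallySmall.{v} C]

lemma ext_small {F G : AddPsh C} {φ ψ : F ⟶ G}
    (h : ∀ (s : SmallModel.{v} C) (x : F.sec (smallObj s)), ap φ _ x = ap ψ _ x) : φ = ψ := by
  refine ext fun c x => ?_
  let e := (equivSmallModel.{v} C).unitIso.app c
  have h3 : F.res (e.hom ≫ e.inv) x = x :=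
    (congr_arg (F.resHom c x) e.hom_inv_id).trans (F.res_id x)
  rw [← h3, res_comp, ap_res φ, ap_res ψ]
  exact congr_arg _ (h _ _)

instance : LocallySmall.{v} (AddPsh C) where
  hom_small F G := small_of_injective
    (β := ∀ s : SmallModel.{v} C, F.sec (smallObj s) → G.sec (smallObj s))
    (f := fun φ _ x => ap φ _ x) fun _ _ h => ext_small fun s x => congr_fun (congr_fun h s) x

/-- A presentation determines the presheaf up to isomorphism and can be transported to a morphism of
the small model; such morphisms form a small set. -/
instance : ObjectProperty.EssentiallySmall.{v} (IsFinPres (C := C)) where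
  exists_small_le' := by
    let ι := Σ (s t : SmallModel.{v} C), (smallObj s ⟶ smallObj t)
    let Z (i : ι) : AddPsh C := cokernel (ofSec (repSec i.2.2))
    refine ⟨ObjectProperty.ofObj Z, inferInstance, ?_⟩
    rintro F ⟨A, B, α, x, h⟩
    let e := (equivSmallModel.{v} C).unitIso.symm.app A
    let e' := (equivSmallModel.{v} C).unitIso.symm.app B
    have h1 := h.transport e e'
    have h2 := isPres_cokernel (ofSec (repSec (e.hom ≫ α ≫ e'.inv)))
    have h3 : (show _ ⟶ _ from ap (ofSec (repSec (e.hom ≫ α ≫ e'.inv))) _ (repSec (𝟙 _))) =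
        e.hom ≫ α ≫ e'.inv := Category.id_comp _
    rw [h3] at h2
    exact ⟨_, ObjectProperty.ofObj_apply Z ⟨_, _, e.hom ≫ α ≫ e'.inv⟩, h1.nonempty_iso h2⟩

end Small

/-- A class of finitely presented presheaves closed under subobjects, quotients and extensions
within the finitely presented presheaves. -/
structure IsSerreFP (S : ObjectProperty (AddPsh C)) : Prop where
  le : ∀ F, S F → IsFinPres F
  zero : ∃ F, IsZero F ∧ S F
  serre (E : ShortComplex (AddPsh C)) (hE : E.ShortExact) (h₁ : IsFinPres E.X₁)
    (h₂ : IsFinPres E.X₂) (h₃ : IsFinPres E.X₃) : S E.X₂ ↔ S E.X₁ ∧ S E.X₃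

lemma shortExact_ker {F G : AddPsh C} (φ : F ⟶ G) [Epi φ] :
    (ShortComplex.mk (Sub.ker φ).ι φ (ext fun c x => (Sub.ker φ).ι_mem c x)).ShortExact where
  exact := exact_of_sec _ fun _ _ h => Sub.exists_ι _ h
  mono_f := inferInstanceAs (Mono (Sub.ker φ).ι)
  epi_g := inferInstanceAs (Epi φ)

lemma shortExact_range {F G : AddPsh C} (φ : F ⟶ G) [Mono φ] :
    (ShortComplex.mk φ (Sub.range φ).π (ext fun c x => by
      rw [ap_comp, ap_zero, Sub.π_eq_zero_iff]
      exact ⟨x, rfl⟩)).ShortExact where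
  exact := exact_of_sec _ fun _ x h => ((Sub.range φ).π_eq_zero_iff x).1 h
  mono_f := inferInstanceAs (Mono φ)
  epi_g := inferInstanceAs (Epi (Sub.range φ).π)

namespace IsSerreFP
variable {S : ObjectProperty (AddPsh C)} (hS : IsSerreFP S) {F G : AddPsh C}
include hS

/-- Invariance under isomorphism is not part of the definition; it follows from the short exact
sequence `0 ⟶ F ⟶ G` whose first term is a zero object in `S`. -/
lemma of_iso (e : F ≅ G) (hF : S F) : S G := by
  obtain ⟨Z, hZ, hSZ⟩ := hS.zero
  let E : ShortComplex (AddPsh C) := ShortComplex.mk (0 : Z ⟶ F) e.hom (by simp)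
  have hE : E.ShortExact :=
    { exact := (E.exact_iff_mono rfl).2 (inferInstanceAs (Mono e.hom))
      mono_f := ⟨fun _ _ _ => hZ.eq_of_tgt _ _⟩
      epi_g := inferInstanceAs (Epi e.hom) }
  exact ((hS.serre E hE (hS.le _ hSZ) (hS.le _ hF) ((hS.le _ hF).of_iso e)).1 hF).2

lemma of_isZero (hF : IsZero F) : S F := by
  obtain ⟨Z, hZ, hSZ⟩ := hS.zero
  exact hS.of_iso (hZ.iso hF) hSZ

variable [HasBinaryBiproducts C] (hC : WeakKernels C)
include hC

lemma of_epi (φ : F ⟶ G) [Epi φ] (hF : S F) (hG : IsFinPres G) : S G :=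
  ((hS.serre _ (shortExact_ker φ) (.ker hC φ (hS.le _ hF) hG) (hS.le _ hF) hG).1 hF).2

lemma of_mono (φ : F ⟶ G) [Mono φ] (hG : S G) (hF : IsFinGen F) : S F :=
  ((hS.serre _ (shortExact_range φ) (.of_mono hC φ hF (hS.le _ hG)) (hS.le _ hG)
    (.quot (hS.le _ hG) _ (isFinGen_range φ hF))).1 hG).1

lemma span (hF : S F) {B : C} (x : F.sec B) : S (Sub.span x).obj :=
  hS.of_mono hC (Sub.span x).ι hF (isFinGen_span x)

lemma quot (hF : S F) (N : Sub F) (hN : IsFinGen N.obj) : S N.quot :=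
  hS.of_epi hC N.π hF (.quot (hS.le _ hF) N hN)

lemma range (φ : F ⟶ G) (hF : S F) (hG : IsFinPres G) : S (Sub.range φ).obj := by
  have : Epi ((Sub.range φ).lift φ fun c x => ⟨x, rfl⟩) := epi_of_surjective _ fun c s => by
    obtain ⟨x, hx⟩ := (Sub.range φ).ι_mem c s
    exact ⟨x, Subtype.ext hx⟩
  exact hS.of_epi hC ((Sub.range φ).lift φ fun c x => ⟨x, rfl⟩) hF
    (.of_mono hC (Sub.range φ).ι (isFinGen_range φ (hS.le _ hF).isFinGen) hG)

omit hC in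
lemma biprod (hF : S F) (hG : S G) : S (F ⊞ G) := by
  let E : ShortComplex (AddPsh C) :=
    ShortComplex.mk (biprod.inl : F ⟶ F ⊞ G) (biprod.snd : F ⊞ G ⟶ G) (by simp)
  have hE : E.ShortExact := (ShortComplex.Splitting.ofHasBinaryBiproduct F G).shortExact
  exact (hS.serre E hE (hS.le _ hF) (.biprod (hS.le _ hF) (hS.le _ hG)) (hS.le _ hG)).2 ⟨hF, hG⟩

end IsSerreFP

/-- The section `x` is the image of a section of an object of `S`. -/
def IsTorsionSec (S : ObjectProperty (AddPsh C)) (X : AddPsh C) {c : C} (x : X.sec c) : Prop :=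
  ∃ (F : AddPsh C) (_ : S F) (h : F ⟶ X) (s : F.sec c), ap h c s = x

/-- The torsion subpresheaf with respect to `S`. -/
def torsion [HasBinaryBiproducts C] {S : ObjectProperty (AddPsh C)} (hS : IsSerreFP S)
    (X : AddPsh C) : Sub X where
  carrier c :=
    { carrier := {x | IsTorsionSec S X x}
      zero_mem' := by
        obtain ⟨Z, _, hZ⟩ := hS.zero
        exact ⟨Z, hZ, 0, 0, by simp⟩
      add_mem' := by
        rintro _ _ ⟨F, hF, h, s, rfl⟩ ⟨G, hG, k, t, rfl⟩
        exact ⟨F ⊞ G, hS.biprod hF hG, biprod.desc h k, ap biprod.inl c s + ap biprod.inr c t, by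
          rw [map_add, ← ap_comp, ← ap_comp, biprod.inl_desc, biprod.inr_desc]⟩
      neg_mem' := by
        rintro _ ⟨F, hF, h, s, rfl⟩
        exact ⟨F, hF, h, -s, map_neg _ _⟩ }
  res_mem f := by
    rintro _ ⟨F, hF, h, s, rfl⟩
    exact ⟨F, hF, h, F.res f s, ap_res h f s⟩

/-- A presheaf without nonzero maps from objects of `S`. -/
def IsTorsionFree (S : ObjectProperty (AddPsh C)) (X : AddPsh C) : Prop :=
  ∀ F, S F → ∀ f : F ⟶ X, f = 0

lemma isTorsionFree_iff {S : ObjectProperty (AddPsh C)} {X : AddPsh C} :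
    IsTorsionFree S X ↔ ∀ c, ∀ x : X.sec c, IsTorsionSec S X x → x = 0 := by
  constructor
  · rintro h c _ ⟨F, hF, k, s, rfl⟩
    rw [h F hF k, ap_zero]
  · exact fun h F hF f => ext fun c s => h c _ ⟨F, hF, f, s, rfl⟩

lemma isTorsionFree_of_mono {S : ObjectProperty (AddPsh C)} {X Y : AddPsh C} (φ : X ⟶ Y) [Mono φ]
    (h : IsTorsionFree S Y) : IsTorsionFree S X := fun F hF f => by
  rw [← cancel_mono φ, zero_comp]
  exact h F hF _

lemma hom_eq_zero_of_ind {S : ObjectProperty (AddPsh C)} {X Y : AddPsh C}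
    (h : ObjectProperty.ind.{v} S X) (hY : IsTorsionFree S Y) (f : X ⟶ Y) : f = 0 := by
  obtain ⟨J, _, _, p, hp⟩ := h
  exact p.isColimit.hom_ext fun j => (hY _ (hp j) _).trans (hY _ (hp j) _).symm

section
variable {S : ObjectProperty (AddPsh C)} {X : AddPsh C}

/-- An object of `S` over `X`. -/
def overMk {F : AddPsh C} (hF : S F) (h : F ⟶ X) : CostructuredArrow S.ι X :=
  CostructuredArrow.mk (S := S.ι) (Y := ObjectProperty.FullSubcategory.mk F hF)
    (show S.ι.obj (ObjectProperty.FullSubcategory.mk F hF) ⟶ X from h)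

/-- The structure morphism of an object of `S` over `X`. -/
abbrev overHom (A : CostructuredArrow S.ι X) : A.left.obj ⟶ X := A.hom

/-- A morphism of objects of `S` over `X`. -/
def overHomMk {A B : CostructuredArrow S.ι X} (p : A.left.obj ⟶ B.left.obj)
    (hp : p ≫ overHom B = overHom A) : A ⟶ B :=
  CostructuredArrow.homMk ⟨p⟩ (by exact hp)

lemma overHom_w {A B : CostructuredArrow S.ι X} (f : A ⟶ B) :
    f.left.hom ≫ overHom B = overHom A := CostructuredArrow.w f

end

section
variable [HasBinaryBiproducts C] {S : ObjectProperty (AddPsh C)} (hS : IsSerreFP S)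

variable (hC : WeakKernels C)
include hS hC

/-- A section of an object of `S` over `X` which vanishes in `X` can be killed within `S`. -/
lemma exists_kill {X F : AddPsh C} (hF : S F) (h : F ⟶ X) {c : C} (s : F.sec c)
    (hs : ap h c s = 0) :
    ∃ (F' : AddPsh C) (_ : S F') (h' : F' ⟶ X) (p : F ⟶ F'), p ≫ h' = h ∧ ap p c s = 0 := by
  refine ⟨(Sub.span s).quot, hS.quot hC hF _ (isFinGen_span s), (Sub.span s).desc h ?_,
    (Sub.span s).π, Sub.π_desc _ _ _, ?_⟩
  · rintro d _ ⟨f, rfl⟩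
    exact (ap_res h (show d ⟶ c from f) s).trans (by rw [hs, map_zero])
  · rw [Sub.π_eq_zero_iff]
    exact Sub.self_mem_span s

/-- Biproducts give upper bounds. Parallel maps agree in the quotient by the image of their
difference, which still lies over `X` because both maps do. -/
lemma isFiltered_costructuredArrow (X : AddPsh C) : IsFiltered (CostructuredArrow S.ι X) where
  cocone_objs A B :=
    ⟨overMk (hS.biprod A.left.property B.left.property) (biprod.desc (overHom A) (overHom B)),
      overHomMk biprod.inl (biprod.inl_desc _ _), overHomMk biprod.inr (biprod.inr_desc _ _),
      trivial⟩
  cocone_maps A B f g := by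
    let k : A.left.obj ⟶ B.left.obj := f.left.hom - g.left.hom
    have hk : ∀ c, ∀ x ∈ (Sub.range k).carrier c, ap (overHom B) c x = 0 := by
      rintro c _ ⟨x, rfl⟩
      rw [← ap_comp, Preadditive.sub_comp, overHom_w, overHom_w, sub_self, ap_zero]
    refine ⟨overMk (hS.quot hC B.left.property _
      (isFinGen_range k (hS.le _ A.left.property).isFinGen)) ((Sub.range k).desc (overHom B) hk),
      overHomMk (Sub.range k).π (Sub.π_desc _ _ _), ?_⟩
    ext : 1
    apply ObjectProperty.hom_ext
    have : k ≫ (Sub.range k).π = 0 := ext fun c x => by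
      rw [ap_comp, ap_zero, Sub.π_eq_zero_iff]
      exact ⟨x, rfl⟩
    exact sub_eq_zero.1 ((Preadditive.sub_comp _ _ _).symm.trans this)
  nonempty := by
    obtain ⟨Z, _, hZ⟩ := hS.zero
    exact ⟨overMk hZ 0⟩

variable [EssentiallySmall.{v} C]

omit [HasBinaryBiproducts C] hC in
lemma essentiallySmall_costructuredArrow (X : AddPsh C) :
    EssentiallySmall.{v} (CostructuredArrow S.ι X) := by
  have : ObjectProperty.EssentiallySmall.{v} S := .of_le (Q := IsFinPres (C := C)) hS.le
  infer_instance

/-- The torsion subpresheaf is the colimit of all objects of `S` over `X`. Each torsion section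
comes from a stage by definition, and a section dying in `X` already dies at a later stage by
`exists_kill`. The index category is filtered and essentially small. -/
lemma ind_torsion (X : AddPsh C) : ObjectProperty.ind.{v} S (torsion hS X).obj := by
  have := isFiltered_costructuredArrow hS hC X
  have := essentiallySmall_costructuredArrow hS X
  let t := torsion hS X
  let D : CostructuredArrow S.ι X ⥤ AddPsh C := CostructuredArrow.proj S.ι X ⋙ S.ι
  let lft (A : CostructuredArrow S.ι X) : D.obj A ⟶ t.obj :=
    t.lift (overHom A) fun c x => ⟨_, A.left.property, overHom A, x, rfl⟩
  have hlft (A) : lft A ≫ t.ι = overHom A := t.lift_ι _ _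
  let ι : D ⟶ (Functor.const _).obj t.obj :=
    { app := lft
      naturality := fun A B f => by
        rw [← cancel_mono t.ι, Category.assoc, hlft]
        exact (CostructuredArrow.w f).trans ((Category.assoc _ _ _).trans
          ((Category.comp_id _).trans (hlft A))).symm }
  have hsurj (c : C) (x : t.obj.sec c) : ∃ (A : CostructuredArrow S.ι X) (s : (D.obj A).sec c),
      ap (lft A) c s = x := by
    obtain ⟨F, hF, h, s, hs⟩ := t.ι_mem c x
    exact ⟨overMk hF h, s, t.ι_injective c hs⟩
  have hkill (σ : Cocone D) (A : CostructuredArrow S.ι X) (c : C) (s : (D.obj A).sec c)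
      (hs : ap (lft A) c s = 0) : ap (σ.ι.app A) c s = 0 := by
    have hs' : ap (overHom A) c s = 0 := by
      rw [← hlft A]
      exact (congr_arg (ap t.ι c) hs).trans (map_zero _)
    obtain ⟨F', hF', h', p, hp, hps⟩ := exists_kill hS hC A.left.property (overHom A) s hs'
    let q : A ⟶ overMk hF' h' := overHomMk p hp
    rw [← σ.w q, ap_comp]
    exact (congr_arg _ hps).trans (map_zero _)
  have hwd (σ : Cocone D) (A B : CostructuredArrow S.ι X) (c : C) (s : (D.obj A).sec c)
      (s' : (D.obj B).sec c) (hs : ap (lft A) c s = ap (lft B) c s') :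
      ap (σ.ι.app A) c s = ap (σ.ι.app B) c s' := by
    let a : A ⟶ IsFiltered.max A B := IsFiltered.leftToMax A B
    let b : B ⟶ IsFiltered.max A B := IsFiltered.rightToMax A B
    have h1 : ap (lft A) c s = ap (lft _) c (ap (D.map a) c s) := by
      rw [← ap_comp]
      exact (congr_arg (fun φ => ap φ c s) ((ι.naturality a).trans (Category.comp_id _))).symm
    have h2 : ap (lft B) c s' = ap (lft _) c (ap (D.map b) c s') := by
      rw [← ap_comp]
      exact (congr_arg (fun φ => ap φ c s') ((ι.naturality b).trans (Category.comp_id _))).symm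
    rw [← σ.w a, ← σ.w b, ap_comp, ap_comp, ← sub_eq_zero, ← map_sub]
    apply hkill
    rw [map_sub, ← h1, ← h2, hs, sub_self]
  -- The descended map is computed at an arbitrarily chosen stage; `hwd` makes the choice
  -- immaterial.
  choose A s hAs using hsurj
  refine ObjectProperty.of_essentiallySmall_index (J := CostructuredArrow S.ι X)
    ⟨D, ι, ⟨fun σ => mkHom (fun c => AddMonoidHom.mk'
      (fun x => ap (σ.ι.app (A c x)) c (s c x)) fun x y => ?_) ?_, ?_, ?_⟩⟩
      fun A => A.left.property
  · let a := IsFiltered.leftToMax (A c x) (A c y)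
    let b := IsFiltered.rightToMax (A c x) (A c y)
    have h1 : ap (lft _) c (ap (D.map a) c (s c x)) = ap (lft _) c (s c x) := by
      rw [← ap_comp]
      exact congr_arg (fun φ => ap φ c (s c x)) ((ι.naturality a).trans (Category.comp_id _))
    have h2 : ap (lft _) c (ap (D.map b) c (s c y)) = ap (lft _) c (s c y) := by
      rw [← ap_comp]
      exact congr_arg (fun φ => ap φ c (s c y)) ((ι.naturality b).trans (Category.comp_id _))
    rw [← σ.w a, ← σ.w b, ap_comp, ap_comp, ← map_add]
    apply hwd
    rw [hAs, map_add, h1, h2, hAs, hAs]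
  · intro c d f x
    change ap _ c _ = σ.pt.res f (ap _ d _)
    rw [← ap_res]
    apply hwd
    rw [hAs, ap_res, hAs]
  · intro σ B
    refine ext fun c x => ?_
    exact hwd σ _ _ c _ _ (hAs c (ap (lft B) c x))
  · intro σ m hm
    refine ext fun c x => ?_
    change _ = ap (σ.ι.app (A c x)) c (s c x)
    rw [← hm]
    change _ = ap m c (ap (lft _) c (s c x))
    rw [hAs]

end
end AddPsh

/-! ### Injective hulls under equivalences, and localizations given by reflections -/

section InjectiveHulls

variable {C D : Type*} [Category* C] [Category* D]

lemma IsInjectiveHull.iso_comp {X Y J : C} {i : X ⟶ J} (h : IsInjectiveHull i) (e : Y ≅ X) :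
    IsInjectiveHull (e.hom ≫ i) where
  mono := have := h.mono; inferInstance
  injective := h.injective
  essential g hg := h.essential g (by
    have : i ≫ g = e.inv ≫ (e.hom ≫ i) ≫ g := by simp
    rw [this]
    exact mono_comp _ _)

lemma IsInjectiveHull.map_inverse {X J : C} {i : X ⟶ J} (h : IsInjectiveHull i) (e : D ≌ C) :
    IsInjectiveHull (e.inverse.map i) where
  mono := have := h.mono; inferInstance
  injective := by
    have := h.injective
    exact Injective.injective_of_adjoint e.toAdjunction J
  essential {Z} g hg := by
    have h1 : Mono (e.functor.map (e.inverse.map i ≫ g)) := inferInstance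
    have h2 : Mono (e.counitInv.app J ≫ e.functor.map g) := h.essential _ (by
      have : i ≫ e.counitInv.app J ≫ e.functor.map g =
          e.counitInv.app X ≫ e.functor.map (e.inverse.map i ≫ g) := by simp
      rw [this]
      exact mono_comp _ _)
    have h3 : Mono (e.functor.map g) := by
      have : e.functor.map g = e.counit.app J ≫ e.counitInv.app J ≫ e.functor.map g := by simp
      rw [this]
      exact mono_comp _ _
    exact e.functor.mono_of_mono_map h3

/-- A left adjoint with fully faithful right adjoint is a localization at `W` when it inverts `W`
and the unit lies in `W`. -/
lemma exists_equivalence_of_reflection {G : C ⥤ D} {F : D ⥤ C} (adj : G ⊣ F) [F.Full] [F.Faithful]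
    (W : MorphismProperty C) (hG : W.IsInvertedBy G) (hW : ∀ X, W (adj.unit.app X)) :
    ∃ e : W.Localization ≌ D, Nonempty (G ⋙ e.inverse ≅ W.Q) := by
  have : ∀ X : C, IsIso ((Functor.whiskerRight adj.unit W.Q).app X) := fun X =>
    Localization.inverts W.Q W _ (hW X)
  have : IsIso (Functor.whiskerRight adj.unit W.Q) := NatIso.isIso_of_isIso_app _
  let e : W.Localization ≌ D := CategoryTheory.Equivalence.mk (Localization.lift G hG W.Q) (F ⋙ W.Q)
    (Localization.liftNatIso W.Q W W.Q (G ⋙ F ⋙ W.Q) _ _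
    (W.Q.leftUnitor.symm ≪≫ asIso (Functor.whiskerRight adj.unit W.Q)))
    (Functor.associator _ _ _ ≪≫ Functor.isoWhiskerLeft _ (Localization.fac G hG W.Q) ≪≫
      asIso adj.counit)
  exact ⟨e, ⟨(W.Q.leftUnitor.symm ≪≫ asIso (Functor.whiskerRight adj.unit W.Q)).symm⟩⟩

end InjectiveHulls

/-! ### The Gabriel quotient by a torsion class -/

namespace AddPsh
variable {C : Type u} [Category.{v} C] [Preadditive C]

section
variable {F G X Y : AddPsh C}

lemma exists_lift_of_mono (i : X ⟶ Y) [Mono i] (φ : G ⟶ Y)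
    (h : ∀ c y, ∃ x, ap i c x = ap φ c y) : ∃ ψ : G ⟶ X, ψ ≫ i = φ := by
  have hi := injective_of_mono i
  choose f hf using h
  refine ⟨mkHom (fun c => AddMonoidHom.mk' (f c) fun x y => hi c ?_) ?_, ext hf⟩
  · rw [map_add, hf, hf, hf, map_add]
  · intro c d g x
    apply hi c
    change ap i c (f c _) = ap i c (X.res g (f d x))
    rw [hf, ap_res, ap_res, hf]

lemma nonempty_iso_cokernel (f : F ⟶ X) (p : X ⟶ G) [Epi p]
    (h : ∀ c x, ap p c x = 0 ↔ ∃ a, ap f c a = x) : Nonempty (G ≅ cokernel f) := by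
  have w : f ≫ p = 0 := ext fun c a => (h c _).2 ⟨a, rfl⟩
  have : IsIso (cokernel.desc f p w) := isIso_of_bijective _ fun c => by
    constructor
    · rw [injective_iff_map_eq_zero]
      intro x hx
      obtain ⟨y, rfl⟩ := surjective_of_epi (cokernel.π f) c x
      rw [← ap_comp, cokernel.π_desc] at hx
      obtain ⟨a, rfl⟩ := (h c y).1 hx
      rw [← ap_comp, cokernel.condition, ap_zero]
    · intro y
      obtain ⟨x, rfl⟩ := surjective_of_epi p c y
      exact ⟨ap (cokernel.π f) c x, by rw [← ap_comp, cokernel.π_desc]⟩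
  exact ⟨(asIso (cokernel.desc f p w)).symm⟩

lemma nonempty_iso_kernel (f : X ⟶ F) (i : G ⟶ X) [Mono i]
    (h : ∀ c x, ap f c x = 0 ↔ ∃ a, ap i c a = x) : Nonempty (G ≅ kernel f) := by
  have w : i ≫ f = 0 := ext fun c a => (h c _).2 ⟨a, rfl⟩
  have : IsIso (kernel.lift f i w) := isIso_of_bijective _ fun c => by
    constructor
    · rw [injective_iff_map_eq_zero]
      intro x hx
      apply injective_of_mono i c
      rw [map_zero, ← kernel.lift_ι f i w, ap_comp, hx, map_zero]
    · intro y
      obtain ⟨a, ha⟩ := (h c (ap (kernel.ι f) c y)).1 (by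
        rw [← ap_comp, kernel.condition, ap_zero])
      refine ⟨a, injective_of_mono (kernel.ι f) c ?_⟩
      rw [← ap_comp, kernel.lift_ι, ha]
  exact ⟨asIso (kernel.lift f i w)⟩

lemma shortExact_sub (N : Sub X) : (ShortComplex.mk N.ι N.π N.ι_π).ShortExact where
  exact := exact_of_sec _ fun _ _ h => N.exists_ι ((N.π_eq_zero_iff _).1 h)
  mono_f := inferInstanceAs (Mono N.ι)
  epi_g := inferInstanceAs (Epi N.π)

end

section
variable [HasZeroObject C] [HasBinaryBiproducts C] {S : ObjectProperty (AddPsh C)}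
  (hS : IsSerreFP S) (hC : WeakKernels C)
include hC

/-- Torsion is closed under extensions. Given `F ⟶ X / tX` with `F` in `S`, lift the generator of
`F` to a section `z` of `X`. The relation `α` makes `z` restrict to a torsion section, coming from
some `F₁` in `S`; gluing gives an extension in `S` through which `z` factors, so `z` is torsion. -/
lemma isTorsionFree_quot_torsion (X : AddPsh C) : IsTorsionFree S (torsion hS X).quot := by
  intro F hF g
  let t := torsion hS X
  obtain ⟨A, B, α, x, hx⟩ := hS.le F hF
  obtain ⟨z, hz⟩ := t.π_surjective B (ap g B x)
  have hα : F.res α x = 0 := (hx.rel α).2 ⟨𝟙 A, Category.id_comp α⟩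
  have hαz : X.res α z ∈ t.carrier A := by
    rw [← t.π_eq_zero_iff, ap_res, hz, ← ap_res, hα, map_zero]
  obtain ⟨F₁, hF₁, h, s, hs⟩ := hαz
  obtain ⟨w, hw1, hw2⟩ := exists_biprod_sec (F := rep B) (G := F₁) (repSec α) (-s)
  have hw : w = ap (biprod.inl : rep B ⟶ rep B ⊞ F₁) A (repSec α) -
      ap (biprod.inr : F₁ ⟶ rep B ⊞ F₁) A s := by
    apply biprod_sec_ext
    · rw [hw1, map_sub, ← ap_comp, ← ap_comp]
      simp
    · rw [hw2, map_sub, ← ap_comp, ← ap_comp]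
      simp
  -- `N.quot` is the pushout of `rep B` and `F₁` along `rep A`; `hdesc` lets `z` and `h` glue to a
  -- map from it to `X`.
  let N : Sub (rep B ⊞ F₁) := Sub.span w
  have hP : IsFinPres N.quot := .quot (.biprod (isFinPres_rep B) (hS.le _ hF₁)) N (isFinGen_span w)
  have hdesc : ∀ c, ∀ y ∈ N.carrier c, ap (biprod.desc (ofSec z) h) c y = 0 := by
    rintro c _ ⟨f, rfl⟩
    refine (ap_res (biprod.desc (ofSec z) h) (show c ⟶ A from f) w).trans ?_
    rw [hw, map_sub, ← ap_comp, ← ap_comp, biprod.inl_desc, biprod.inr_desc, ap_ofSec, hs,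
      sub_self, map_zero]
  let k : F₁ ⟶ N.quot := biprod.inr ≫ N.π
  -- The pushout is an extension of `M.quot`, which is a quotient of `F`, by the image `M` of `F₁`;
  -- both ends lie in `S`.
  let M : Sub N.quot := Sub.range k
  have hM : S M.obj := hS.range hC k hF₁ hP
  let b : M.quot.sec B := ap M.π B (ap N.π B (ap (biprod.inl : rep B ⟶ _) B (repSec (𝟙 B))))
  have hid {c : C} (f : c ⟶ B) : (rep B).res f (repSec (𝟙 B)) = repSec f := Category.comp_id f
  have hb {c : C} (f : c ⟶ B) : M.quot.res f b =
      ap M.π c (ap N.π c (ap (biprod.inl : rep B ⟶ _) c (repSec f))) := by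
    rw [← ap_res, ← ap_res, ← ap_res, hid]
  have hinr {c : C} (y : F₁.sec c) :
      ap M.π c (ap N.π c (ap (biprod.inr : F₁ ⟶ rep B ⊞ F₁) c y)) = 0 :=
    (M.π_eq_zero_iff _).2 ⟨y, rfl⟩
  have hαb : M.quot.res α b = 0 := by
    have : ap (biprod.inl : rep B ⟶ rep B ⊞ F₁) A (repSec α) =
        w + ap (biprod.inr : F₁ ⟶ rep B ⊞ F₁) A s := by rw [hw, sub_add_cancel]
    rw [hb, this, map_add, map_add, hinr, (N.π_eq_zero_iff w).2 (Sub.self_mem_span w), map_zero,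
      add_zero]
  obtain ⟨φ, hφ⟩ := hx.exists_hom b hαb
  have : Epi φ := epi_of_surjective _ fun c y => by
    obtain ⟨y, rfl⟩ := M.π_surjective c y
    obtain ⟨y, rfl⟩ := N.π_surjective c y
    refine ⟨F.res (show c ⟶ B from ap biprod.fst c y) x, ?_⟩
    rw [ap_res, hφ, hb]
    have hy : y = ap (biprod.inl : rep B ⟶ rep B ⊞ F₁) c (ap biprod.fst c y) +
        ap (biprod.inr : F₁ ⟶ rep B ⊞ F₁) c (ap biprod.snd c y) := by
      rw [← ap_comp, ← ap_comp, ← ap_add, biprod.total, ap_id]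
    conv_rhs => rw [hy, map_add, map_add, hinr, add_zero]
    rfl
  have hMq : IsFinPres M.quot := .quot hP M (hS.le _ hM).isFinGen
  have hSP : S N.quot := (hS.serre _ (shortExact_sub M) (hS.le _ hM) hP hMq).2
    ⟨hM, hS.of_epi hC φ hF hMq⟩
  have hzt : z ∈ t.carrier B := by
    refine ⟨N.quot, hSP, N.desc _ hdesc,
      ap N.π B (ap (biprod.inl : rep B ⟶ _) B (repSec (𝟙 B))), ?_⟩
    rw [Sub.desc_π, ← ap_comp, biprod.inl_desc, ap_ofSec, res_id]
  refine hx.gen.hom_ext ?_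
  rw [← hz, ap_zero]
  exact (t.π_eq_zero_iff z).2 hzt

omit [HasZeroObject C] in
-- A section of `X` that becomes torsion in `J` is already torsion in `X`, as witnessed by the span
-- of one section of an object of `S`. So `X` meets the torsion of `J` trivially, and essentiality
-- makes `J ⟶ J / tJ` a monomorphism.
lemma IsTorsionFree.of_isInjectiveHull {X J : AddPsh C} (hX : IsTorsionFree S X) {i : X ⟶ J}
    (hi : IsInjectiveHull i) (hS : IsSerreFP S) : IsTorsionFree S J := by
  have := hi.mono
  have h1 : Mono (i ≫ (torsion hS J).π) := mono_of_injective _ fun c => by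
    rw [injective_iff_map_eq_zero]
    intro x hx
    obtain ⟨F, hF, h, s, hs⟩ := ((torsion hS J).π_eq_zero_iff _).1 hx
    replace hs : ap h c s = ap i c x := hs
    obtain ⟨ψ, hψ⟩ := exists_lift_of_mono i ((Sub.span s).ι ≫ h) fun d y => by
      obtain ⟨f, hf⟩ := Sub.mem_span.1 ((Sub.span s).ι_mem d y)
      exact ⟨X.res f x, by rw [ap_res, ← hs, ap_comp, ← hf, ap_res]⟩
    obtain ⟨s', hs'⟩ := (Sub.span s).exists_ι (Sub.self_mem_span s)
    have hx' : ap ψ c s' = x := injective_of_mono i c (by rw [← ap_comp, hψ, ap_comp, hs', hs])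
    exact isTorsionFree_iff.1 hX c x ⟨_, hS.span hC hF s, ψ, s', hx'⟩
  have := hi.essential _ h1
  refine isTorsionFree_iff.2 fun c x hx => ?_
  apply injective_of_mono (torsion hS J).π c
  rw [map_zero]
  exact ((torsion hS J).π_eq_zero_iff x).2 hx

end

/-- The morphisms with kernel and cokernel a filtered colimit of objects of `S`. -/
def indIso (S : ObjectProperty (AddPsh C)) : MorphismProperty (AddPsh C) := fun _ _ f =>
  ObjectProperty.ind.{v} S (kernel f) ∧ ObjectProperty.ind.{v} S (cokernel f)

section
variable {S : ObjectProperty (AddPsh C)} {X Y Z : AddPsh C}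

lemma indIso.hom_ext {f : X ⟶ Y} (hf : indIso S f) (hZ : IsTorsionFree S Z) {g g' : Y ⟶ Z}
    (h : f ≫ g = f ≫ g') : g = g' := by
  have h0 : f ≫ (g - g') = 0 := by rw [Preadditive.comp_sub, h, sub_self]
  rw [← sub_eq_zero, ← cokernel.π_desc f _ h0, hom_eq_zero_of_ind hf.2 hZ (cokernel.desc f _ h0),
    comp_zero]

lemma indIso.exists_extension {f : X ⟶ Y} (hf : indIso S f) (hZ : IsTorsionFree S Z)
    [Injective Z] (g : X ⟶ Z) : ∃ g' : Y ⟶ Z, f ≫ g' = g := by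
  have hg : kernel.ι f ≫ g = 0 := hom_eq_zero_of_ind hf.1 hZ _
  have hex : (ShortComplex.mk (kernel.ι f) f (kernel.condition f)).Exact :=
    ShortComplex.exact_kernel f
  exact ⟨hex.descToInjective g hg, hex.comp_descToInjective g hg⟩

lemma isLocal_of_isTorsionFree [Injective Z] (hZ : IsTorsionFree S Z) : (indIso S).isLocal Z :=
  fun _ _ _ hf => ⟨fun _ _ h => hf.hom_ext hZ h, fun g => hf.exists_extension hZ g⟩

/-- A map into the kernel extends along `f` to a map into `Z`. Its composite with `φ` vanishes after
`f`, hence vanishes because `Y` is torsion-free, so the extension lands in the kernel. -/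
lemma isLocal_ker [Injective Z] (hZ : IsTorsionFree S Z) (φ : Z ⟶ Y) (hY : IsTorsionFree S Y) :
    (indIso S).isLocal (Sub.ker φ).obj := fun A B f hf => by
  refine ⟨fun _ _ h => hf.hom_ext (isTorsionFree_of_mono (Sub.ker φ).ι hZ) h, fun g => ?_⟩
  obtain ⟨g', hg'⟩ := hf.exists_extension hZ (g ≫ (Sub.ker φ).ι)
  have h0 : g' ≫ φ = 0 := hf.hom_ext hY (by
    rw [← Category.assoc, hg', comp_zero, Category.assoc]
    refine ext fun c x => ?_
    exact (Sub.ker φ).ι_mem c (ap g c x))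
  refine ⟨(Sub.ker φ).lift g' fun c x => ?_, ?_⟩
  · rw [Sub.mem_ker, ← ap_comp, h0, ap_zero]
  · rw [← cancel_mono (Sub.ker φ).ι]
    exact (Category.assoc _ _ _).trans hg'

end

variable [HasZeroObject C] [HasBinaryBiproducts C] [EssentiallySmall.{v} C]
  {S : ObjectProperty (AddPsh C)} (hS : IsSerreFP S) (hC : WeakKernels C)
include hS hC

/-- Every presheaf maps, by a morphism of `indIso S`, to a local subobject of the injective hull
of its largest torsion-free quotient. -/
lemma exists_reflection (X : AddPsh C) : ∃ (L I : AddPsh C) (η : X ⟶ L) (k : L ⟶ I),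
    indIso S η ∧ (indIso S).isLocal L ∧ Injective I ∧ IsTorsionFree S I ∧ Mono k ∧
    (∀ {Z : AddPsh C} (g : I ⟶ Z), Mono (k ≫ g) → Mono g) ∧
    ∀ c x, ap η c x = 0 → IsTorsionSec S X x := by
  let t := torsion hS X
  have htf : IsTorsionFree S t.quot := isTorsionFree_quot_torsion hS hC X
  obtain ⟨I, j, hj⟩ := exists_injectiveHull t.quot
  have := hj.injective
  have := hj.mono
  have hI : IsTorsionFree S I := htf.of_isInjectiveHull hC hj hS
  -- The reflection is `Sub.ker φ`, the preimage in `I` of the torsion of `I / N`. Then the kernel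
  -- of `X ⟶ Sub.ker φ` is the torsion of `X`, and its cokernel is the torsion of `I / N`.
  let N := Sub.range j
  let t' := torsion hS N.quot
  let φ := N.π ≫ t'.π
  have hφ {c : C} (y : I.sec c) : ap φ c y = 0 ↔ ap N.π c y ∈ t'.carrier c := t'.π_eq_zero_iff _
  have hjφ (c : C) (x : t.quot.sec c) : ap j c x ∈ (Sub.ker φ).carrier c := by
    rw [Sub.mem_ker, hφ, (N.π_eq_zero_iff _).2 ⟨x, rfl⟩]
    exact zero_mem _
  let j' : t.quot ⟶ (Sub.ker φ).obj := (Sub.ker φ).lift j hjφ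
  have hj' : j' ≫ (Sub.ker φ).ι = j := Sub.lift_ι _ _ _
  have : Mono j' := by
    have : Mono (j' ≫ (Sub.ker φ).ι) := by rw [hj']; infer_instance
    exact mono_of_mono _ (Sub.ker φ).ι
  have hη (c : C) (x : X.sec c) : ap (t.π ≫ j') c x = 0 ↔ IsTorsionSec S X x := by
    rw [ap_comp, map_eq_zero_iff _ (injective_of_mono j' c)]
    exact t.π_eq_zero_iff x
  refine ⟨(Sub.ker φ).obj, I, t.π ≫ j', (Sub.ker φ).ι, ⟨?_, ?_⟩,
    isLocal_ker hI φ (isTorsionFree_quot_torsion hS hC _), inferInstance, hI, inferInstance,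
    fun g hg => hj.essential g ?_, fun c x h => (hη c x).1 h⟩
  · obtain ⟨e⟩ := nonempty_iso_kernel (t.π ≫ j') t.ι fun c x =>
      (hη c x).trans ⟨fun h => t.exists_ι h, by rintro ⟨a, rfl⟩; exact t.ι_mem c a⟩
    exact ObjectProperty.prop_of_iso _ e (ind_torsion hS hC X)
  · let p : (Sub.ker φ).obj ⟶ t'.obj := t'.lift ((Sub.ker φ).ι ≫ N.π)
      fun c x => (hφ _).1 ((Sub.ker φ).ι_mem c x)
    have hp : p ≫ t'.ι = (Sub.ker φ).ι ≫ N.π := Sub.lift_ι _ _ _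
    have : Epi p := epi_of_surjective _ fun c y => by
      obtain ⟨z, hz⟩ := N.π_surjective c (ap t'.ι c y)
      obtain ⟨z', rfl⟩ := (Sub.ker φ).exists_ι (x := z) (by
        rw [Sub.mem_ker, hφ, hz]
        exact t'.ι_mem c y)
      refine ⟨z', t'.ι_injective c ?_⟩
      rw [← ap_comp, hp, ap_comp, hz]
    obtain ⟨e⟩ := nonempty_iso_cokernel (t.π ≫ j') p fun c x => by
      rw [← map_eq_zero_iff (ap t'.ι c) (t'.ι_injective c), ← ap_comp, hp, ap_comp,
        N.π_eq_zero_iff, Sub.mem_range]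
      constructor
      · rintro ⟨y, hy⟩
        obtain ⟨z, rfl⟩ := t.π_surjective c y
        refine ⟨z, (Sub.ker φ).ι_injective c ?_⟩
        rw [← hy, ← hj']
        rfl
      · rintro ⟨z, rfl⟩
        refine ⟨ap t.π c z, ?_⟩
        rw [← hj']
        rfl
    exact ObjectProperty.prop_of_iso _ e (ind_torsion hS hC _)
  · rw [← hj', Category.assoc]
    exact mono_comp _ _

/-- The quotient functor inverting `indIso S` has a right adjoint, and the image of every presheaf
has an injective hull, which corresponds to a torsion-free injective presheaf. -/
theorem exists_injectiveHull_localization (X : AddPsh C) :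
    ∃ (R : (indIso S).Localization ⥤ AddPsh C) (_ : (indIso S).Q ⊣ R)
      (J : (indIso S).Localization) (i : (indIso S).Q.obj X ⟶ J), IsInjectiveHull i ∧
      ∃ (I : AddPsh C) (φ : X ⟶ I), Nonempty (I ≅ R.obj J) ∧ Injective I ∧ IsTorsionFree S I ∧
        ∀ c x, ap φ c x = 0 → IsTorsionSec S X x := by
  choose L I η k hη hL hI hIt hk hess hker using exists_reflection hS hC
  let P := (indIso S).isLocal
  -- Locality of `Z` against `η A` says exactly that `L` is left adjoint to the inclusion of the
  -- local objects.
  let e (A : AddPsh C) (Z : P.FullSubcategory) :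
      ((⟨L A, hL A⟩ : P.FullSubcategory) ⟶ Z) ≃ (A ⟶ P.ι.obj Z) :=
    (P.fullyFaithfulι.homEquiv).trans (Equiv.ofBijective _ (Z.property (η A) (hη A)))
  have he (A Z) (f : (⟨L A, hL A⟩ : P.FullSubcategory) ⟶ Z) : e A Z f = η A ≫ f.hom := rfl
  have hnat : ∀ A Z Z' (g : Z ⟶ Z') (h : (⟨L A, hL A⟩ : P.FullSubcategory) ⟶ Z),
      e A Z' (h ≫ g) = e A Z h ≫ P.ι.map g := fun A Z Z' g h => by
    rw [he, he]
    exact (Category.assoc _ _ _).symm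
  let adj := Adjunction.adjunctionOfEquivLeft e hnat
  have hunit (A) : adj.unit.app A = η A := by
    rw [← Adjunction.homEquiv_id]
    exact Category.comp_id (η A)
  obtain ⟨E, ⟨iso⟩⟩ := exists_equivalence_of_reflection adj (indIso S) (fun A B f hf => by
    rw [← ObjectProperty.isLocal_iff_isIso_map adj]
    rintro _ ⟨Z, rfl⟩
    exact Z.property f hf) fun A => by
      rw [hunit]
      exact hη A
  -- The injective `I X` is itself local, so `k X` is an injective hull among local objects; it is
  -- then carried across the equivalence `E`.
  let J : P.FullSubcategory := ⟨I X, have := hI X; isLocal_of_isTorsionFree (hIt X)⟩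
  let κ : (⟨L X, hL X⟩ : P.FullSubcategory) ⟶ J := ⟨k X⟩
  have hκ : IsInjectiveHull κ :=
    { mono := P.ι.mono_of_mono_map (hk X)
      injective := ⟨fun {A B} g f hf => by
        have : P.ι.IsRightAdjoint := adj.isRightAdjoint
        have : Mono f.hom := inferInstanceAs (Mono (P.ι.map f))
        have := hI X
        exact ⟨⟨Injective.factorThru (J := I X) g.hom f.hom⟩,
          ObjectProperty.hom_ext _ (Injective.comp_factorThru (J := I X) g.hom f.hom)⟩⟩
      essential := fun {Z} g hg => by
        have : P.ι.IsRightAdjoint := adj.isRightAdjoint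
        exact P.ι.mono_of_mono_map (hess X g.hom (inferInstanceAs (Mono (P.ι.map (κ ≫ g))))) }
  refine ⟨E.functor ⋙ P.ι, (adj.comp E.symm.toAdjunction).ofNatIsoLeft iso, E.inverse.obj J,
    (iso.app X).inv ≫ E.inverse.map κ, ?_, I X, η X ≫ k X,
    ⟨(P.ι.mapIso (E.counitIso.app J)).symm⟩, hI X, hIt X, fun c x hx => hker X c x ?_⟩
  · exact (hκ.map_inverse E).iso_comp (iso.app X).symm
  · have := hk X
    rwa [ap_comp, map_eq_zero_iff _ (injective_of_mono (k X) c)] at hx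

end AddPsh

/-! ### Coproducts and compact objects -/

section Coproducts

variable {T : Type u} [Category.{v} T] [Preadditive T] [HasCoproducts.{v} T]

open scoped Classical in
/-- The projection of a coproduct to a summand. -/
def sigmaProj {J : Type v} (Y : J → T) (j : J) : ∐ Y ⟶ Y j :=
  Sigma.desc (Pi.single (M := fun i => Y i ⟶ Y j) j (𝟙 (Y j)))

@[simp] lemma ι_sigmaProj_self {J : Type v} (Y : J → T) (j : J) :
    Sigma.ι Y j ≫ sigmaProj Y j = 𝟙 _ := by
  simp [sigmaProj]

lemma ι_sigmaProj_of_ne {J : Type v} (Y : J → T) {i j : J} (h : i ≠ j) :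
    Sigma.ι Y i ≫ sigmaProj Y j = 0 := by
  simp [sigmaProj, h]

/-- The projector of a coproduct onto finitely many summands. -/
def sigmaIdem {J : Type v} (Y : J → T) (s : Finset J) : ∐ Y ⟶ ∐ Y :=
  ∑ j ∈ s, sigmaProj Y j ≫ Sigma.ι Y j

lemma ι_sigmaIdem {J : Type v} (Y : J → T) {s : Finset J} {j : J} (hj : j ∈ s) :
    Sigma.ι Y j ≫ sigmaIdem Y s = Sigma.ι Y j := by
  classical
  rw [sigmaIdem, Preadditive.comp_sum, Finset.sum_eq_single j]
  · rw [← Category.assoc, ι_sigmaProj_self, Category.id_comp]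
  · intro i _ hi
    rw [← Category.assoc, ι_sigmaProj_of_ne Y hi.symm, zero_comp]
  · exact fun h => (h hj).elim

lemma sigmaIdem_comp_of_subset {J : Type v} (Y : J → T) {s t : Finset J} (h : s ⊆ t) :
    sigmaIdem Y s ≫ sigmaIdem Y t = sigmaIdem Y s := by
  rw [sigmaIdem, Preadditive.sum_comp]
  refine Finset.sum_congr rfl fun j hj => ?_
  rw [Category.assoc, ι_sigmaIdem Y (h hj)]

lemma comp_sigmaIdem_of_subset {J : Type v} {Y : J → T} {s t : Finset J} (h : s ⊆ t) {X : T}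
    {f : X ⟶ ∐ Y} (hf : f ≫ sigmaIdem Y s = f) : f ≫ sigmaIdem Y t = f := by
  rw [← hf, Category.assoc, sigmaIdem_comp_of_subset Y h]

/-- An object is compact if and only if every map to a coproduct factors through a finite
subcoproduct. -/
lemma isCompact_iff (X : T) : isCompact T X ↔
    ∀ (J : Type v) (Y : J → T) (f : X ⟶ ∐ Y), ∃ s : Finset J, f ≫ sigmaIdem Y s = f := by
  classical
  constructor
  · intro hX J Y f
    have := hX J
    -- `N` consists of the maps through finite subcoproducts. The quotient by `N` vanishes on each
    -- summand, so it is zero when `Hom(X, -)` preserves the coproduct.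
    let N : AddSubgroup (X ⟶ ∐ Y) :=
      { carrier := {f | ∃ s : Finset J, f ≫ sigmaIdem Y s = f}
        zero_mem' := ⟨∅, zero_comp⟩
        add_mem' := by
          rintro f g ⟨s, hs⟩ ⟨t, ht⟩
          exact ⟨s ∪ t, by
            rw [Preadditive.add_comp, comp_sigmaIdem_of_subset Finset.subset_union_left hs,
              comp_sigmaIdem_of_subset Finset.subset_union_right ht]⟩
        neg_mem' := by
          rintro f ⟨s, hs⟩
          exact ⟨s, by rw [Preadditive.neg_comp, hs]⟩ }
    let F := preadditiveCoyoneda.obj (op X)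
    let q : F.obj (∐ Y) ⟶ AddCommGrpCat.of ((X ⟶ ∐ Y) ⧸ N) :=
      AddCommGrpCat.ofHom (QuotientAddGroup.mk' N)
    have hq : q = 0 := by
      refine (isColimitOfPreserves F (coproductIsCoproduct Y)).hom_ext fun ⟨j⟩ => ?_
      have hj (g : X ⟶ Y j) : g ≫ Sigma.ι Y j ∈ N := ⟨{j}, by
        rw [Category.assoc, ι_sigmaIdem Y (Finset.mem_singleton_self j)]⟩
      ext g
      exact (QuotientAddGroup.eq_zero_iff _).2 (hj g)
    have hf : QuotientAddGroup.mk' N f = 0 := congr_arg (fun φ => φ.hom f) hq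
    exact (QuotientAddGroup.eq_zero_iff f).1 hf
  · intro h J
    let F := preadditiveCoyoneda.obj (op X)
    suffices ∀ Y : J → T, PreservesColimit (Discrete.functor Y) F from
      preservesColimitsOfShape_of_discrete F
    intro Y
    refine preservesColimit_of_preserves_colimit_cocone (coproductIsCoproduct Y)
      ((isColimitMapCoconeCofanMkEquiv F Y (Sigma.ι Y)).symm ?_)
    -- Finite support makes the sum defining the descended map `d` additive.
    have hfin {A : AddCommGrpCat.{v}} (a : ∀ j, F.obj (Y j) ⟶ A) (f : X ⟶ ∐ Y) :
        (Function.support fun j => (a j).hom (f ≫ sigmaProj Y j)).Finite := by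
      obtain ⟨s, hs⟩ := h J Y f
      refine s.finite_toSet.subset fun j hj => ?_
      by_contra hjs
      apply hj
      have h0 : f ≫ sigmaProj Y j = 0 := by
        rw [← hs, Category.assoc, sigmaIdem, Preadditive.sum_comp]
        rw [Finset.sum_eq_zero, comp_zero]
        intro i hi
        rw [Category.assoc, ι_sigmaProj_of_ne Y (fun hij : i = j => hjs (hij ▸ Finset.mem_coe.2 hi)), comp_zero]
      change (a j).hom (f ≫ sigmaProj Y j) = 0
      rw [h0]
      exact map_zero _
    let d {A : AddCommGrpCat.{v}} (a : ∀ j, F.obj (Y j) ⟶ A) : F.obj (∐ Y) ⟶ A :=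
      AddCommGrpCat.ofHom (AddMonoidHom.mk' (fun f : X ⟶ ∐ Y =>
        ∑ᶠ j, (a j).hom (f ≫ sigmaProj Y j)) fun f g => by
          rw [← finsum_add_distrib (hfin a f) (hfin a g)]
          refine finsum_congr fun j => ?_
          exact (congr_arg (a j).hom (Preadditive.add_comp X _ _ f g (sigmaProj Y j))).trans
            (map_add _ _ _))
    have hd {A : AddCommGrpCat.{v}} (a : ∀ j, F.obj (Y j) ⟶ A) (j : J) :
        F.map (Sigma.ι Y j) ≫ d a = a j := by
      ext (g : X ⟶ Y j)
      change ∑ᶠ i, (a i).hom ((g ≫ Sigma.ι Y j) ≫ sigmaProj Y i) = (a j).hom g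
      rw [finsum_eq_single _ j]
      · rw [Category.assoc, ι_sigmaProj_self, Category.comp_id]
      · intro i hi
        rw [Category.assoc, ι_sigmaProj_of_ne Y hi.symm, comp_zero]
        exact map_zero _
    refine Cofan.IsColimit.mk _ (fun s => d s.inj) (fun s j => hd s.inj j) fun s m hm => ?_
    ext (f : X ⟶ ∐ Y)
    obtain ⟨t, ht⟩ := h J Y f
    have key (m : F.obj (∐ Y) ⟶ s.pt) : m.hom f =
        ∑ j ∈ t, (F.map (Sigma.ι Y j) ≫ m).hom (f ≫ sigmaProj Y j) := by
      change _ = ∑ j ∈ t, m.hom ((f ≫ sigmaProj Y j) ≫ Sigma.ι Y j)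
      have : f = ∑ j ∈ t, (f ≫ sigmaProj Y j) ≫ Sigma.ι Y j := by
        conv_lhs => rw [← ht, sigmaIdem, Preadditive.comp_sum]
        simp only [Category.assoc]
      conv_lhs => rw [this]
      exact map_sum _ _ _
    rw [key, key]
    refine Finset.sum_congr rfl fun j _ => ?_
    rw [hd s.inj j]
    exact congr_arg (fun φ => φ.hom (f ≫ sigmaProj Y j)) (hm j)

lemma isCompact_of_retract {X Y : T} (r : Retract X Y) (hY : isCompact T Y) : isCompact T X := by
  rw [isCompact_iff] at hY ⊢
  intro J Z f
  obtain ⟨s, hs⟩ := hY J Z (r.r ≫ f)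
  refine ⟨s, ?_⟩
  have := congr_arg (r.i ≫ ·) hs
  simpa using this

lemma isCompact_biprod [HasBinaryBiproducts T] {X Y : T} (hX : isCompact T X)
    (hY : isCompact T Y) : isCompact T (X ⊞ Y) := by
  classical
  rw [isCompact_iff] at hX hY ⊢
  intro J Z f
  obtain ⟨s, hs⟩ := hX J Z (biprod.inl ≫ f)
  obtain ⟨t, ht⟩ := hY J Z (biprod.inr ≫ f)
  refine ⟨s ∪ t, ?_⟩
  ext
  · rw [← Category.assoc, comp_sigmaIdem_of_subset Finset.subset_union_left hs]
  · rw [← Category.assoc, comp_sigmaIdem_of_subset Finset.subset_union_right ht]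

instance : (isCompact T).IsStableUnderRetracts := ⟨fun h hY => isCompact_of_retract h hY⟩

lemma isCompact_of_isZero {X : T} (hX : IsZero X) : isCompact T X := by
  rw [isCompact_iff]
  exact fun J Z f => ⟨∅, hX.eq_of_src _ _⟩

omit [HasCoproducts.{v} T] in
lemma isCompact_of_adjunction {L R : T ⥤ T} (adj : L ⊣ R) [L.Additive]
    [∀ J : Type v, PreservesColimitsOfShape (Discrete J) R] {X : T} (hX : isCompact T X) :
    isCompact T (L.obj X) := by
  intro J
  have := hX J
  let e : R ⋙ preadditiveCoyoneda.obj (op X) ≅ preadditiveCoyoneda.obj (op (L.obj X)) :=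
    NatIso.ofComponents (fun Z => (adj.homAddEquiv X Z).symm.toAddCommGrpIso)
      (fun {Z W} f => by
        ext g
        exact adj.homEquiv_naturality_right_symm g f)
  exact preservesColimitsOfShape_of_natIso e

end Coproducts

/-! ### Compact objects as a triangulated subcategory -/

section Triangulated

variable {T : Type u} [Category.{v} T] [Preadditive T] [HasCoproducts.{v} T] [HasZeroObject T]
  [HasShift T ℤ] [∀ n : ℤ, (shiftFunctor T n).Additive] [Pretriangulated T]

omit [HasCoproducts.{v} T] [HasZeroObject T] [Pretriangulated T] in
lemma isCompact_shift {X : T} (hX : isCompact T X) (n : ℤ) : isCompact T (X⟦n⟧) := by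
  have : (shiftEquiv T n).functor.Additive := inferInstanceAs (shiftFunctor T n).Additive
  exact isCompact_of_adjunction (shiftEquiv T n).toAdjunction hX

/-- Subtracting a finite part of `f` leaves a map that vanishes on `t.obj₂`, hence factors through
the compact object `t.obj₁⟦1⟧`. -/
lemma isCompact_obj₃ {t : Triangle T} (ht : t ∈ distTriang T) (h₁ : isCompact T t.obj₁)
    (h₂ : isCompact T t.obj₂) : isCompact T t.obj₃ := by
  classical
  have h₁' := isCompact_shift h₁ 1
  rw [isCompact_iff] at h₁' h₂ ⊢
  intro J Y f
  obtain ⟨s, hs⟩ := h₂ J Y (t.mor₂ ≫ f)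
  have h0 : t.mor₂ ≫ (f - f ≫ sigmaIdem Y s) = 0 := by
    rw [Preadditive.comp_sub, ← Category.assoc, hs, sub_self]
  obtain ⟨g, hg⟩ := t.yoneda_exact₃ ht _ h0
  obtain ⟨s', hs'⟩ := h₁' J Y g
  refine ⟨s ∪ s', ?_⟩
  have h1 : (f - f ≫ sigmaIdem Y s) ≫ sigmaIdem Y (s ∪ s') = f - f ≫ sigmaIdem Y s := by
    rw [hg, Category.assoc, comp_sigmaIdem_of_subset Finset.subset_union_right hs']
  rwa [Preadditive.sub_comp, Category.assoc, sigmaIdem_comp_of_subset Y Finset.subset_union_left,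
    sub_left_inj] at h1

instance : (isCompact T).IsTriangulated where
  exists_zero := ⟨(HasZeroObject.zero' T).1, isZero_zero T, isCompact_of_isZero (isZero_zero T)⟩
  isStableUnderShiftBy n := ⟨fun _ hX => isCompact_shift hX n⟩
  toIsTriangulatedClosed₂ := .mk' fun _ ht h₁ h₃ =>
    isCompact_obj₃ (inv_rot_of_distTriang _ ht) (isCompact_shift h₃ (-1)) h₁

instance : HasBinaryBiproducts (Cpt T) where
  has_binary_biproduct X Y := by
    let Z : Cpt T := ⟨X.obj ⊞ Y.obj, isCompact_biprod X.property Y.property⟩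
    let b : BinaryBicone X Y :=
      { pt := Z
        fst := ⟨biprod.fst⟩
        snd := ⟨biprod.snd⟩
        inl := ⟨biprod.inl⟩
        inr := ⟨biprod.inr⟩
        inl_fst := ObjectProperty.hom_ext _ biprod.inl_fst
        inl_snd := ObjectProperty.hom_ext _ biprod.inl_snd
        inr_fst := ObjectProperty.hom_ext _ biprod.inr_fst
        inr_snd := ObjectProperty.hom_ext _ biprod.inr_snd }
    exact hasBinaryBiproduct_of_total b (ObjectProperty.hom_ext _ biprod.total)

variable (T) in
-- The fibre of `f` is compact, and the long exact sequence of the triangle makes it a weak kernel.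
lemma weakKernels_cpt : AddPsh.WeakKernels (Cpt T) := fun {X Y} f => by
  obtain ⟨K, k, h, hK⟩ := distinguished_cocone_triangle₁ f.hom
  have hKc : isCompact T K := (isCompact T).ext_of_isTriangulatedClosed₁ _ hK X.property Y.property
  refine ⟨⟨K, hKc⟩, ⟨k⟩, fun c g => ⟨fun hg => ?_, ?_⟩⟩
  · obtain ⟨l, hl⟩ := Triangle.coyoneda_exact₂ _ hK g.hom (congr_arg (·.hom) hg)
    exact ⟨⟨l⟩, ObjectProperty.hom_ext _ hl.symm⟩
  · rintro ⟨l, rfl⟩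
    apply ObjectProperty.hom_ext
    have : k ≫ f.hom = 0 := comp_distTriang_mor_zero₁₂ _ hK
    change (l.hom ≫ k) ≫ f.hom = 0
    rw [Category.assoc, this, comp_zero]

end Triangulated

/-! ### The restricted Yoneda functor -/

section RestrictedYoneda

variable {T : Type u} [Category.{v} T] [Preadditive T]

open AddPsh

/-- A morphism from a compact object as a section of the restricted Yoneda presheaf. -/
def yoSec {X : T} {c : Cpt T} (f : c.obj ⟶ X) : sec ((yo T).obj X) c := f

/-- A section of the restricted Yoneda presheaf as a morphism. -/
def ofYoSec {X : T} {c : Cpt T} (s : sec ((yo T).obj X) c) : c.obj ⟶ X := s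

@[simp] lemma yoSec_ofYoSec {X : T} {c : Cpt T} (s : sec ((yo T).obj X) c) :
    yoSec (ofYoSec s) = s := rfl

lemma yoSec_injective {X : T} {c : Cpt T} {f g : c.obj ⟶ X} (h : yoSec f = yoSec g) : f = g := h

@[simp] lemma yoSec_zero {X : T} {c : Cpt T} : yoSec (0 : c.obj ⟶ X) = 0 := rfl

lemma yoSec_add {X : T} {c : Cpt T} (f g : c.obj ⟶ X) : yoSec (f + g) = yoSec f + yoSec g := rfl

@[simp] lemma res_yoSec {X : T} {c d : Cpt T} (g : d ⟶ c) (f : c.obj ⟶ X) :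
    res _ g (yoSec f) = yoSec (g.hom ≫ f) := rfl

@[simp] lemma ap_yo_map {X Y : T} (φ : X ⟶ Y) {c : Cpt T} (f : c.obj ⟶ X) :
    ap ((yo T).map φ) c (yoSec f) = yoSec (f ≫ φ) := rfl

/-- On compact objects, restricted Yoneda agrees with the Yoneda embedding. -/
def repIso (c : Cpt T) : rep c ≅ (yo T).obj c.obj where
  hom := ofSec (yoSec (𝟙 c.obj))
  inv := mkHom (F := (yo T).obj c.obj)
    (fun d => AddMonoidHom.mk' (fun f => repSec ⟨ofYoSec f⟩) fun _ _ => rfl) (fun _ _ => rfl)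
  hom_inv_id := rep_ext (by
    rw [ap_comp, ap_ofSec, res_id]
    rfl)
  inv_hom_id := ext fun d f => by
    rw [ap_comp]
    exact Category.comp_id (ofYoSec f)

/-- The morphism from a restricted Yoneda presheaf attached to a section. -/
def ofSecYo {F : Modc T} {c : Cpt T} (x : sec F c) : (yo T).obj c.obj ⟶ F :=
  (repIso c).inv ≫ ofSec x

@[simp] lemma ap_ofSecYo {F : Modc T} {c d : Cpt T} (x : sec F c) (f : d.obj ⟶ c.obj) :
    ap (ofSecYo x) d (yoSec f) = res F ⟨f⟩ x := rfl

lemma yo_hom_ext {F : Modc T} {c : Cpt T} {φ ψ : (yo T).obj c.obj ⟶ F}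
    (h : ap φ c (yoSec (𝟙 c.obj)) = ap ψ c (yoSec (𝟙 c.obj))) : φ = ψ := by
  rw [← cancel_epi (repIso c).hom]
  apply rep_ext
  simpa [repIso] using h

lemma nonempty_cokernel_iso {A B : Cpt T} (α : A ⟶ B) :
    Nonempty (cokernel (ofSec (repSec α)) ≅ cokernel ((yo T).map α.hom)) :=
  ⟨cokernel.mapIso _ _ (repIso A) (repIso B) (rep_ext (by simp [repIso]))⟩

lemma isFP_iff (F : Modc T) : isFP T F ↔ IsFinPres F := by
  constructor
  · rintro ⟨A, B, α, ⟨e⟩⟩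
    obtain ⟨e'⟩ := nonempty_cokernel_iso (A := A) (B := B) ⟨α⟩
    exact IsFinPres.of_iso ⟨_, _, _, _, isPres_cokernel _⟩ (e' ≪≫ e)
  · rintro ⟨A, B, α, x, h⟩
    obtain ⟨e⟩ := nonempty_cokernel_iso α
    have h2 := isPres_cokernel (ofSec (repSec α))
    have h3 : (show _ ⟶ _ from ap (ofSec (repSec α)) _ (repSec (𝟙 _))) = α := Category.id_comp α
    rw [h3] at h2
    obtain ⟨e'⟩ := h2.nonempty_iso h
    exact ⟨A, B, α.hom, ⟨e.symm ≪≫ e'⟩⟩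

lemma isFP_yo (c : Cpt T) [HasZeroObject (Cpt T)] : isFP T ((yo T).obj c.obj) :=
  (isFP_iff _).2 ((isFinPres_rep c).of_iso (repIso c))

end RestrictedYoneda

open AddPsh

/-! ### Restricted Yoneda preserves coproducts -/

section YonedaCoproducts

variable {T : Type u} [Category.{v} T] [Preadditive T] [HasCoproducts.{v} T]

lemma sum_sigmaProj_comp_ι {J : Type v} {Y : J → T} {X : T} {f : X ⟶ ∐ Y} {s : Finset J}
    (h : f ≫ sigmaIdem Y s = f) : f = ∑ j ∈ s, (f ≫ sigmaProj Y j) ≫ Sigma.ι Y j := by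
  conv_lhs => rw [← h, sigmaIdem, Preadditive.comp_sum]
  simp only [Category.assoc]

lemma comp_sigmaProj_eq_zero {J : Type v} {Y : J → T} {X : T} {f : X ⟶ ∐ Y} {s : Finset J}
    (h : f ≫ sigmaIdem Y s = f) {j : J} (hj : j ∉ s) : f ≫ sigmaProj Y j = 0 := by
  rw [← h, Category.assoc, sigmaIdem, Preadditive.sum_comp, Finset.sum_eq_zero, comp_zero]
  intro i hi
  rw [Category.assoc, ι_sigmaProj_of_ne Y (fun hij : i = j => hj (hij ▸ hi)), comp_zero]

lemma hom_sigma_eq_zero {J : Type v} {Y : J → T} {X : T} (hX : isCompact T X) {f : X ⟶ ∐ Y}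
    (h : ∀ j, f ≫ sigmaProj Y j = 0) : f = 0 := by
  obtain ⟨s, hs⟩ := (isCompact_iff X).1 hX J Y f
  rw [sum_sigmaProj_comp_ι hs]
  exact Finset.sum_eq_zero fun j _ => by rw [h, zero_comp]

omit [HasCoproducts.{v} T] in
lemma yoSec_sum {X : T} {c : Cpt T} {ι : Type*} (s : Finset ι) (f : ι → (c.obj ⟶ X)) :
    yoSec (∑ j ∈ s, f j) = ∑ j ∈ s, yoSec (f j) :=
  map_sum (AddMonoidHom.mk' (fun g : c.obj ⟶ X => yoSec g) fun _ _ => rfl) f s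

/-- A section over a compact object is a finite sum of sections coming from the summands. Together
with `exists_yo_sigma_desc` this is preservation of coproducts. -/
lemma yo_sigma_hom_ext {J : Type v} {Y : J → T} {F : Modc T} {φ ψ : (yo T).obj (∐ Y) ⟶ F}
    (h : ∀ j, (yo T).map (Sigma.ι Y j) ≫ φ = (yo T).map (Sigma.ι Y j) ≫ ψ) : φ = ψ := by
  refine ext fun c x => ?_
  obtain ⟨s, hs⟩ := (isCompact_iff c.obj).1 c.property J Y (ofYoSec x)
  have hx : x = ∑ j ∈ s, ap ((yo T).map (Sigma.ι Y j)) c (yoSec (ofYoSec x ≫ sigmaProj Y j)) := by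
    conv_lhs => rw [← yoSec_ofYoSec x, sum_sigmaProj_comp_ι hs, yoSec_sum]
    rfl
  rw [hx, map_sum, map_sum]
  refine Finset.sum_congr rfl fun j _ => ?_
  rw [← ap_comp, ← ap_comp, h]

lemma exists_yo_sigma_desc {J : Type v} {Y : J → T} {F : Modc T}
    (f : ∀ j, (yo T).obj (Y j) ⟶ F) :
    ∃ φ : (yo T).obj (∐ Y) ⟶ F, ∀ j, (yo T).map (Sigma.ι Y j) ≫ φ = f j := by
  have hfin (c : Cpt T) (x : c.obj ⟶ ∐ Y) :
      (Function.support fun j => ap (f j) c (yoSec (x ≫ sigmaProj Y j))).Finite := by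
    obtain ⟨s, hs⟩ := (isCompact_iff c.obj).1 c.property J Y x
    refine s.finite_toSet.subset fun j hj => ?_
    by_contra hjs
    apply hj
    change ap (f j) c (yoSec (x ≫ sigmaProj Y j)) = 0
    rw [comp_sigmaProj_eq_zero hs (fun h => hjs (Finset.mem_coe.2 h)), yoSec_zero, map_zero]
  refine ⟨mkHom (F := (yo T).obj (∐ Y)) (fun c => AddMonoidHom.mk'
    (fun x => ∑ᶠ j, ap (f j) c (yoSec (ofYoSec x ≫ sigmaProj Y j))) fun x y => ?_) ?_, fun j => ?_⟩
  · rw [← finsum_add_distrib (hfin c (ofYoSec x)) (hfin c (ofYoSec y))]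
    refine finsum_congr fun j => ?_
    rw [← map_add, ← yoSec_add]
    exact congr_arg (fun g => ap (f j) c (yoSec g)) (Preadditive.add_comp _ _ _ _ _ _)
  · intro c d g x
    refine Eq.trans ?_ ((res F g).map_finsum (hfin d (ofYoSec x))).symm
    refine finsum_congr fun j => ?_
    rw [← ap_res, res_yoSec]
    exact congr_arg (fun g => ap (f j) c (yoSec g)) (Category.assoc _ _ _)
  · refine ext fun c x => ?_
    change ∑ᶠ i, ap (f i) c (yoSec ((ofYoSec x ≫ Sigma.ι Y j) ≫ sigmaProj Y i)) = ap (f j) c x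
    rw [finsum_eq_single _ j]
    · rw [Category.assoc, ι_sigmaProj_self, Category.comp_id, yoSec_ofYoSec]
    · intro i hi
      rw [Category.assoc, ι_sigmaProj_of_ne Y hi.symm, comp_zero, yoSec_zero, map_zero]

end YonedaCoproducts

/-! ### Brown representability for injective presheaves -/

section Brown

variable {T : Type u} [Category.{v} T] [Preadditive T] [HasZeroObject T]
  [HasShift T ℤ] [∀ n : ℤ, (shiftFunctor T n).Additive] [Pretriangulated T]

lemma yo_exact {t : Triangle T} (ht : t ∈ distTriang T) :
    (ShortComplex.mk ((yo T).map t.mor₁) ((yo T).map t.mor₂) (by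
      rw [← Functor.map_comp, comp_distTriang_mor_zero₁₂ _ ht]
      exact ext fun c x => comp_zero (C := T))).Exact :=
  exact_of_sec _ fun c x hx => by
    obtain ⟨y, hy⟩ := t.coyoneda_exact₂ ht (ofYoSec x) (yoSec_injective hx)
    exact ⟨yoSec y, congr_arg yoSec hy.symm⟩

lemma exists_yo_extension {X Y Z : T} {a : X ⟶ Y} {b : Y ⟶ Z} {d : Z ⟶ X⟦(1 : ℤ)⟧}
    (ht : Triangle.mk a b d ∈ distTriang T) {I : Modc T} [Injective I]
    (f : (yo T).obj Y ⟶ I) (hf : (yo T).map a ≫ f = 0) :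
    ∃ g : (yo T).obj Z ⟶ I, (yo T).map b ≫ g = f :=
  ⟨(yo_exact ht).descToInjective f hf, (yo_exact ht).comp_descToInjective f hf⟩

lemma exists_yo_lift {X Y Z : T} {a : X ⟶ Y} {b : Y ⟶ Z} {d : Z ⟶ X⟦(1 : ℤ)⟧}
    (ht : Triangle.mk a b d ∈ distTriang T) {c : T} (f : c ⟶ Z) (hf : f ≫ d = 0) :
    ∃ g : c ⟶ Y, f = g ≫ b := Triangle.coyoneda_exact₃ _ ht f hf

omit [HasZeroObject T] [HasShift T ℤ] [∀ n : ℤ, (shiftFunctor T n).Additive] [Pretriangulated T] in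
instance : (yo T).Additive where
  map_add {X Y f g} := ext fun c x => Preadditive.comp_add c.obj X Y (ofYoSec x) f g

variable [HasCoproducts.{v} T]

/-- The telescope endomorphism of the coproduct of a sequence. -/
def telescope {X : ℕ → T} (w : ∀ n, X n ⟶ X (n + 1)) :
    (∐ fun n : ULift.{v} ℕ => X n.down) ⟶ ∐ fun n : ULift.{v} ℕ => X n.down :=
  Sigma.desc fun n => w n.down ≫ Sigma.ι (fun n : ULift.{v} ℕ => X n.down) ⟨n.down + 1⟩

omit [HasZeroObject T] [HasShift T ℤ] [∀ n : ℤ, (shiftFunctor T n).Additive] [Pretriangulated T] in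
-- The hypothesis says that `g` is fixed by the telescope. Its component at `0` vanishes because the
-- telescope never reaches that summand, and its component at `n + 1` is the one at `n` followed by
-- `w n`.
lemma eq_zero_of_comp_telescope {X : ℕ → T} (w : ∀ n, X n ⟶ X (n + 1)) {c : T}
    (hc : isCompact T c) (g : c ⟶ ∐ fun n : ULift.{v} ℕ => X n.down)
    (hg : g ≫ (𝟙 _ - telescope w) = 0) : g = 0 := by
  have hg' : g = g ≫ telescope w := by
    rwa [Preadditive.comp_sub, Category.comp_id, sub_eq_zero] at hg
  have h0 : telescope w ≫ sigmaProj _ ⟨0⟩ = 0 := by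
    refine Sigma.hom_ext _ _ fun n => ?_
    rw [telescope, Sigma.ι_desc_assoc, Category.assoc, ι_sigmaProj_of_ne _ (by simp), comp_zero,
      comp_zero]
  have h1 (n : ℕ) : telescope w ≫ sigmaProj _ ⟨n + 1⟩ = sigmaProj _ ⟨n⟩ ≫ w n := by
    refine Sigma.hom_ext _ _ fun m => ?_
    rw [telescope, Sigma.ι_desc_assoc, Category.assoc]
    by_cases h : m = ⟨n⟩
    · subst h
      rw [ι_sigmaProj_self (fun n : ULift.{v} ℕ => X n.down) ⟨n + 1⟩, ← Category.assoc,
        ι_sigmaProj_self (fun n : ULift.{v} ℕ => X n.down) ⟨n⟩]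
      exact (Category.comp_id _).trans (Category.id_comp _).symm
    · rw [ι_sigmaProj_of_ne _ (by
        intro h'
        apply h
        ext
        simpa using h'), ← Category.assoc, ι_sigmaProj_of_ne _ h, comp_zero, zero_comp]
  refine hom_sigma_eq_zero hc fun ⟨n⟩ => ?_
  induction n with
  | zero => rw [hg', Category.assoc, h0, comp_zero]
  | succ n ih => rw [hg', Category.assoc, h1, ← Category.assoc, ih, zero_comp]

omit [HasZeroObject T] [Pretriangulated T] [HasCoproducts.{v} T] in
lemma eq_zero_of_comp_shift {Z W : T} (δ : Z ⟶ W)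
    (hδ : ∀ c : T, isCompact T c → ∀ g : c ⟶ Z, g ≫ δ = 0 → g = 0) {c : T} (hc : isCompact T c)
    (g : c ⟶ Z⟦(1 : ℤ)⟧) (hg : g ≫ δ⟦(1 : ℤ)⟧' = 0) : g = 0 := by
  let adj : shiftFunctor T (-1 : ℤ) ⊣ shiftFunctor T (1 : ℤ) :=
    (shiftEquiv' T (-1) 1 (by simp)).toAdjunction
  have h : (adj.homEquiv c Z).symm g = 0 := by
    refine hδ _ (isCompact_shift hc (-1)) _ ?_
    rw [← adj.homEquiv_naturality_right_symm, hg]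
    exact (adj.homAddEquiv c W).symm.map_zero
  exact (adj.homAddEquiv c Z).symm.injective (h.trans (map_zero _).symm)

section
variable [EssentiallySmall.{v} (Cpt T)]

omit [HasZeroObject T] [HasShift T ℤ] [∀ n : ℤ, (shiftFunctor T n).Additive] [Pretriangulated T]
  [HasCoproducts.{v} T] in
lemma exists_small_factor {X : T} {c : Cpt T} (g : c.obj ⟶ X) :
    ∃ (s : SmallModel.{v} (Cpt T)) (e : c ≅ smallObj s), g = e.hom.hom ≫ e.inv.hom ≫ g := by
  let e := (equivSmallModel.{v} (Cpt T)).unitIso.app c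
  refine ⟨_, e, ?_⟩
  have : e.hom.hom ≫ e.inv.hom = 𝟙 c.obj := congr_arg (·.hom) e.hom_inv_id
  rw [← Category.assoc, this, Category.id_comp]

/-- `X'` is the cone of the sum of all maps from small-model compacts killed by `f`. As `I` is
injective and restricted Yoneda is exact, `f` extends over the cone. -/
lemma exists_kill_step {I : Modc T} [Injective I] {X : T} (f : (yo T).obj X ⟶ I) :
    ∃ (X' : T) (w : X ⟶ X') (f' : (yo T).obj X' ⟶ I), (yo T).map w ≫ f' = f ∧
      ∀ (c : Cpt T) (g : c.obj ⟶ X), ap f c (yoSec g) = 0 → g ≫ w = 0 := by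
  let J := Σ s : SmallModel.{v} (Cpt T), {g : (smallObj s).obj ⟶ X // ap f _ (yoSec g) = 0}
  let Y (j : J) : T := (smallObj j.1).obj
  let κ : ∐ Y ⟶ X := Sigma.desc fun j => j.2.1
  obtain ⟨X', w, h, ht⟩ := distinguished_cocone_triangle κ
  have hκι (j : J) : Sigma.ι Y j ≫ κ = j.2.1 := Sigma.ι_desc _ _
  obtain ⟨f', hf'⟩ := exists_yo_extension ht f (yo_sigma_hom_ext fun j => by
    rw [← Category.assoc, ← Functor.map_comp, hκι, comp_zero]
    refine yo_hom_ext (c := smallObj j.1) ?_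
    rw [ap_comp, ap_yo_map, Category.id_comp]
    exact j.2.2)
  refine ⟨X', w, f', hf', fun c g hg => ?_⟩
  obtain ⟨s, e, he⟩ := exists_small_factor g
  let j : J := ⟨s, e.inv.hom ≫ g, by rw [← res_yoSec, ap_res, hg, map_zero]⟩
  have hj : e.inv.hom ≫ g = Sigma.ι Y j ≫ κ := (hκι j).symm
  have hκ : κ ≫ w = 0 := comp_distTriang_mor_zero₁₂ _ ht
  rw [he, hj, Category.assoc, Category.assoc, hκ, comp_zero, comp_zero]

/-- Brown representability for injective objects: every injective presheaf on the compact objects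
is the restricted Yoneda presheaf of an object. -/
theorem exists_yo_iso_of_injective (I : Modc T) [Injective I] :
    ∃ E : T, Nonempty ((yo T).obj E ≅ I) := by
  let A := Σ X : T, ((yo T).obj X ⟶ I)
  choose next w f' hf' hkill using fun a : A => exists_kill_step a.2
  -- The initial stage has one summand for each section of `I` over the small model, which will make
  -- `ψ` surjective.
  let J₀ := Σ s : SmallModel.{v} (Cpt T), sec I (smallObj s)
  let Y₀ (j : J₀) : T := (smallObj j.1).obj
  obtain ⟨f₀, hf₀⟩ := exists_yo_sigma_desc (Y := Y₀) fun j => ofSecYo j.2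
  let a (n : ℕ) : A := Nat.rec ⟨∐ Y₀, f₀⟩ (fun _ a => ⟨next a, f' a⟩) n
  let X (n : ℕ) : T := (a n).1
  let v (n : ℕ) : X n ⟶ X (n + 1) := w (a n)
  have hv (n : ℕ) : (yo T).map (v n) ≫ (a (n + 1)).2 = (a n).2 := hf' (a n)
  let Y (n : ULift.{v} ℕ) : T := X n.down
  -- The cone `E` of `δ` is the homotopy colimit of the stages.
  let δ := 𝟙 (∐ Y) - telescope v
  obtain ⟨φ, hφ⟩ := exists_yo_sigma_desc (Y := Y) fun n => (a n.down).2
  obtain ⟨E, p, d, ht⟩ := distinguished_cocone_triangle δ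
  have hδφ : (yo T).map δ ≫ φ = 0 := yo_sigma_hom_ext fun n => by
    have h1 : Sigma.ι Y n ≫ δ = Sigma.ι Y n - v n.down ≫ Sigma.ι Y ⟨n.down + 1⟩ := by
      rw [Preadditive.comp_sub, Category.comp_id, telescope]
      congr 1
      exact Sigma.ι_desc _ _
    rw [← Category.assoc, ← Functor.map_comp, h1, Functor.map_sub, Functor.map_comp,
      Preadditive.sub_comp, Category.assoc, hφ, hφ, hv, sub_self, comp_zero]
  obtain ⟨ψ, hψ⟩ := exists_yo_extension ht φ hδφ
  have hp (n : ℕ) : Sigma.ι Y ⟨n⟩ ≫ p = v n ≫ Sigma.ι Y ⟨n + 1⟩ ≫ p := by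
    have h1 : δ ≫ p = 0 := comp_distTriang_mor_zero₁₂ _ ht
    have h2 : p = telescope v ≫ p := by
      rwa [Preadditive.sub_comp, Category.id_comp, sub_eq_zero] at h1
    conv_lhs => rw [h2, telescope]
    rw [Sigma.ι_desc_assoc, Category.assoc]
  have hψn (n : ℕ) {c : Cpt T} (k : c.obj ⟶ X n) :
      ap ψ c (yoSec (k ≫ Sigma.ι Y ⟨n⟩ ≫ p)) = ap (a n).2 c (yoSec k) := by
    rw [← hφ ⟨n⟩, ← hψ, ap_comp, ap_comp, ap_yo_map, ap_yo_map, Category.assoc]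
  have hmove {n m : ℕ} (h : n ≤ m) {c : Cpt T} (k : c.obj ⟶ X n) :
      ∃ k' : c.obj ⟶ X m, k ≫ Sigma.ι Y ⟨n⟩ ≫ p = k' ≫ Sigma.ι Y ⟨m⟩ ≫ p := by
    induction m, h using Nat.le_induction with
    | base => exact ⟨k, rfl⟩
    | succ m _ ih =>
      obtain ⟨k', hk'⟩ := ih
      exact ⟨k' ≫ v m, by rw [hk', hp, Category.assoc]⟩
  -- A compact object meets finitely many summands, and all of them can be moved to a common later
  -- stage.
  have hstage {c : Cpt T} (k : c.obj ⟶ ∐ Y) :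
      ∃ (n : ℕ) (k' : c.obj ⟶ X n), k ≫ p = k' ≫ Sigma.ι Y ⟨n⟩ ≫ p := by
    classical
    obtain ⟨s, hs⟩ := (isCompact_iff c.obj).1 c.property _ Y k
    rw [sum_sigmaProj_comp_ι hs]
    generalize hg : (fun j => k ≫ sigmaProj Y j) = g
    have hg' (j) : k ≫ sigmaProj Y j = g j := congr_fun hg j
    simp only [hg', Preadditive.sum_comp]
    clear hs
    induction s using Finset.induction_on with
    | empty => exact ⟨0, 0, by simp⟩
    | insert j s hj ih =>
      obtain ⟨n, k', hk'⟩ := ih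
      obtain ⟨k₁, hk₁⟩ := hmove (le_max_left n j.down) k'
      obtain ⟨k₂, hk₂⟩ := hmove (le_max_right n j.down) (g j)
      refine ⟨_, k₁ + k₂, ?_⟩
      rw [Finset.sum_insert hj, hk', hk₁, Preadditive.add_comp, add_comm, ← hk₂, Category.assoc]
  refine ⟨E, ⟨@asIso _ _ _ _ ψ (isIso_of_bijective ψ fun c => ⟨?_, ?_⟩)⟩⟩
  · rw [injective_iff_map_eq_zero]
    intro x hx
    -- By the telescope lemma the shift of `δ` is injective on maps from compacts, so `x` lifts to
    -- `∐ Y` and then to a stage `n`. There the map to `I` kills it, so it dies at stage `n + 1`.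
    have hd : ofYoSec x ≫ d = 0 := by
      refine eq_zero_of_comp_shift δ (fun c hc => eq_zero_of_comp_telescope v hc) c.property _ ?_
      have h0 : d ≫ δ⟦(1 : ℤ)⟧' = 0 := comp_distTriang_mor_zero₃₁ _ ht
      rw [Category.assoc, h0, comp_zero]
    obtain ⟨k, hk⟩ := exists_yo_lift ht (ofYoSec x) hd
    obtain ⟨n, k', hk'⟩ := hstage k
    have hx' : ofYoSec x = k' ≫ Sigma.ι Y ⟨n⟩ ≫ p := hk.trans hk'
    have h0 : k' ≫ v n = 0 := hkill (a n) c k' (by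
      rw [← hψn, ← hx']
      exact hx)
    rw [← yoSec_ofYoSec x, hx', hp, ← Category.assoc, h0, zero_comp, yoSec_zero]
  · intro x
    let e := (equivSmallModel.{v} (Cpt T)).unitIso.app c
    let j : J₀ := ⟨_, res I e.inv x⟩
    refine ⟨yoSec ((e.hom.hom ≫ Sigma.ι Y₀ j) ≫ Sigma.ι Y ⟨0⟩ ≫ p), ?_⟩
    refine (hψn 0 (e.hom.hom ≫ Sigma.ι Y₀ j)).trans ?_
    change ap f₀ c (yoSec (e.hom.hom ≫ Sigma.ι Y₀ j)) = x
    rw [← ap_yo_map, ← ap_comp, hf₀]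
    refine Eq.trans (ap_ofSecYo (c := smallObj j.1) j.2 e.hom.hom) ?_
    change res I e.hom (res I e.inv x) = x
    rw [← res_comp]
    exact (congr_arg (resHom I c x) e.hom_inv_id).trans (res_id I x)

end
end Brown

/-! ### Rigid objects have duals -/

section Duals

variable {T : Type u} [Category.{v} T] [MonoidalCategory T] [MonoidalClosed T]

/-- The displayed map is postcomposition with the rigidity isomorphism followed by uncurrying. -/
lemma bijective_of_isRigid {X : T} (hX : isRigid T X) (Z Y : T) :
    Function.Bijective fun g : Z ⟶ (ihom X).obj (𝟙_ T) ⊗ Y =>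
      X ◁ g ≫ (α_ _ _ _).inv ≫ (ihom.ev X).app (𝟙_ T) ▷ Y ≫ (λ_ Y).hom := by
  have := hX Y
  have h : (fun g : Z ⟶ (ihom X).obj (𝟙_ T) ⊗ Y =>
      X ◁ g ≫ (α_ _ _ _).inv ≫ (ihom.ev X).app (𝟙_ T) ▷ Y ≫ (λ_ Y).hom) =
      fun g => MonoidalClosed.uncurry (g ≫ rigidityMap T X Y) := by
    funext g
    rw [MonoidalClosed.uncurry_natural_left, rigidityMap, MonoidalClosed.uncurry_curry]
  rw [h]
  refine (((ihom.adjunction X).homEquiv Z Y).symm.bijective).comp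
    ⟨fun g g' hg => (cancel_mono (rigidityMap T X Y)).1 hg,
      fun g => ⟨g ≫ inv (rigidityMap T X Y), by simp⟩⟩

/-- A rigid object has `[X, 𝟙]` as a dual. -/
abbrev exactPairingOfIsRigid {X : T} (hX : isRigid T X) :
    ExactPairing ((ihom X).obj (𝟙_ T)) X :=
  let ε : X ⊗ (ihom X).obj (𝟙_ T) ⟶ 𝟙_ T := (ihom.ev X).app (𝟙_ T)
  -- The coevaluation is the preimage of the right unitor, so one triangle identity holds by choice.
  -- The other is checked after applying the injection of `bijective_of_isRigid`.
  let η := ((bijective_of_isRigid hX (𝟙_ T) X).2 (ρ_ X).hom).choose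
  have hη : X ◁ η ≫ (α_ _ _ _).inv ≫ ε ▷ X ≫ (λ_ X).hom = (ρ_ X).hom :=
    ((bijective_of_isRigid hX (𝟙_ T) X).2 (ρ_ X).hom).choose_spec
  have h₁ : X ◁ η ≫ (α_ _ _ _).inv ≫ ε ▷ X = (ρ_ X).hom ≫ (λ_ X).inv := by
    rw [← hη]
    simp
  { coevaluation' := η
    evaluation' := ε
    coevaluation_evaluation' := h₁
    evaluation_coevaluation' := by
      apply (bijective_of_isRigid hX _ _).1
      change X ◁ (η ▷ _ ≫ (α_ _ _ _).hom ≫ _ ◁ ε) ≫ (α_ _ _ _).inv ≫ ε ▷ _ ≫ (λ_ _).hom =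
        X ◁ ((λ_ _).hom ≫ (ρ_ _).inv) ≫ (α_ _ _ _).inv ≫ ε ▷ _ ≫ (λ_ _).hom
      have h₂ : X ◁ η ⊗≫ ε ▷ X = ⊗𝟙.hom := by
        convert! h₁ using 1 <;> simp [monoidalComp]
      calc
        _ = 𝟙 _ ⊗≫ X ◁ η ▷ (ihom X).obj (𝟙_ T) ⊗≫ ((X ⊗ (ihom X).obj (𝟙_ T)) ◁ ε ≫ ε ▷ 𝟙_ T) ⊗≫ 𝟙 _ := by
          monoidal
        _ = 𝟙 _ ⊗≫ (X ◁ η ⊗≫ ε ▷ X) ▷ (ihom X).obj (𝟙_ T) ⊗≫ ε := by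
          rw [whisker_exchange]; monoidal
        _ = _ := by
          rw [h₂]; monoidal }

end Duals

/-! ### Precomposition with adjoint functors -/

namespace AddPsh

variable {C : Type u} [Category.{v} C] [Preadditive C]

lemma res_comp_congr {F : AddPsh C} {c d d' e : C} {f : c ⟶ d} {g : d ⟶ e} {f' : c ⟶ d'}
    {g' : d' ⟶ e} (x : F.sec e) (h : f ≫ g = f' ≫ g') :
    F.res f (F.res g x) = F.res f' (F.res g' x) := by
  rw [← res_comp, ← res_comp, h]

lemma res_comp_eq_self {F : AddPsh C} {c d : C} {f : c ⟶ d} {g : d ⟶ c} (x : F.sec c)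
    (h : f ≫ g = 𝟙 c) : F.res f (F.res g x) = x := by
  rw [← res_comp, h, res_id]

/-- Precomposition of additive presheaves with an additive endofunctor. -/
def pre (L : C ⥤ C) [L.Additive] : AddPsh C ⥤ AddPsh C where
  obj F := mk' (fun c => sec F (L.obj c)) (fun f => F.res (L.map f)) (fun c x => by simp)
    (fun f g x => by rw [L.map_comp, res_comp]) (fun f g x => by rw [L.map_add, res_add])
  map φ := mkHom (fun c => ap φ (L.obj c)) fun f x => ap_res φ (L.map f) x

section
variable {L R : C ⥤ C} [L.Additive] [R.Additive]

/-- A section of `F` over `L c`, as a section over `c` of the precomposition. -/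
def toPre (L : C ⥤ C) [L.Additive] {F : AddPsh C} {c : C} (x : F.sec (L.obj c)) :
    sec ((pre L).obj F) c := x

/-- Precomposition with adjoint functors gives adjoint functors. -/
def preAdj (adj : L ⊣ R) : pre L ⊣ pre R where
  unit :=
    { app F := mkHom (G := (pre R).obj ((pre L).obj F)) (fun c => F.res (adj.counit.app c))
        fun f x => res_comp_congr x (adj.counit_naturality f).symm
      naturality _ _ φ := ext fun c x => (ap_res φ (adj.counit.app c) x).symm }
  counit :=
    { app F := mkHom (F := (pre L).obj ((pre R).obj F)) (fun c => F.res (adj.unit.app c))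
        fun {c d} f x => res_comp_congr (F := F) (c := c) (e := R.obj (L.obj d)) x
          (adj.unit_naturality f)
      naturality _ _ φ := ext fun c x => (ap_res φ (adj.unit.app c) x).symm }
  left_triangle_components F := ext fun c x =>
    res_comp_eq_self (F := F) (c := L.obj c) x (adj.left_triangle_components c)
  right_triangle_components F := ext fun c x =>
    res_comp_eq_self (F := F) (c := R.obj c) x (adj.right_triangle_components c)

instance (F G : AddPsh C) (φ : F ⟶ G) [Mono φ] : Mono ((pre L).map φ) :=
  mono_of_injective _ fun c => injective_of_mono φ (L.obj c)

lemma injective_pre (adj : L ⊣ R) (I : AddPsh C) [Injective I] :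
    Injective ((pre R).obj I) := by
  have : (pre L).PreservesMonomorphisms := ⟨fun φ _ => inferInstance⟩
  exact Injective.injective_of_adjoint (preAdj adj) I

/-- Maps `L e ⟶ b` are maps `e ⟶ R b`, so precomposition with `L` turns a presentation by `α` into
one by `R α`. -/
lemma IsPres.pre {F : AddPsh C} (adj : L ⊣ R) {a b : C} {α : a ⟶ b} {x : F.sec b}
    (h : IsPres x α) : IsPres (toPre L (F.res (adj.counit.app b) x)) (R.map α) := by
  have key {e : C} (f : L.obj e ⟶ b) : res _ (adj.homEquiv _ _ f)
      (toPre L (F.res (adj.counit.app b) x)) = toPre L (F.res f x) := by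
    refine (congr_arg (toPre L) (F.res_comp _ _ x).symm).trans ?_
    exact congr_arg (fun f => toPre L (F.res f x))
      ((adj.homEquiv_counit _ _ _).symm.trans ((adj.homEquiv e b).symm_apply_apply f))
  constructor
  · intro c s
    obtain ⟨f, hf⟩ := h.gen (L.obj c) s
    exact ⟨adj.homEquiv _ _ f, (key f).trans (congr_arg (toPre L) hf)⟩
  · intro c f
    obtain ⟨f, rfl⟩ := (adj.homEquiv _ _).surjective f
    rw [key]
    refine (h.rel f).trans ⟨?_, ?_⟩
    · rintro ⟨g, rfl⟩
      exact ⟨adj.homEquiv _ _ g, (adj.homEquiv_naturality_right g α).symm⟩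
    · rintro ⟨g, hg⟩
      obtain ⟨g, rfl⟩ := (adj.homEquiv _ _).surjective g
      rw [← adj.homEquiv_naturality_right] at hg
      exact ⟨g, (adj.homEquiv _ _).injective hg⟩

lemma IsFinPres.pre {F : AddPsh C} (adj : L ⊣ R) (h : IsFinPres F) :
    IsFinPres ((pre L).obj F) := by
  obtain ⟨a, b, α, x, h⟩ := h
  exact ⟨_, _, _, _, h.pre adj⟩

end

end AddPsh

open AddPsh

/-! ### Twists and Day convolution with representables -/

section

variable {T : Type u} [Category.{v} T] [Preadditive T] [HasZeroObject T] [HasShift T ℤ]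
  [∀ n : ℤ, (shiftFunctor T n).Additive] [Pretriangulated T] [IsTriangulated T]
  [MonoidalCategory T] [SymmetricCategory T] [MonoidalClosed T] [IsRigidlyCompactlyGenerated T]

instance (X : T) : (tensorLeft X).Additive := by
  obtain ⟨_, _⟩ := IsRigidlyCompactlyGenerated.exact_tensorLeft X
  infer_instance

instance (c : Cpt T) : (tensorLeft c).Additive where
  map_add {_ _ f g} :=
    ObjectProperty.hom_ext _ ((tensorLeft c.obj).map_add (f := f.hom) (g := g.hom))

instance (c : Cpt T) : (tensorRight c).Additive where
  map_add {_ _ f g} := by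
    obtain ⟨_, _⟩ := IsRigidlyCompactlyGenerated.exact_tensorRight c.obj
    exact ObjectProperty.hom_ext _ ((tensorRight c.obj).map_add (f := f.hom) (g := g.hom))

instance : HasZeroObject (Cpt T) := by
  have : HasCoproducts.{v} T := IsRigidlyCompactlyGenerated.hasCoproducts
  infer_instance

/-- The functor `d ⊗ -` is left adjoint to `c ⊗ -`, which preserves coproducts; so it preserves
compactness, and `d` is `d ⊗ 𝟙`. -/
lemma isCompact_of_exactPairing (c d : T) [ExactPairing d c] : isCompact T d := by
  have : HasCoproducts.{v} T := IsRigidlyCompactlyGenerated.hasCoproducts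
  have (J : Type v) : PreservesColimitsOfShape (Discrete J) (tensorLeft c) := inferInstance
  have : ExactPairing c d := BraidedCategory.exactPairing_swap d c
  have := isCompact_of_adjunction (tensorLeftAdjunction c d)
    (ObjectProperty.prop_unit (isCompact T))
  exact (isCompact T).prop_of_iso (ρ_ d) this

variable (T) in
lemma exists_exactPairing (c : Cpt T) :
    ∃ d : Cpt T, Nonempty (ExactPairing c d) ∧ Nonempty (ExactPairing d c) := by
  have h := exactPairingOfIsRigid
    ((IsRigidlyCompactlyGenerated.compact_iff_rigid _).1 c.property)
  let d : Cpt T := ⟨(ihom c.obj).obj (𝟙_ T), isCompact_of_exactPairing c.obj _⟩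
  have : ExactPairing d c :=
    { coevaluation' := ⟨η_ d.obj c.obj⟩
      evaluation' := ⟨ε_ d.obj c.obj⟩
      coevaluation_evaluation' := ObjectProperty.hom_ext _ h.coevaluation_evaluation'
      evaluation_coevaluation' := ObjectProperty.hom_ext _ h.evaluation_coevaluation' }
  exact ⟨d, ⟨BraidedCategory.exactPairing_swap d c⟩, ⟨this⟩⟩

/-- The twist of a presheaf by a compact object: its precomposition with `c ⊗ -`. -/
abbrev tw (c : Cpt T) : Modc T ⥤ Modc T := pre (tensorLeft c)

/-- A section over `c ⊗ b`, as a section over `b` of the twist by `c`. -/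
def toTw {F : Modc T} {c b : Cpt T} (x : sec F (c ⊗ b)) : sec ((tw c).obj F) b := x

@[simp] lemma toTw_add {F : Modc T} {c b : Cpt T} (x y : sec F (c ⊗ b)) :
    toTw (x + y) = toTw x + toTw y := rfl

lemma res_toTw {F : Modc T} {c a b : Cpt T} (f : a ⟶ b) (x : sec F (c ⊗ b)) :
    res _ f (toTw x) = toTw (res F (c ◁ f) x) := rfl

/-- The adjunction between twists by dual objects. -/
def twAdj (c d : Cpt T) [ExactPairing d c] : tw c ⊣ tw d := preAdj (tensorLeftAdjunction d c)

instance injective_tw (c : Cpt T) (I : Modc T) [Injective I] : Injective ((tw c).obj I) := by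
  obtain ⟨d, ⟨_⟩, -⟩ := exists_exactPairing T c
  exact injective_pre (tensorLeftAdjunction c d) I

lemma isFinPres_tw (c : Cpt T) {F : Modc T} (hF : IsFinPres F) : IsFinPres ((tw c).obj F) := by
  obtain ⟨d, -, ⟨_⟩⟩ := exists_exactPairing T c
  exact hF.pre (tensorLeftAdjunction d c)

/-- The counit `c ⊗ d ⊗ b ⟶ b` of a duality. -/
def dualCounit (c d b : Cpt T) [ExactPairing d c] : c ⊗ d ⊗ b ⟶ b :=
  (tensorLeftAdjunction d c).counit.app b

/-- The unit `b ⟶ d ⊗ c ⊗ b` of a duality. -/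
def dualUnit (c d b : Cpt T) [ExactPairing d c] : b ⟶ d ⊗ c ⊗ b :=
  (tensorLeftAdjunction d c).unit.app b

section
variable {c d a b : Cpt T} [ExactPairing d c]

lemma dualCounit_naturality (f : a ⟶ b) :
    c ◁ d ◁ f ≫ dualCounit c d b = dualCounit c d a ≫ f :=
  (tensorLeftAdjunction d c).counit_naturality f

lemma dualUnit_naturality (f : a ⟶ b) : dualUnit c d a ≫ d ◁ c ◁ f = f ≫ dualUnit c d b :=
  (tensorLeftAdjunction d c).unit_naturality f

lemma whisker_dualUnit_comp : c ◁ dualUnit c d b ≫ dualCounit c d (c ⊗ b) = 𝟙 _ :=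
  (tensorLeftAdjunction d c).left_triangle_components b

lemma dualUnit_comp_whisker : dualUnit c d (d ⊗ b) ≫ d ◁ dualCounit c d b = 𝟙 _ :=
  (tensorLeftAdjunction d c).right_triangle_components b

end

section
variable {F G H K : Modc T} {a a' b b' : Cpt T}

lemma Pairing.map_res_left (β : Pairing F G H) (f : a ⟶ a') (x : sec F a') (y : sec G b) :
    β.map a b (res F f x) y = res H (f ▷ b) (β.map a' b x y) := by
  have := β.naturality f (𝟙 b) x y
  rw [tensorHom_id] at this
  refine Eq.trans ?_ this
  exact congr_arg (β.map a b (res F f x)) (res_id G y).symm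

lemma Pairing.map_res_right (β : Pairing F G H) (f : b ⟶ b') (x : sec F a) (y : sec G b') :
    β.map a b x (res G f y) = res H (a ◁ f) (β.map a b' x y) := by
  have := β.naturality (𝟙 a) f x y
  rw [id_tensorHom] at this
  refine Eq.trans ?_ this
  exact congr_arg (fun x => β.map a b x (res G f y)) (res_id F x).symm

/-- A pairing from a biadditive family natural in each variable. -/
def Pairing.mk' (m : ∀ a b : Cpt T, sec F a → sec G b → sec H (a ⊗ b))
    (add_left : ∀ a b x x' y, m a b (x + x') y = m a b x y + m a b x' y)
    (add_right : ∀ a b x y y', m a b x (y + y') = m a b x y + m a b x y')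
    (left : ∀ {a a'} b (f : a ⟶ a') x y, m a b (res F f x) y = res H (f ▷ b) (m a' b x y))
    (right : ∀ a {b b'} (f : b ⟶ b') x y, m a b x (res G f y) = res H (a ◁ f) (m a b' x y)) :
    Pairing F G H where
  map a b := AddMonoidHom.mk' (fun x => AddMonoidHom.mk' (m a b x) (add_right a b x))
    fun x x' => by ext y; exact add_left a b x x' y
  naturality {a a' b b'} f g x y := by
    change m a b (res F f x) (res G g y) = res H (f ⊗ₘ g) (m a' b' x y)
    rw [left, right, ← res_comp, MonoidalCategory.tensorHom_def]

/-- The composition of a pairing with a morphism. -/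
def Pairing.comp (β : Pairing F G H) (φ : H ⟶ K) : Pairing F G K :=
  Pairing.mk' (fun a b x y => ap φ (a ⊗ b) (β.map a b x y)) (fun a b x x' y => by simp)
    (fun a b x y y' => by simp) (fun b f x y => by rw [β.map_res_left, ap_res])
    (fun a _ _ f x y => by rw [β.map_res_right, ap_res])

/-- A pairing is universal if every pairing factors uniquely through it. -/
def Pairing.IsUniversal (β : Pairing F G H) : Prop :=
  ∀ (K : Modc T) (γ : Pairing F G K), ∃! φ : H ⟶ K, ∀ a b x y,
    ap φ (a ⊗ b) (β.map a b x y) = γ.map a b x y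

lemma isDayTensor_iff : IsDayTensor F G H ↔ ∃ β : Pairing F G H, β.IsUniversal := Iff.rfl

lemma Pairing.IsUniversal.hom_ext {β : Pairing F G H} (hβ : β.IsUniversal) {φ ψ : H ⟶ K}
    (h : ∀ a b x y, ap φ (a ⊗ b) (β.map a b x y) = ap ψ (a ⊗ b) (β.map a b x y)) : φ = ψ :=
  (hβ K (β.comp ψ)).unique h fun _ _ _ _ => rfl

end

/-- A section of the presheaf of a compact object, as a morphism of compact objects. -/
def cptHom {a d : Cpt T} (f : sec ((yo T).obj d.obj) a) : a ⟶ d := ⟨ofYoSec f⟩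

/-- A morphism of compact objects, as a section of the presheaf of its target. -/
def cptSec {a d : Cpt T} (f : a ⟶ d) : sec ((yo T).obj d.obj) a := yoSec f.hom

@[simp] lemma cptHom_cptSec {a d : Cpt T} (f : a ⟶ d) : cptHom (cptSec f) = f := rfl

lemma cptHom_add {a d : Cpt T} (f g : sec ((yo T).obj d.obj) a) :
    cptHom (f + g) = cptHom f + cptHom g := rfl

lemma cptHom_res {a b d : Cpt T} (g : a ⟶ b) (f : sec ((yo T).obj d.obj) b) :
    cptHom (res _ g f) = g ≫ cptHom f := rfl

lemma res_cptSec_id {a d : Cpt T} (f : sec ((yo T).obj d.obj) a) :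
    res _ (cptHom f) (cptSec (𝟙 d)) = f := Category.comp_id (ofYoSec f)

/-- The pairing exhibiting a twist as a Day convolution product with a representable. -/
def twPairing (c d : Cpt T) [ExactPairing d c] (F : Modc T) :
    Pairing ((yo T).obj d.obj) F ((tw c).obj F) :=
  Pairing.mk' (F := (yo T).obj d.obj)
    (fun a b f x => toTw (res F (c ◁ (cptHom f ▷ b) ≫ dualCounit c d b) x))
    (fun a b f f' x => by
      have h : c ◁ (cptHom (f + f') ▷ b) = c ◁ (cptHom f ▷ b) + c ◁ (cptHom f' ▷ b) := by
        rw [cptHom_add]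
        exact ((tensorRight b ⋙ tensorLeft c).map_add (f := cptHom f) (g := cptHom f'))
      rw [h, Preadditive.add_comp, res_add, toTw_add])
    (fun a b f x x' => by simp)
    (fun b f x y => by
      rw [res_toTw, ← res_comp, cptHom_res, comp_whiskerRight, whiskerLeft_comp, Category.assoc])
    (fun a b b' f x y => by
      rw [res_toTw, ← res_comp, ← res_comp, Category.assoc, ← dualCounit_naturality,
        ← whiskerLeft_comp_assoc, ← whiskerLeft_comp_assoc, whisker_exchange])

lemma twPairing_map {c d a b : Cpt T} [ExactPairing d c] {F : Modc T}
    (f : sec ((yo T).obj d.obj) a) (x : sec F b) : (twPairing c d F).map a b f x =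
      toTw (res F (c ◁ (cptHom f ▷ b) ≫ dualCounit c d b) x) := rfl

/-- By Yoneda a pairing is determined by its values at the identity `e` of `d`. The induced map
sends a section `x` over `c ⊗ b` to its pairing with `e`, restricted along the unit `b ⟶ d ⊗ c ⊗ b`;
the triangle identities do the rest. -/
lemma isUniversal_twPairing (c d : Cpt T) [ExactPairing d c] (F : Modc T) :
    (twPairing c d F).IsUniversal := by
  intro K γ
  let e : sec ((yo T).obj d.obj) d := cptSec (𝟙 d)
  have he (b : Cpt T) (x : sec F (c ⊗ b)) :
      res ((tw c).obj F) (dualUnit c d b) ((twPairing c d F).map d (c ⊗ b) e x) = toTw x := by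
    rw [twPairing_map, res_toTw, ← res_comp]
    rw [cptHom_cptSec, id_whiskerRight, whiskerLeft_id, Category.id_comp, whisker_dualUnit_comp,
      res_id]
  have hφ {a b : Cpt T} (f : sec ((yo T).obj d.obj) a) (x : sec F b) :
      res K (dualUnit c d (a ⊗ b)) (γ.map d (c ⊗ a ⊗ b) e
        (res F (c ◁ (cptHom f ▷ b) ≫ dualCounit c d b) x)) = γ.map a b f x := by
    rw [γ.map_res_right, ← res_comp, whiskerLeft_comp, ← Category.assoc, dualUnit_naturality,
      Category.assoc, dualUnit_comp_whisker, Category.comp_id, ← γ.map_res_left, res_cptSec_id]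
  have hψ' {b : Cpt T} (x : sec F (c ⊗ b)) (ψ : (tw c).obj F ⟶ K)
      (hψ : ∀ a b x y, ap ψ (a ⊗ b) ((twPairing c d F).map a b x y) = γ.map a b x y) :
      ap ψ b (toTw x) = res K (dualUnit c d b) (γ.map d (c ⊗ b) e x) := by
    rw [← hψ d (c ⊗ b) e x, ← ap_res, he]
  refine ⟨mkHom (F := (tw c).obj F) (fun b => AddMonoidHom.mk'
    (fun x : sec F (c ⊗ b) => res K (dualUnit c d b) (γ.map d (c ⊗ b) e x))
    (fun x x' => by rw [← map_add]; exact congr_arg _ (map_add (γ.map d (c ⊗ b) e) x x')))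
    (fun {a b} f x => ?_), fun a b f x => ?_, fun ψ hψ => ext fun b x => ?_⟩
  · change res K _ (γ.map d (c ⊗ a) e (res F (c ◁ f) (show sec F (c ⊗ b) from x))) =
      res K f (res K _ (γ.map d (c ⊗ b) e x))
    rw [γ.map_res_right]
    exact res_comp_congr _ (dualUnit_naturality f)
  · exact hφ f x
  · exact hψ' x ψ hψ

end

/-! ### Day products, Serre tensor ideals and annihilators -/

section

variable {T : Type u} [Category.{v} T] [Preadditive T] [HasZeroObject T] [HasShift T ℤ]
  [∀ n : ℤ, (shiftFunctor T n).Additive] [Pretriangulated T] [IsTriangulated T]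
  [MonoidalCategory T] [SymmetricCategory T] [MonoidalClosed T] [IsRigidlyCompactlyGenerated T]

instance : HasBinaryBiproducts (Cpt T) := by
  have : HasCoproducts.{v} T := IsRigidlyCompactlyGenerated.hasCoproducts
  infer_instance

/-- The restriction of a pairing along a morphism in the first variable. -/
def Pairing.precomp {F F' G H : Modc T} (β : Pairing F G H) (φ : F' ⟶ F) : Pairing F' G H :=
  Pairing.mk' (fun a b x y => β.map a b (ap φ a x) y) (fun a b x x' y => by simp)
    (fun a b x y y' => by simp) (fun b f x y => by rw [ap_res, β.map_res_left])
    (fun a _ _ f x y => by rw [β.map_res_right])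

lemma cptSec_add {a d : Cpt T} (f g : a ⟶ d) : cptSec (f + g) = cptSec f + cptSec g := rfl

lemma res_cptSec {a b d : Cpt T} (g : a ⟶ b) (f : b ⟶ d) :
    res _ g (cptSec f) = cptSec (g ≫ f) := rfl

lemma cptSec_cptHom {a d : Cpt T} (f : sec ((yo T).obj d.obj) a) : cptSec (cptHom f) = f := rfl

lemma ap_ofSecYo_cptSec {F : Modc T} {c d : Cpt T} (x : sec F c) (f : d ⟶ c) :
    ap (ofSecYo x) d (cptSec f) = res F f x := rfl

/-- A Day convolution product of finitely presented presheaves is finitely presented. -/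
lemma isFinPres_of_isDayTensor {F G H : Modc T} (hF : IsFinPres F) (hG : IsFinPres G)
    (hH : IsDayTensor F G H) : IsFinPres H := by
  obtain ⟨a, b, α, x, h⟩ := hF
  obtain ⟨β, hβ⟩ := isDayTensor_iff.1 hH
  obtain ⟨a', ⟨_⟩, -⟩ := exists_exactPairing T a
  obtain ⟨b', ⟨_⟩, -⟩ := exists_exactPairing T b
  -- Right exactness of the Day product: the twists by the duals `a'` and `b'` model `y a ⊗ G` and
  -- `y b ⊗ G`, and `H` will be the cokernel of the map `τ` induced by `α`.
  let βa := twPairing a' a G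
  let βb := twPairing b' b G
  have hβb : βb.IsUniversal := isUniversal_twPairing b' b G
  obtain ⟨τ, hτ, -⟩ := isUniversal_twPairing a' a G _ (βb.precomp ((yo T).map α.hom))
  obtain ⟨p, hp, -⟩ := hβb _ (β.precomp (ofSecYo x))
  replace hτ (s t) (f : s ⟶ a) (y : sec G t) :
      ap τ _ (βa.map s t (cptSec f) y) = βb.map s t (cptSec (f ≫ α)) y := hτ s t (cptSec f) y
  replace hp (s t) (f : s ⟶ b) (y : sec G t) :
      ap p _ (βb.map s t (cptSec f) y) = β.map s t (res F f x) y := hp s t (cptSec f) y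
  have hτp : τ ≫ p = 0 := (isUniversal_twPairing a' a G).hom_ext fun s t f y => by
    rw [← cptSec_cptHom f, ap_comp, hτ, hp, (h.rel _).2 ⟨_, rfl⟩, ap_zero, map_zero]
    rfl
  let N := Sub.range τ
  have hN {s t : Cpt T} {f g : s ⟶ b} (y : sec G t) (hfg : res F f x = res F g x) :
      ap N.π _ (βb.map s t (cptSec f) y) = ap N.π _ (βb.map s t (cptSec g) y) := by
    have h0 : res F (f - g) x = 0 := by
      have := (resHom F s x).map_sub f g
      rwa [resHom_apply, resHom_apply, resHom_apply, hfg, sub_self] at this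
    obtain ⟨k, hk⟩ := (h.rel _).1 h0
    have h1 : ap N.π _ (βb.map s t (cptSec (f - g)) y) = 0 := by
      rw [Sub.π_eq_zero_iff, ← hk, ← hτ]
      exact ⟨_, rfl⟩
    have h2 : cptSec f = cptSec (f - g) + cptSec g := by rw [← cptSec_add, sub_add_cancel]
    rw [h2, map_add, AddMonoidHom.add_apply, map_add, h1, zero_add]
  let q := N.desc p fun c y ⟨z, hz⟩ => by rw [← hz, ← ap_comp, hτp, ap_zero]
  choose r hr using fun s => h.gen s
  -- Sections of `F` are lifted to morphisms into `b`; by `hN` the lift does not matter modulo the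
  -- image of `τ`.
  let γ : Pairing F G N.quot := Pairing.mk'
    (fun s t u y => ap N.π _ (βb.map s t (cptSec (r s u)) y))
    (fun s t u u' y => by
      rw [hN y (f := r s (u + u')) (g := r s u + r s u') (by rw [res_add, hr, hr, hr]),
        cptSec_add, map_add, AddMonoidHom.add_apply, map_add])
    (fun s t u y y' => by rw [map_add, map_add])
    (fun {s s'} t f u y => by
      rw [hN y (f := r s _) (g := f ≫ r s' u) (by rw [res_comp, hr, hr]),
        ← ap_res, ← βb.map_res_left, res_cptSec])
    (fun s t t' f u y => by rw [βb.map_res_right, ap_res])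
  obtain ⟨φ, hφ, -⟩ := hβ _ γ
  have hφ' (s t) (f : s ⟶ b) (y : sec G t) : ap φ _ (β.map s t (res F f x) y) =
      ap N.π _ (βb.map s t (cptSec f) y) := (hφ s t _ y).trans (hN y (hr _ _))
  have h₁ : φ ≫ q = 𝟙 H := hβ.hom_ext fun s t u y => by
    obtain ⟨f, rfl⟩ := h.gen s u
    rw [ap_comp, hφ', Sub.desc_π, hp, ap_id]
  have h₂ : q ≫ φ = 𝟙 _ := by
    rw [← cancel_epi N.π, Category.comp_id]
    refine hβb.hom_ext fun s t f y => ?_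
    rw [← cptSec_cptHom f, ap_comp, ap_comp, Sub.desc_π, hp, hφ']
  have hb := isFinPres_tw b' hG
  exact (hb.quot N (isFinGen_range τ (isFinPres_tw a' hG).isFinGen)).of_iso ⟨q, φ, h₂, h₁⟩

/-- The twist of the presheaf of a compact object is the presheaf of the tensor product with the
dual. -/
lemma nonempty_yo_tensor_iso (c d x : Cpt T) [ExactPairing d c] :
    Nonempty ((yo T).obj (d ⊗ x).obj ≅ (tw c).obj ((yo T).obj x.obj)) := by
  let φ : (yo T).obj (d ⊗ x).obj ⟶ (tw c).obj ((yo T).obj x.obj) :=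
    ofSecYo (toTw (cptSec (dualCounit c d x)))
  have hφ (b : Cpt T) (f : b ⟶ d ⊗ x) : ap φ b (cptSec f) =
      toTw (cptSec (((tensorLeftAdjunction d c).homEquiv b x).symm f)) := by
    rw [Adjunction.homEquiv_counit]
    rfl
  have : IsIso φ := isIso_of_bijective φ fun b =>
    ⟨fun f g hfg => ?_, fun g => ?_⟩
  · exact ⟨asIso φ⟩
  · have hfg : ap φ b (cptSec (cptHom f)) = ap φ b (cptSec (cptHom g)) := hfg
    rw [hφ, hφ] at hfg
    have := ((tensorLeftAdjunction d c).homEquiv b x).symm.injective (congr_arg cptHom hfg)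
    exact congr_arg cptSec this
  · obtain ⟨f, hf⟩ := ((tensorLeftAdjunction d c).homEquiv b x).symm.surjective (cptHom (d := x) g)
    exact ⟨cptSec f, (hφ b f).trans (congr_arg cptSec hf)⟩

section Ideal

variable {B : ObjectProperty (Modc T)} (hB : IsSerreTensorIdeal B)
include hB

lemma IsSerreTensorIdeal.isSerreFP : IsSerreFP B where
  le F hF := (isFP_iff F).1 (hB.le_isFP F hF)
  zero := by
    have := hB.containsZero
    obtain ⟨Z, hZ, h⟩ := B.exists_prop_of_containsZero
    exact ⟨Z, hZ, h⟩
  serre E hE h₁ h₂ h₃ := hB.serre E hE ((isFP_iff _).2 h₁) ((isFP_iff _).2 h₂) ((isFP_iff _).2 h₃)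

lemma IsSerreTensorIdeal.tw (c : Cpt T) {F : Modc T} (hF : B F) : B ((tw c).obj F) := by
  obtain ⟨d, -, ⟨_⟩⟩ := exists_exactPairing T c
  exact hB.tensor _ _ _ (isFP_yo d) hF (isDayTensor_iff.2 ⟨_, isUniversal_twPairing c d F⟩)

lemma IsSerreTensorIdeal.yo_tensor (c : Cpt T) {x : Cpt T} (hx : B ((yo T).obj x.obj)) :
    B ((yo T).obj (c ⊗ x).obj) := by
  obtain ⟨d, ⟨_⟩, -⟩ := exists_exactPairing T c
  obtain ⟨e⟩ := nonempty_yo_tensor_iso d c x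
  exact hB.isSerreFP.of_iso e.symm (hB.tw d hx)

end Ideal

/-- The finitely presented presheaves without nonzero morphisms to the twists of `I`. -/
def annIdeal (I : Modc T) : ObjectProperty (Modc T) := fun F =>
  isFP T F ∧ ∀ (c : Cpt T) (f : F ⟶ (tw c).obj I), f = 0

/-- Twists of `I` are injective, so maps to them form exact functors and the Serre property follows.
Allowing all twists gives the ideal property: fixing a section of `F` over `s` turns a map from `F ⊗
G` to the twist by `c` into a map from `G` to the twist by `c ⊗ s`. -/
lemma isSerreTensorIdeal_annIdeal (I : Modc T) [Injective I] :
    IsSerreTensorIdeal (annIdeal I) where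
  le_isFP F hF := hF.1
  containsZero :=
    let h := isZero_zero (Modc T)
    ⟨_, h, (isFP_iff _).2 (isFinPres_of_isZero h), fun _ _ => h.eq_of_src _ _⟩
  serre E hE h₁ h₂ h₃ := by
    have := hE.mono_f
    have := hE.epi_g
    refine ⟨fun h => ⟨⟨h₁, fun c f => ?_⟩, h₃, fun c f => ?_⟩, fun h => ⟨h₂, fun c f => ?_⟩⟩
    · exact (Injective.comp_factorThru f E.f).symm.trans
        ((congr_arg (E.f ≫ ·) (h.2 c (Injective.factorThru f E.f))).trans comp_zero)
    · rw [← cancel_epi E.g, h.2 c (E.g ≫ f), comp_zero]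
    · exact (hE.exact.g_desc f (h.1.2 c _)).symm.trans
        ((congr_arg (E.g ≫ ·) (h.2.2 c (hE.exact.desc f (h.1.2 c _)))).trans comp_zero)
  tensor F G H hF hG hH := by
    refine ⟨(isFP_iff _).2 (isFinPres_of_isDayTensor ((isFP_iff _).1 hF) ((isFP_iff _).1 hG.1) hH),
      fun c h => ?_⟩
    obtain ⟨β, hβ⟩ := isDayTensor_iff.1 hH
    refine hβ.hom_ext fun s t u y => ?_
    let m (t : Cpt T) (y : sec G t) : sec I (c ⊗ s ⊗ t) := ap h (s ⊗ t) (β.map s t u y)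
    have hm {t t' : Cpt T} (f : t ⟶ t') (y : sec G t') :
        m t (res G f y) = res I (c ◁ s ◁ f) (m t' y) :=
      (congr_arg (ap h _) (β.map_res_right f u y)).trans (ap_res h _ _)
    let ψ : G ⟶ (tw (c ⊗ s)).obj I := mkHom (G := (tw (c ⊗ s)).obj I)
      (fun t => AddMonoidHom.mk' (fun y => toTw (res I (α_ c s t).hom (m t y)))
        fun y y' => by
          have : m t (y + y') = m t y + m t y' := by
            change ap h _ _ = ap h _ _ + ap h _ _
            rw [map_add, map_add]
            rfl
          rw [this, map_add, toTw_add])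
      (fun {t t'} f y => by
        change toTw (res I _ (m t (res G f y))) = _
        rw [hm]
        exact congr_arg toTw (res_comp_congr _ (associator_naturality_right c s f).symm))
    have h0 : res I (α_ c s t).hom (m t y) = 0 :=
      (congr_arg (fun φ => ap φ t y) (hG.2 _ ψ) :)
    have h1 : m t y = 0 := by
      have := congr_arg (res I (α_ c s t).inv) h0
      rwa [res_comp_eq_self _ (Iso.inv_hom_id _), map_zero] at this
    exact h1

lemma annIdeal_yo_iff {I : Modc T} (x : Cpt T) : annIdeal I ((yo T).obj x.obj) ↔
    ∀ (c : Cpt T) (z : sec I (c ⊗ x)), z = 0 := by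
  refine ⟨fun h c z => ?_, fun h => ⟨isFP_yo x, fun c f => yo_hom_ext ?_⟩⟩
  · have := congr_arg (fun φ => ap φ x (cptSec (𝟙 x))) (h.2 c (ofSecYo (toTw z)))
    rw [ap_ofSecYo_cptSec, res_id] at this
    exact this
  · exact h c _

/-- A maximal Serre tensor ideal is determined by any nonzero injective torsion-free object. -/
lemma HomologicalSpectrum.carrier_eq_annIdeal (B : HomologicalSpectrum T) (I : Modc T)
    [Injective I] (hI : IsTorsionFree B.carrier I) {b : Cpt T} {z : sec I b} (hz : z ≠ 0) :
    B.carrier = annIdeal I := by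
  refine (B.maximal _ (isSerreTensorIdeal_annIdeal I) (fun h => ?_) fun F hF => ?_).symm
  -- Properness: if the annihilator contained `y 𝟙`, then `I(b ⊗ 𝟙)` would vanish, against `z ≠ 0`.
  · have h1 : annIdeal I ((yo T).obj (𝟙_ (Cpt T)).obj) := by
      rw [h]
      exact isFP_yo _
    have h2 := (annIdeal_yo_iff _).1 h1 b (res I (ρ_ b).hom z)
    apply hz
    have := congr_arg (res I (ρ_ b).inv) h2
    rwa [res_comp_eq_self _ (Iso.inv_hom_id _), map_zero] at this
  -- By duality a map from `F` to a twist of `I` is a map from a twist of `F` to `I`, and `B` is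
  -- stable under twists.
  · refine ⟨B.isIdeal.le_isFP F hF, fun c f => ?_⟩
    obtain ⟨d, ⟨_⟩, -⟩ := exists_exactPairing T c
    apply ((twAdj d c).homEquiv F I).symm.injective
    rw [hI _ (B.isIdeal.tw d hF) (((twAdj d c).homEquiv F I).symm f),
      hI _ (B.isIdeal.tw d hF) (((twAdj d c).homEquiv F I).symm 0)]

end

/-! ### Residue objects, supports and the comparison map -/

section

variable {T : Type u} [Category.{v} T] [Preadditive T] [HasZeroObject T] [HasShift T ℤ]
  [∀ n : ℤ, (shiftFunctor T n).Additive] [Pretriangulated T] [IsTriangulated T]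
  [MonoidalCategory T] [SymmetricCategory T] [MonoidalClosed T] [IsRigidlyCompactlyGenerated T]

lemma forall_sec_eq_zero_of_iso {I : Modc T} {a b : Cpt T} (e : a ≅ b)
    (h : ∀ z : sec I a, z = 0) (z : sec I b) : z = 0 := by
  have := congr_arg (res I e.inv) (h (res I e.hom z))
  rwa [res_comp_eq_self _ (Iso.inv_hom_id _), map_zero] at this

/-- Tensoring `y 𝟙` with `b` gives `y b`, and every finitely presented functor is a quotient of some
`y b`; so `y 𝟙` in the ideal would contradict properness. -/
lemma HomologicalSpectrum.not_carrier_yo_unit (B : HomologicalSpectrum T) :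
    ¬ B.carrier ((yo T).obj (𝟙_ (Cpt T)).obj) := by
  have : HasCoproducts.{v} T := IsRigidlyCompactlyGenerated.hasCoproducts
  have hS := B.isIdeal.isSerreFP
  refine fun h => B.proper (le_antisymm B.isIdeal.le_isFP fun F hF => ?_)
  obtain ⟨a, b, α, ⟨e⟩⟩ := hF
  have hb := hS.of_iso ((yo T).mapIso ((isCompact T).ι.mapIso (ρ_ b))) (B.isIdeal.yo_tensor b h)
  exact hS.of_epi (weakKernels_cpt T) (cokernel.π ((yo T).map α) ≫ e.hom) hb
    ((isFP_iff _).1 ⟨a, b, α, ⟨e⟩⟩)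

/-- Every homological prime has a pure injective object, and this detects the prime. -/
theorem HomologicalSpectrum.exists_residueObject (B : HomologicalSpectrum T) :
    ∃ E : T, IsResidueObject B.carrier E ∧ IsTorsionFree B.carrier ((yo T).obj E) ∧
      ∃ (b : Cpt T) (z : sec ((yo T).obj E) b), z ≠ 0 := by
  have : HasCoproducts.{v} T := IsRigidlyCompactlyGenerated.hasCoproducts
  have : EssentiallySmall.{v} (Cpt T) := IsRigidlyCompactlyGenerated.essentiallySmall
  have hS := B.isIdeal.isSerreFP
  obtain ⟨R, adj, J, i, hi, I, φ, ⟨e⟩, hI, hIt, hφ⟩ :=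
    exists_injectiveHull_localization hS (weakKernels_cpt T) ((yo T).obj (𝟙_ T))
  obtain ⟨E, ⟨e'⟩⟩ := exists_yo_iso_of_injective I
  refine ⟨E, ⟨Injective.of_iso e'.symm hI, R, adj, J, i, hi, ⟨e' ≪≫ e⟩⟩, fun F hF f => ?_, ?_⟩
  · rw [← cancel_mono e'.hom, hIt F hF (f ≫ e'.hom), zero_comp]
  -- If `y E` were zero, the identity section of `y 𝟙` would be torsion, exhibiting `y 𝟙` as a
  -- quotient of an object of `B`.
  · by_contra! h0
    obtain ⟨F, hF, k, s, hs⟩ := hφ (𝟙_ (Cpt T)) (cptSec (𝟙 _)) (by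
      apply injective_of_mono e'.inv
      rw [h0 _ (ap e'.inv _ _), map_zero])
    have : Epi k := epi_of_surjective k fun a f =>
      ⟨res F (cptHom (d := 𝟙_ (Cpt T)) f) s, by
        rw [ap_res, hs]
        exact res_cptSec_id (d := 𝟙_ (Cpt T)) f⟩
    exact B.not_carrier_yo_unit
      (hS.of_epi (weakKernels_cpt T) k hF ((isFP_iff _).1 (isFP_yo (𝟙_ (Cpt T)))))

lemma HomologicalSpectrum.carrier_yo_iff (B : HomologicalSpectrum T) {I : Modc T}
    [Injective I] (hI : IsTorsionFree B.carrier I) {b : Cpt T} {z : sec I b} (hz : z ≠ 0)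
    (x : Cpt T) : B.carrier ((yo T).obj x.obj) ↔ ∀ (c : Cpt T) (z : sec I (c ⊗ x)), z = 0 := by
  rw [B.carrier_eq_annIdeal I hI hz, annIdeal_yo_iff]

lemma HomologicalSpectrum.exists_carrier_iff (B : HomologicalSpectrum T) :
    ∃ E : T, IsResidueObject B.carrier E ∧ ∀ x : T, isCompact T x →
      (B.carrier ((yo T).obj x) ↔ ∀ (c : T), isCompact T c → ∀ g : c ⊗ x ⟶ E, g = 0) := by
  obtain ⟨E, hE, ht, b, z, hz⟩ := B.exists_residueObject
  have := hE.1
  refine ⟨E, hE, fun x hx => ?_⟩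
  rw [B.carrier_yo_iff ht hz ⟨x, hx⟩]
  exact ⟨fun h c hc g => h ⟨c, hc⟩ (yoSec g), fun h c g => h c.obj c.property (ofYoSec g)⟩

lemma HomologicalSpectrum.isTorsionFree_tw (B : HomologicalSpectrum T) {I : Modc T}
    [Injective I] (hI : IsTorsionFree B.carrier I) {b : Cpt T} {z : sec I b} (hz : z ≠ 0)
    (d : Cpt T) : IsTorsionFree B.carrier ((tw d).obj I) := fun F hF => by
  rw [B.carrier_eq_annIdeal _ hI hz] at hF
  exact hF.2 d

/-- If `y b` is not in `B`, the twist of `I` by `b` is again a nonzero torsion-free injective, so it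
detects `B` too. Its test for `a` is the test of `I` for `a ⊗ b`, up to associativity and symmetry.
-/
lemma HomologicalSpectrum.carrier_or_carrier (B : HomologicalSpectrum T) {I : Modc T}
    [Injective I] (hI : IsTorsionFree B.carrier I) {c : Cpt T} {z : sec I c} (hz : z ≠ 0)
    (a b : Cpt T) (h : B.carrier ((yo T).obj (a ⊗ b).obj)) :
    B.carrier ((yo T).obj a.obj) ∨ B.carrier ((yo T).obj b.obj) := by
  rw [or_iff_not_imp_right]
  intro hb
  rw [B.carrier_yo_iff hI hz] at h hb
  push Not at hb
  obtain ⟨d, w, hw⟩ := hb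
  have key (e : Cpt T) (w : sec I (b ⊗ (e ⊗ a))) : w = 0 :=
    forall_sec_eq_zero_of_iso ((α_ e a b).symm ≪≫ β_ (e ⊗ a) b) (h e) w
  have hw' : res I (β_ b d).hom w ≠ 0 := fun h0 => hw (by
    have := congr_arg (res I (β_ b d).inv) h0
    rwa [res_comp_eq_self _ (Iso.inv_hom_id _), map_zero] at this)
  have ht := B.isTorsionFree_tw hI hz b
  have hw'' : toTw (res I (β_ b d).hom w) ≠ 0 := hw'
  exact (B.carrier_yo_iff ht hw'' a).2 key

section
variable {E : T}

lemma tensor_hom_eq_zero_obj₂ {t : Triangle T} (ht : t ∈ distTriang T) (c : T)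
    (h₁ : ∀ g : c ⊗ t.obj₁ ⟶ E, g = 0) (h₃ : ∀ g : c ⊗ t.obj₃ ⟶ E, g = 0)
    (g : c ⊗ t.obj₂ ⟶ E) : g = 0 := by
  obtain ⟨_, _⟩ := IsRigidlyCompactlyGenerated.exact_tensorLeft c
  obtain ⟨k, hk⟩ := Triangle.yoneda_exact₂ _ ((tensorLeft c).map_distinguished t ht) g (h₁ _)
  rw [hk, show k = 0 from h₃ k]
  exact comp_zero

/-- Exactness in both variables moves the shift from `x` to `c`, where it is absorbed since `c`
ranges over all compacts. -/
lemma tensor_shift_hom_eq_zero {x : T} (n : ℤ)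
    (h : ∀ c, isCompact T c → ∀ g : c ⊗ x ⟶ E, g = 0)
    (c : T) (hc : isCompact T c) (g : c ⊗ x⟦n⟧ ⟶ E) : g = 0 := by
  obtain ⟨_, _⟩ := IsRigidlyCompactlyGenerated.exact_tensorLeft c
  obtain ⟨_, _⟩ := IsRigidlyCompactlyGenerated.exact_tensorRight x
  let e : c⟦n⟧ ⊗ x ≅ c ⊗ x⟦n⟧ := ((tensorRight x).commShiftIso n).app c ≪≫
    (((tensorLeft c).commShiftIso n).app x).symm
  rw [← cancel_epi e.hom, comp_zero]
  have : HasCoproducts.{v} T := IsRigidlyCompactlyGenerated.hasCoproducts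
  exact h _ (isCompact_shift hc n) _

end

/-- The compact objects whose restricted Yoneda presheaf lies in a homological prime. -/
def HomologicalSpectrum.preimage (B : HomologicalSpectrum T) : ObjectProperty T :=
  fun x => isCompact T x ∧ B.carrier ((yo T).obj x)

instance (B : HomologicalSpectrum T) : B.preimage.IsClosedUnderIsomorphisms where
  of_iso e h := by
    have : HasCoproducts.{v} T := IsRigidlyCompactlyGenerated.hasCoproducts
    exact ⟨(isCompact T).prop_of_iso e h.1, B.isIdeal.isSerreFP.of_iso ((yo T).mapIso e) h.2⟩

/-- The comparison map from the homological spectrum to the Balmer spectrum. -/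
def comparisonMap (B : HomologicalSpectrum T) : BalmerSpectrum T :=
  have : HasCoproducts.{v} T := IsRigidlyCompactlyGenerated.hasCoproducts
  { carrier := B.preimage
    le_isCompact := fun _ h => h.1
    triangulated := by
      -- Testing membership by maps `c ⊗ x ⟶ E` turns closure under triangles into exactness of Hom.
      obtain ⟨E, -, hE⟩ := B.exists_carrier_iff
      exact
        { exists_zero := ⟨_, isZero_zero T, isCompact_of_isZero (isZero_zero T),
            B.isIdeal.isSerreFP.of_isZero ((yo T).map_isZero (isZero_zero T))⟩
          isStableUnderShiftBy n := ⟨fun x hx => ⟨isCompact_shift hx.1 n,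
            (hE _ (isCompact_shift hx.1 n)).2
              (tensor_shift_hom_eq_zero n ((hE _ hx.1).1 hx.2))⟩⟩
          toIsTriangulatedClosed₂ := .mk' fun t ht h₁ h₃ => by
            have h₂ := (isCompact T).ext_of_isTriangulatedClosed₂ t ht h₁.1 h₃.1
            exact ⟨h₂, (hE _ h₂).2 fun c hc => tensor_hom_eq_zero_obj₂ ht c
              ((hE _ h₁.1).1 h₁.2 c hc) ((hE _ h₃.1).1 h₃.2 c hc)⟩ }
    thick := ⟨fun {x y} r hy => by
      obtain ⟨E, -, hE⟩ := B.exists_carrier_iff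
      have hx := isCompact_of_retract r hy.1
      refine ⟨hx, (hE _ hx).2 fun c hc g => ?_⟩
      have := (hE _ hy.1).1 hy.2 c hc (c ◁ r.r ≫ g)
      rw [← Category.id_comp g, ← whiskerLeft_id, ← r.retract, whiskerLeft_comp, Category.assoc,
        this, comp_zero]⟩
    tensor := fun a b ha hb => ⟨(isCompact T).prop_tensor ha hb.1,
      B.isIdeal.yo_tensor ⟨a, ha⟩ (x := ⟨b, hb.1⟩) hb.2⟩
    proper := fun h => B.not_carrier_yo_unit
      (Eq.mpr (congr_fun h (𝟙_ (Cpt T)).obj) (𝟙_ (Cpt T)).property).2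
    prime := fun a b ha hb h => by
      obtain ⟨E, hE, ht, c, z, hz⟩ := B.exists_residueObject
      have := hE.1
      exact (B.carrier_or_carrier ht hz ⟨a, ha⟩ ⟨b, hb⟩ h.2).imp (⟨ha, ·⟩) (⟨hb, ·⟩) }

lemma isoMod_of_isZero {S : ObjectProperty (Modc T)} (hS : IsSerreFP S) {Z X : Modc T}
    (hZ : IsZero Z) (hX : S X) (f : Z ⟶ X) : isoMod S f := by
  have hf : f = 0 := hZ.eq_of_src _ _
  refine ⟨ObjectProperty.le_ind _ _ (hS.of_isZero ?_), ObjectProperty.le_ind _ _ ?_⟩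
  · exact IsZero.of_mono (kernel.ι f) hZ
  · rw [hf]
    exact hS.of_iso cokernelZeroIsoTarget.symm hX

/-- The quotient functor identifies an object `F` of `S` with zero, so by adjunction `F` has no
nonzero map to `R J`. This covers every choice of residue object. -/
lemma IsResidueObject.isTorsionFree {S : ObjectProperty (Modc T)} (hS : IsSerreFP S) {E : T}
    (hE : IsResidueObject S E) : IsTorsionFree S ((yo T).obj E) := by
  obtain ⟨-, R, adj, J, i, -, ⟨e⟩⟩ := hE
  intro F hF f
  rw [← cancel_mono e.hom]
  apply (adj.homEquiv F J).symm.injective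
  have hZ := isZero_zero (Modc T)
  let u : (HasZeroObject.zero' (Modc T)).1 ⟶ F := 0
  have : IsIso ((isoMod S).Q.map u) := Localization.inverts _ _ _ (isoMod_of_isZero hS hZ hF u)
  rw [← cancel_epi ((isoMod S).Q.map u), ← adj.homEquiv_naturality_left_symm,
    ← adj.homEquiv_naturality_left_symm]
  exact congr_arg _ (hZ.eq_of_src _ _)

/-- If `y x ∈ B`, then `y (x ⊗ c) ∈ B` has no nonzero map to the torsion-free `y E`, so `[x, E]`
receives no nonzero map from a compact and is zero. Conversely, if `[x, E] = 0` for the residue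
object of `exists_carrier_iff`, its test puts `y x` in `B`. -/
lemma mem_homologicalSupport_iff (B : HomologicalSpectrum T) (x : Cpt T) :
    B ∈ homologicalSupport x.obj ↔ ¬ B.carrier ((yo T).obj x.obj) := by
  constructor
  · rintro ⟨E, hE, h⟩ hx
    refine h (IsRigidlyCompactlyGenerated.isZero_of_compact _ fun c hc f => ?_)
    apply ((ihom.adjunction x.obj).homEquiv c E).symm.injective
    have ht := hE.isTorsionFree B.isIdeal.isSerreFP _
      (B.isIdeal.isSerreFP.of_iso ((yo T).mapIso (β_ c x.obj))
        (B.isIdeal.yo_tensor ⟨c, hc⟩ hx))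
    have key (g : x.obj ⊗ c ⟶ E) : g = 0 := by
      have := congr_arg (fun φ => ap φ (x ⊗ ⟨c, hc⟩) (yoSec (𝟙 _))) (ht ((yo T).map g))
      exact (Category.id_comp g).symm.trans this
    rw [key (((ihom.adjunction x.obj).homEquiv c E).symm f),
      key (((ihom.adjunction x.obj).homEquiv c E).symm 0)]
  · intro h
    obtain ⟨E, hE, hE'⟩ := B.exists_carrier_iff
    refine ⟨E, hE, fun h0 => h ((hE' _ x.property).2 fun c hc g => ?_)⟩
    rw [← cancel_epi (β_ x.obj c).hom]
    apply ((ihom.adjunction x.obj).homEquiv c E).injective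
    exact h0.eq_of_tgt _ _

lemma isInducing_comparisonMap : Topology.IsInducing (comparisonMap (T := T)) where
  eq_induced := by
    refine Eq.trans ?_ (induced_generateFrom_eq).symm
    refine congr_arg TopologicalSpace.generateFrom (Set.ext fun U => ?_)
    have h (x : Cpt T) : (homologicalSupport x.obj)ᶜ =
        comparisonMap ⁻¹' (balmerSupport x.obj)ᶜ := by
      ext B
      rw [Set.mem_compl_iff, mem_homologicalSupport_iff]
      exact ⟨fun h h' => h fun h'' => h' ⟨x.property, h''⟩, fun h h' => h fun h'' => h' h''.2⟩
    constructor
    · rintro ⟨x, rfl⟩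
      exact ⟨_, ⟨x, rfl⟩, (h x).symm⟩
    · rintro ⟨_, ⟨x, rfl⟩, rfl⟩
      exact ⟨x, (h x).symm⟩

instance : T0Space (BalmerSpectrum T) where
  t0 P Q h := by
    have key (x : Cpt T) : P.carrier x.obj ↔ Q.carrier x.obj := by
      have := (inseparable_iff_forall_isOpen.1 h) (balmerSupport x.obj)ᶜ
        (TopologicalSpace.isOpen_generateFrom_of_mem ⟨x, rfl⟩)
      simpa [balmerSupport] using this
    ext x
    exact ⟨fun hx => (key ⟨x, P.le_isCompact x hx⟩).1 hx,
      fun hx => (key ⟨x, Q.le_isCompact x hx⟩).2 hx⟩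

end

end

end HomSpec

theorem theorem4p17 (T : Type u) [Category.{v} T] [Preadditive T] [HasZeroObject T]
    [HasShift T ℤ] [∀ n : ℤ, (shiftFunctor T n).Additive] [Pretriangulated T] [IsTriangulated T]
    [MonoidalCategory T] [SymmetricCategory T] [MonoidalClosed T]
    [HomSpec.IsRigidlyCompactlyGenerated T] :
    ∃ φ : HomSpec.HomologicalSpectrum T → HomSpec.BalmerSpectrum T,
      HomSpec.IsComparisonMap φ ∧ Continuous φ ∧
      (Function.Injective φ ↔ T0Space (HomSpec.HomologicalSpectrum T)) := by
  refine ⟨HomSpec.comparisonMap, fun B C => Iff.rfl, HomSpec.isInducing_comparisonMap.continuous,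
    fun h => ⟨fun B B' hB => ?_⟩, fun h B B' hB => ?_⟩
  -- An inducing map preserves and reflects inseparability; the first case uses that the Balmer
  -- spectrum is `T₀`, the second that the homological spectrum is.
  · exact h (HomSpec.isInducing_comparisonMap.inseparable_iff.2 hB).eq
  · exact (HomSpec.isInducing_comparisonMap.inseparable_iff.1 (.of_eq hB)).eq
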